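/- \textbf{Setting.} A finite two-player zero-sum extensive-form game of height $H\ge 1$ with perfect recall consists of: a finite tree of states $\mathcal S$ with root $s_1$, of depths $0,\dots,H-1$; partitions of $\mathcal S$ into the information sets $\mathcal X$ of the min-player and $\mathcal Y$ of the max-player; finite action sets $\mathcal A,\mathcal B$; transition probabilities $p(\cdot\mid s,a,b)$ from each state of depth $h<H-1$ to states of depth $h+1$, supported on the children of $s$ reached by $(a,b)$; and losses $\ell(s,a,b)\in[0,1]$. Perfect recall means that each $x\in\mathcal X$ determines the unique path $(x_0,a_0,\dots,x_{h-1},a_{h-1},x)$ of information sets and own actions leading to it, and likewise for $\mathcal Y$. In an episode, at each depth $h=0,\dots,H-1$ the players see the information sets $x_h,y_h$ of the current state $s_h$, draw independently $a_h\sim\mu(\cdot\mid x_h)$, $b_h\sim\nu(\cdot\mid y_h)$, observe $\ell_h=\ell(s_h,a_h,b_h)$, and the state moves according to $p$. Let $K=|\mathcal A||\mathcal X|+|\mathcal B||\mathcal Y|$, let $\ell(\mu,\nu)=\mathbb E_{\mu,\nu}\big[\sum_{h=0}^{H-1}\ell_h\big]$, and \[\mathrm{EG}(\mu,\nu)=\max_{\nu'}\ell(\mu,\nu')-\min_{\mu'}\ell(\mu',\nu).\]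 The sequence form of a policy $\mu$ is $\mu_{\to x_h}(a_h)=\prod_{h'=0}^{h}\mu(a_{h'}\mid x_{h'})$ along the unique path leading to $x_h$; similarly for $\nu$. \textbf{Algorithm.} Given $\eta,\tau>0$, an integer $T_0\ge 2$ and $\delta>0$, put $\eta^t=\eta\,(t+T_0)^{-3/4}$, $\tau^t=\tau\log\!\big(\tfrac{t+T_0}{\delta}\big)(t+T_0)^{-1/4}$. Let $\Psi(m)=-\sum_i\log m_i$ on vectors with positive entries, with Bregman divergence $D_\Psi(m,m')=\Psi(m)-\Psi(m')-\langle\nabla\Psi(m'),m-m'\rangle$. The min-player starts from the uniform policy $\mu^0$. At every iteration $t=0,1,2,\dots$ one episode is played with $(\mu^t,\nu^t)$, and then \[\mu^{t+1}=\operatorname*{argmin}_{\mu}\; D_\Psi(\mu_\to,\mu^t_\to)+\eta^t\langle\hat\ell^t_{\min},\mu_\to\rangle,\qquad \hat\ell^t_{\min}=\sum_{h=0}^{H-1}\frac{\ell^t_h}{\mu^t_{\to x^t_h}(a^t_h)}\mathbf 1_{(x^t_h,a^t_h)}+\tau^t\nabla\Psi(\mu^t_\to),\] the minimum being over policies with positive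 probabilities. The max-player does the same for $\nu^t$ on $(\mathcal Y,\mathcal B)$, with $1-\ell^t_h$ in place of $\ell^t_h$. \textbf{Theorem.} For every $K$ and every $\delta>0$ there is a constant $c=c(K,\delta)>0$ such that the following holds for every finite two-player zero-sum extensive-form game with perfect recall with $|\mathcal A||\mathcal X|+|\mathcal B||\mathcal Y|=K$. If both players run the algorithm with parameters $\eta,\tau>0$ and $T_0\in\mathbb N$, $T_0\ge2$, satisfying \[\frac1{\eta\tau}\le c,\qquad \eta\le c,\qquad \eta\tau\le\frac{T_0}{\log(T_0)^4},\qquad T_0\le\log(1/\delta)^2\,\tau^4,\] then with probability at least $1-\delta$, simultaneously for all $t\in\mathbb N$, \[\mathrm{EG}(\mu^t,\nu^t)\le 2K\tau\log\!\Big(\frac{t+T_0}{\delta}\Big)(t+T_0)^{-1/4}.\] -/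

import Mathlib

open MeasureTheory

/-- A forest of decision points: `prev x` is the decision point and the action taken there that
immediately precede `x` (`none` if `x` is initial), and `depth x` is the number of decision points
strictly before `x`. -/
structure DecisionTree (X A : Type*) where
  prev : X → Option (X × A)
  depth : X → ℕ
  depth_of_none : ∀ x, prev x = none → depth x = 0
  depth_of_some : ∀ x p, prev x = some p → depth x = depth p.1 + 1

/-- A (behavioural) policy: a probability distribution `μ(· | x)` on actions for every `x`. -/
def IsPolicy {X A : Type*} [Fintype A] (μ : X → A → ℝ) : Prop :=
  (∀ x a, 0 ≤ μ x a) ∧ ∀ x, ∑ a, μ x a = 1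

/-- A policy that gives positive probability to every action. -/
def IsInteriorPolicy {X A : Type*} [Fintype A] (μ : X → A → ℝ) : Prop :=
  IsPolicy μ ∧ ∀ x a, 0 < μ x a

/-- The uniform policy. -/
noncomputable def uniformPolicy (X A : Type*) [Fintype A] : X → A → ℝ :=
  fun _ _ => 1 / (Fintype.card A : ℝ)

/-- The sequence form of a policy: the product of the probabilities `μ(a' | x')` along the unique
path `(x₁, a₁, …, x, a)` that leads to `x` and then plays `a`. -/
noncomputable def DecisionTree.seqForm {X A : Type*} (T : DecisionTree X A) (μ : X → A → ℝ)
    (x : X) (a : A) : ℝ :=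
  μ x a * match _h : T.prev x with
    | none => 1
    | some p => T.seqForm μ p.1 p.2
termination_by T.depth x
decreasing_by
  have := T.depth_of_some x p _h
  omega

/-- The log-barrier `Ψ(m) = -∑ log m(x, a)`, on vectors with positive entries. -/
noncomputable def logBarrier {X A : Type*} [Fintype X] [Fintype A] (m : X → A → ℝ) : ℝ :=
  -∑ x, ∑ a, Real.log (m x a)

/-- The gradient of the log-barrier. -/
noncomputable def logBarrierGrad {X A : Type*} (m : X → A → ℝ) : X → A → ℝ :=
  fun x a => -(m x a)⁻¹

/-- The scalar product on vectors indexed by pairs `(x, a)`. -/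
def pairing {X A : Type*} [Fintype X] [Fintype A] (f m : X → A → ℝ) : ℝ :=
  ∑ x, ∑ a, f x a * m x a

/-- The Bregman divergence of the log-barrier. -/
noncomputable def logBarrierDiv {X A : Type*} [Fintype X] [Fintype A] (m m' : X → A → ℝ) : ℝ :=
  logBarrier m - logBarrier m' - pairing (logBarrierGrad m') (m - m')

/-- `μ'` is the mirror descent update of `μ` with learning rate `c` and step `ξ`, for the dilated
log-barrier: it minimizes `D_Ψ(·, μ) + c ⟨ξ, ·⟩`, computed on sequence forms. The minimum is over
the policies on which the barrier is finite. -/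
def DecisionTree.IsMirrorStep {X A : Type*} [Fintype X] [Fintype A] (T : DecisionTree X A)
    (c : ℝ) (ξ : X → A → ℝ) (μ μ' : X → A → ℝ) : Prop :=
  IsInteriorPolicy μ' ∧
    IsMinOn
      (fun κ : X → A → ℝ =>
        logBarrierDiv (T.seqForm κ) (T.seqForm μ) + c * pairing ξ (T.seqForm κ))
      {κ | IsInteriorPolicy κ} μ'

/-- A finite two-player zero-sum extensive-form game with perfect recall: states `S`, information
sets `X` with actions `A` (min-player), information sets `Y` with actions `B` (max-player).
Depths are counted from `0`, so that an episode visits states of depth `0, …, H - 1`. -/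
structure ExtensiveGame (S X Y A B : Type*) [Fintype S] where
  H : ℕ
  H_pos : 0 < H
  /-- The tree of states; a state other than the root is reached from one state by one pair of
  actions. -/
  tree : DecisionTree S (A × B)
  root : S
  prev_eq_none_iff : ∀ s, tree.prev s = none ↔ s = root
  depth_lt : ∀ s, tree.depth s < H
  /-- `trans s a b s'` is the probability of moving to `s'` when `(a, b)` is played at `s`. -/
  trans : S → A → B → S → ℝ
  trans_nonneg : ∀ s a b s', 0 ≤ trans s a b s'
  trans_sum : ∀ s a b, tree.depth s + 1 < H → ∑ s', trans s a b s' = 1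
  trans_tree : ∀ s a b s', trans s a b s' ≠ 0 → tree.prev s' = some (s, (a, b))
  /-- The loss of the min-player; the depth is determined by the state. -/
  loss : S → A → B → ℝ
  loss_mem : ∀ s a b, loss s a b ∈ Set.Icc (0 : ℝ) 1
  /-- The partition of the states into the information sets of the min-player. -/
  infoMin : S → X
  infoMin_surjective : Function.Surjective infoMin
  minTree : DecisionTree X A
  /-- Perfect recall: an information set determines the previous one and the action played. -/
  recall_min : ∀ s,
    minTree.prev (infoMin s) = (tree.prev s).map fun p => (infoMin p.1, p.2.1)
  /-- The partition of the states into the information sets of the max-player. -/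
  infoMax : S → Y
  infoMax_surjective : Function.Surjective infoMax
  maxTree : DecisionTree Y B
  recall_max : ∀ s,
    maxTree.prev (infoMax s) = (tree.prev s).map fun p => (infoMax p.1, p.2.2)

namespace ExtensiveGame

variable {S X Y A B : Type*} [Fintype S]

/-- A play of one episode: the state and the two actions `(s_h, a_h, b_h)` at each depth. -/
abbrev Play (G : ExtensiveGame S X Y A B) : Type _ := Fin G.H → S × A × B

open Classical in
/-- The probability that the environment produces the state of `z` at depth `h`, given the
states and actions of `z` at the previous depth. -/
noncomputable def arrivalProb (G : ExtensiveGame S X Y A B) (z : G.Play) (h : Fin G.H) : ℝ :=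
  if (h : ℕ) = 0 then (if (z h).1 = G.root then 1 else 0)
  else
    let y := z ⟨(h : ℕ) - 1, lt_of_le_of_lt (Nat.sub_le _ _) h.isLt⟩
    G.trans y.1 y.2.1 y.2.2 (z h).1

/-- The probability of the play `z` when the players follow the policies `μ` and `ν`. -/
noncomputable def playProb (G : ExtensiveGame S X Y A B) (μ : X → A → ℝ) (ν : Y → B → ℝ)
    (z : G.Play) : ℝ :=
  ∏ h : Fin G.H,
    (G.arrivalProb z h * μ (G.infoMin (z h).1) (z h).2.1 * ν (G.infoMax (z h).1) (z h).2.2)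

/-- The loss received at depth `h` along the play `z`. -/
def playLoss (G : ExtensiveGame S X Y A B) (z : G.Play) (h : Fin G.H) : ℝ :=
  G.loss (z h).1 (z h).2.1 (z h).2.2

/-- The expected total loss of an episode. -/
noncomputable def value [Fintype A] [Fintype B] (G : ExtensiveGame S X Y A B)
    (μ : X → A → ℝ) (ν : Y → B → ℝ) : ℝ :=
  ∑ z : G.Play, G.playProb μ ν z * ∑ h, G.playLoss z h

/-- The exploitability gap `max_{ν'} ℓ(μ, ν') - min_{μ'} ℓ(μ', ν)`. -/
noncomputable def exploitabilityGap [Fintype A] [Fintype B] (G : ExtensiveGame S X Y A B)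
    (μ : X → A → ℝ) (ν : Y → B → ℝ) : ℝ :=
  sSup ((fun ν' => G.value μ ν') '' {ν' | IsPolicy ν'}) -
    sInf ((fun μ' => G.value μ' ν) '' {μ' | IsPolicy μ'})

open Classical in
/-- The importance-sampling estimate of the min-player, from one play of the policy `μ`. -/
noncomputable def estimateMin (G : ExtensiveGame S X Y A B) (μ : X → A → ℝ) (z : G.Play) :
    X → A → ℝ :=
  fun x a => ∑ h : Fin G.H,
    if G.infoMin (z h).1 = x ∧ (z h).2.1 = a then
      G.playLoss z h / G.minTree.seqForm μ x a
    else 0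

open Classical in
/-- The importance-sampling estimate of the max-player, whose loss at each depth is `1 - ℓ`. -/
noncomputable def estimateMax (G : ExtensiveGame S X Y A B) (ν : Y → B → ℝ) (z : G.Play) :
    Y → B → ℝ :=
  fun y b => ∑ h : Fin G.H,
    if G.infoMax (z h).1 = y ∧ (z h).2.2 = b then
      (1 - G.playLoss z h) / G.maxTree.seqForm ν y b
    else 0

end ExtensiveGame

/-- The learning rate `η^t`. -/
noncomputable def learningRate (η : ℝ) (T₀ t : ℕ) : ℝ :=
  η * ((t : ℝ) + T₀) ^ (-(3 / 4) : ℝ)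

/-- The regularization strength `τ^t`. -/
noncomputable def regStrength (δ τ : ℝ) (T₀ t : ℕ) : ℝ :=
  τ * Real.log (((t : ℝ) + T₀) / δ) * ((t : ℝ) + T₀) ^ (-(1 / 4) : ℝ)

/-- The two players run the regularized mirror descent with the dilated log-barrier: `μ t` and
`ν t` are their policies at iteration `t`, and `Z t` is the play of iteration `t`, which given the
past `ℱ t` is drawn by following `μ t` and `ν t` in the game. -/
structure ExtensiveGame.IsRun {S X Y A B : Type*}
    [Fintype S] [Fintype X] [Fintype Y] [Fintype A] [Fintype B]
    (G : ExtensiveGame S X Y A B) (δ η τ : ℝ) (T₀ : ℕ)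
    {Ω : Type*} {mΩ : MeasurableSpace Ω} (P : Measure Ω) (ℱ : Filtration ℕ mΩ)
    (Z : ℕ → Ω → G.Play) (μ : ℕ → Ω → X → A → ℝ) (ν : ℕ → Ω → Y → B → ℝ) : Prop where
  measurable_min : ∀ t x a, Measurable[ℱ t] fun ω => μ t ω x a
  measurable_max : ∀ t y b, Measurable[ℱ t] fun ω => ν t ω y b
  measurable_play : ∀ t z, MeasurableSet[ℱ (t + 1)] {ω | Z t ω = z}
  law_play : ∀ t z,
    P[Set.indicator {ω | Z t ω = z} (fun _ => (1 : ℝ)) | ℱ t]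
      =ᵐ[P] fun ω => G.playProb (μ t ω) (ν t ω) z
  start_min : ∀ ω, μ 0 ω = uniformPolicy X A
  start_max : ∀ ω, ν 0 ω = uniformPolicy Y B
  step_min : ∀ t ω, G.minTree.IsMirrorStep (learningRate η T₀ t)
    (G.estimateMin (μ t ω) (Z t ω) +
      regStrength δ τ T₀ t • logBarrierGrad (G.minTree.seqForm (μ t ω)))
    (μ t ω) (μ (t + 1) ω)
  step_max : ∀ t ω, G.maxTree.IsMirrorStep (learningRate η T₀ t)
    (G.estimateMax (ν t ω) (Z t ω) +
      regStrength δ τ T₀ t • logBarrierGrad (G.maxTree.seqForm (ν t ω)))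
    (ν t ω) (ν (t + 1) ω)

/-!
Stack the sequence forms of both players into one vector. In these coordinates the game is an
alternating bilinear form on a polytope, an episode yields an unbiased importance-sampling estimate
of the linear form at the current iterate, and the algorithm is one mirror descent with the
log-barrier.

The iterates are compared with a deterministic flow: the implicit natural-gradient dynamics of the
regularized game, started at the analytic centre. Because the form is alternating, it drops out when
two consecutive flow steps are tested against each other, so the local speed of the flow contracts
and stays below `η τ / 8`. A slow flow nearly solves the regularized game, so its points have gap at
most about `K τ`.

The Itakura–Saito divergence between the flow and the iterates contracts in expectation by a factor
`1 - η τ / 2` per step, up to noise that is conditionally exponentially integrable. With an inverse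
temperature of order `min 1 τ / η` this gives an exponential supermartingale, and Markov's
inequality at every `t` keeps the divergence small for all times with probability `1 - δ`. While the
regularization strength is at least `1`, the claimed bound on the gap exceeds the trivial one.
-/

/-! ### Divergences of the log-barrier -/

section RatioInequalities

lemma sub_two_mul_sq_le_log_one_add {a : ℝ} (ha : -(1 / 2) ≤ a) :
    a - 2 * a ^ 2 ≤ Real.log (1 + a) := by
  have hpos : 0 < 1 + a := by linarith
  refine le_trans ?_ (Real.one_sub_inv_le_log_of_pos hpos)
  have hdiff : 1 - (1 + a)⁻¹ - (a - 2 * a ^ 2) = a ^ 2 * (1 + 2 * a) / (1 + a) := by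
    field_simp
    ring
  have : 0 ≤ a ^ 2 * (1 + 2 * a) / (1 + a) :=
    div_nonneg (mul_nonneg (sq_nonneg a) (by linarith)) hpos.le
  linarith

lemma sub_one_sub_log_nonneg {q : ℝ} (hq : 0 < q) : 0 ≤ q - 1 - Real.log q := by
  linarith [Real.log_le_sub_one_of_pos hq]

lemma sq_sqrt_sub_one_le {q : ℝ} (hq : 0 < q) : (√q - 1) ^ 2 ≤ q - 1 - Real.log q := by
  have hlog : Real.log √q ≤ √q - 1 := Real.log_le_sub_one_of_pos (Real.sqrt_pos.2 hq)
  rw [Real.log_sqrt hq.le] at hlog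
  linarith [Real.sq_sqrt hq.le, sub_sq √q 1]

lemma log_le_half {q : ℝ} (hq : 0 < q) : Real.log q ≤ q / 2 := by
  have h : Real.log (q / 2) ≤ q / 2 - 1 := Real.log_le_sub_one_of_pos (by positivity)
  rw [Real.log_div hq.ne' two_ne_zero] at h
  linarith [Real.log_two_lt_d9]

lemma div_add_div_sub_two_eq {c z : ℝ} (hc : c ≠ 0) (hz : z ≠ 0) :
    c / z + z / c - 2 = (c - z) ^ 2 / (c * z) := by
  field_simp
  ring

lemma div_add_div_sub_two_nonneg {c z : ℝ} (hc : 0 < c) (hz : 0 < z) :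
    0 ≤ c / z + z / c - 2 := by
  rw [div_add_div_sub_two_eq hc.ne' hz.ne']
  positivity

/-- The right-hand side grows like `q` for large `q`, which makes up for the absence of an a priori
bound on the ratio `q = c / z`. -/
lemma abs_div_sub_one_le {c z g : ℝ} (hc : 0 < c) (hz : 0 < z) (hg : 0 < g) :
    |c / z - 1| ≤ g + (c / z + z / c - 2) * ((1 + g) / g) := by
  set b := c / z - 1 with hb
  have hb0 : 0 < 1 + b := by
    rw [hb, add_sub_cancel]
    positivity
  have heq : c / z + z / c - 2 = b ^ 2 / (1 + b) := by
    rw [hb, add_sub_cancel]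
    field_simp
    ring
  rw [heq]
  by_cases h : |b| ≤ g
  · have : 0 ≤ b ^ 2 / (1 + b) * ((1 + g) / g) := by positivity
    linarith
  · push Not at h
    have hlarge : |b| ≤ b ^ 2 / (1 + |b|) * ((1 + g) / g) := by
      rw [← sq_abs, div_mul_div_comm, le_div_iff₀ (by positivity)]
      nlinarith [abs_nonneg b]
    have habs : b ^ 2 / (1 + |b|) * ((1 + g) / g) ≤ b ^ 2 / (1 + b) * ((1 + g) / g) := by
      gcongr
      exact le_abs_self b
    linarith

lemma div_le_of_abs_add_div_sub_one_le {c v z : ℝ} (hc : 0 < c) (hz : 0 < z)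
    (hv : |v / c| ≤ 1 / 64) (h : |(c + v) / z - 1| ≤ 1 / 16) : z / c ≤ 13 / 12 := by
  have hv' : v ≤ 1 / 64 * c := (div_le_iff₀ hc).1 ((le_abs_self _).trans hv)
  have h' : 15 / 16 ≤ (c + v) / z := by linarith [(abs_le.1 h).1]
  rw [le_div_iff₀ hz] at h'
  rw [div_le_iff₀ hc]
  linarith

end RatioInequalities

section LogBarrierDivergences

variable {I : Type*} [Fintype I]

/-- The Bregman divergence of the log-barrier (Itakura–Saito divergence) between two positive
vectors indexed by `I`, written in terms of the ratios of their coordinates. -/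
noncomputable def barrierDiv (c z : I → ℝ) : ℝ :=
  ∑ i, (c i / z i - 1 - Real.log (c i / z i))

/-- The symmetrized Bregman divergence `D(c, z) + D(z, c)` of the log-barrier, in which the
logarithms cancel. -/
noncomputable def barrierSym (c z : I → ℝ) : ℝ :=
  ∑ i, (c i / z i + z i / c i - 2)

variable {c z : I → ℝ}

lemma barrierDiv_nonneg (hc : ∀ i, 0 < c i) (hz : ∀ i, 0 < z i) : 0 ≤ barrierDiv c z :=
  Finset.sum_nonneg fun i _ => sub_one_sub_log_nonneg (div_pos (hc i) (hz i))

lemma barrierSym_nonneg (hc : ∀ i, 0 < c i) (hz : ∀ i, 0 < z i) : 0 ≤ barrierSym c z :=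
  Finset.sum_nonneg fun i _ => div_add_div_sub_two_nonneg (hc i) (hz i)

lemma barrierDiv_le_barrierSym (hc : ∀ i, 0 < c i) (hz : ∀ i, 0 < z i) :
    barrierDiv c z ≤ barrierSym c z := by
  refine Finset.sum_le_sum fun i _ => ?_
  have hlog := Real.one_sub_inv_le_log_of_pos (div_pos (hc i) (hz i))
  rw [inv_div] at hlog
  linarith

lemma coord_le_barrierDiv (hc : ∀ i, 0 < c i) (hz : ∀ i, 0 < z i) (i : I) :
    c i / z i - 1 - Real.log (c i / z i) ≤ barrierDiv c z :=
  Finset.single_le_sum (f := fun i => c i / z i - 1 - Real.log (c i / z i))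
    (fun j _ => sub_one_sub_log_nonneg (div_pos (hc j) (hz j))) (Finset.mem_univ i)

lemma coord_le_barrierSym (hc : ∀ i, 0 < c i) (hz : ∀ i, 0 < z i) (i : I) :
    c i / z i + z i / c i - 2 ≤ barrierSym c z :=
  Finset.single_le_sum (f := fun i => c i / z i + z i / c i - 2)
    (fun j _ => div_add_div_sub_two_nonneg (hc j) (hz j)) (Finset.mem_univ i)

lemma div_le_of_barrierDiv_le (hc : ∀ i, 0 < c i) (hz : ∀ i, 0 < z i) {R : ℝ}
    (h : barrierDiv c z ≤ R) (i : I) : c i / z i ≤ 2 * R + 2 := by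
  linarith [coord_le_barrierDiv hc hz i, log_le_half (div_pos (hc i) (hz i))]

lemma abs_div_sub_one_le_of_barrierDiv_le (hc : ∀ i, 0 < c i) (hz : ∀ i, 0 < z i) {R : ℝ}
    (h : barrierDiv c z ≤ R) (i : I) : |c i / z i - 1| ≤ 2 * R + 2 := by
  have hR := (barrierDiv_nonneg hc hz).trans h
  have hratio := div_le_of_barrierDiv_le hc hz h i
  have hpos := div_pos (hc i) (hz i)
  exact abs_le.2 ⟨by linarith, by linarith⟩

lemma abs_div_sub_one_le_of_barrierDiv_le_sq (hc : ∀ i, 0 < c i) (hz : ∀ i, 0 < z i) {e : ℝ}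
    (he0 : 0 ≤ e) (he1 : e ≤ 1) (h : barrierDiv c z ≤ e ^ 2) (i : I) :
    |c i / z i - 1| ≤ 3 * e := by
  have hq := div_pos (hc i) (hz i)
  have hsqrt : |√(c i / z i) - 1| ≤ e := abs_le_of_sq_le_sq
    ((sq_sqrt_sub_one_le hq).trans ((coord_le_barrierDiv hc hz i).trans h)) he0
  set r := √(c i / z i)
  have hfactor : c i / z i - 1 = (r - 1) * (r + 1) := by
    linarith [Real.sq_sqrt hq.le, mul_self_sub_one r, pow_two r]
  have hsum : |r + 1| ≤ 3 := by
    rw [abs_of_nonneg (by positivity)]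
    linarith [(abs_le.1 hsqrt).2]
  calc |c i / z i - 1| = |r - 1| * |r + 1| := by rw [hfactor, abs_mul]
    _ ≤ e * 3 := mul_le_mul hsqrt hsum (abs_nonneg _) he0
    _ = 3 * e := mul_comm _ _

lemma sq_div_sub_one_le_of_barrierDiv_le (hc : ∀ i, 0 < c i) (hz : ∀ i, 0 < z i) {R : ℝ}
    (h : barrierDiv c z ≤ R) (i : I) :
    (c i / z i - 1) ^ 2 ≤ (2 * R + 2) * barrierSym c z := by
  have hR := (barrierDiv_nonneg hc hz).trans h
  have hci := (hc i).ne'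
  have hzi := (hz i).ne'
  calc (c i / z i - 1) ^ 2 = c i / z i * (c i / z i + z i / c i - 2) := by
        field_simp
        ring
    _ ≤ (2 * R + 2) * barrierSym c z :=
        mul_le_mul (div_le_of_barrierDiv_le hc hz h i) (coord_le_barrierSym hc hz i)
          (div_add_div_sub_two_nonneg (hc i) (hz i)) (by linarith)

end LogBarrierDivergences

section LocalNorm

variable {I : Type*} [Fintype I]

/-- The norm of `v` for the Hessian of the log-barrier at `c`, the local norm of interior-point
methods. -/
noncomputable def localNorm (c v : I → ℝ) : ℝ :=
  √(∑ i, (v i / c i) ^ 2)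

lemma localNorm_nonneg (c v : I → ℝ) : 0 ≤ localNorm c v := Real.sqrt_nonneg _

lemma sq_localNorm (c v : I → ℝ) : localNorm c v ^ 2 = ∑ i, (v i / c i) ^ 2 :=
  Real.sq_sqrt (Finset.sum_nonneg fun _ _ => sq_nonneg _)

lemma abs_div_le_localNorm (c v : I → ℝ) (i : I) : |v i / c i| ≤ localNorm c v := by
  refine Real.abs_le_sqrt ?_
  exact Finset.single_le_sum (f := fun i => (v i / c i) ^ 2) (fun j _ => sq_nonneg _)
    (Finset.mem_univ i)

lemma sum_abs_div_mul_abs_div_le (c v d w : I → ℝ) :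
    ∑ i, |v i / c i| * |w i / d i| ≤ localNorm c v * localNorm d w := by
  simpa only [localNorm, sq_abs] using
    Real.sum_mul_le_sqrt_mul_sqrt Finset.univ (fun i => |v i / c i|) fun i => |w i / d i|

lemma sum_abs_div_le (c v : I → ℝ) :
    ∑ i, |v i / c i| ≤ √(Fintype.card I) * localNorm c v := by
  simpa [localNorm] using
    Real.sum_mul_le_sqrt_mul_sqrt Finset.univ (fun _ : I => (1 : ℝ)) fun i => |v i / c i|

end LocalNorm

section FlowStep

lemma exists_mem_forall_bilin_eq {𝕜 E : Type*} [Field 𝕜] [AddCommGroup E] [Module 𝕜 E]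
    (b : LinearMap.BilinForm 𝕜 E) (V : Submodule 𝕜 E) [FiniteDimensional 𝕜 V]
    (hb : ∀ v ∈ V, b v v = 0 → v = 0) (φ : E →ₗ[𝕜] 𝕜) :
    ∃ v ∈ V, ∀ w ∈ V, b v w = φ w := by
  have hinj : Function.Injective (b.domRestrict₁₂ V V) := by
    rw [injective_iff_map_eq_zero]
    intro v hv
    exact Subtype.ext (hb v v.2 (LinearMap.congr_fun hv v))
  have hsurj := (LinearMap.injective_iff_surjective_of_finrank_eq_finrank
    (Subspace.dual_finrank_eq (K := 𝕜) (V := V)).symm).1 hinj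
  obtain ⟨v, hv⟩ := hsurj (φ.comp V.subtype)
  exact ⟨v, v.2, fun w hw => LinearMap.congr_fun hv ⟨w, hw⟩⟩

lemma apply_add_self_of_isAlt {R E : Type*} [CommRing R] [AddCommGroup E] [Module R E]
    {Φ : LinearMap.BilinForm R E} (hΦ : Φ.IsAlt) (c v : E) : Φ (c + v) v = Φ c v := by
  rw [map_add, LinearMap.add_apply, hΦ v, add_zero]

variable {I : Type*} [Fintype I]

/-- `v` is the displacement from `c`, within the tangent space `V`, of an implicit natural-gradient
step for the bilinear game `Φ` regularized by `τ` times the log-barrier. The loss is evaluated at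
the endpoint `c + v`, the metric and the gradient of the barrier at `c`. -/
def IsFlowStep (V : Submodule ℝ (I → ℝ)) (Φ : LinearMap.BilinForm ℝ (I → ℝ)) (η τ : ℝ)
    (c v : I → ℝ) : Prop :=
  v ∈ V ∧ ∀ w ∈ V, ∑ i, (v i / c i - η * τ) * w i / c i = -η * Φ (c + v) w

variable {V : Submodule ℝ (I → ℝ)} {Φ : LinearMap.BilinForm ℝ (I → ℝ)}

theorem exists_isFlowStep (hΦ : Φ.IsAlt) (V : Submodule ℝ (I → ℝ)) (η τ : ℝ) {c : I → ℝ}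
    (hc : ∀ i, 0 < c i) : ∃ v, IsFlowStep V Φ η τ c v := by
  let proj (i : I) : (I → ℝ) →ₗ[ℝ] ℝ := LinearMap.proj i
  let b : LinearMap.BilinForm ℝ (I → ℝ) :=
    ∑ i, ((c i)⁻¹ ^ 2) • LinearMap.BilinForm.linMulLin (proj i) (proj i) + η • Φ
  let φ : (I → ℝ) →ₗ[ℝ] ℝ := ∑ i, (η * τ * (c i)⁻¹) • proj i - η • Φ c
  have hb (v w) : b v w = ∑ i, (c i)⁻¹ ^ 2 * (v i * w i) + η * Φ v w := by
    simp [b, proj]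
  have hφ (w) : φ w = ∑ i, η * τ * (c i)⁻¹ * w i - η * Φ c w := by
    simp [φ, proj]
  have hdef : ∀ v ∈ V, b v v = 0 → v = 0 := by
    intro v _ hv
    rw [hb, hΦ v, mul_zero, add_zero, Finset.sum_eq_zero_iff_of_nonneg
      fun i _ => mul_nonneg (sq_nonneg _) (mul_self_nonneg _)] at hv
    ext i
    simpa [(hc i).ne'] using hv i (Finset.mem_univ i)
  obtain ⟨v, hv, hvw⟩ := exists_mem_forall_bilin_eq b V hdef φ
  refine ⟨v, hv, fun w hw => ?_⟩
  have hsum : ∑ i, (v i / c i - η * τ) * w i / c i =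
      ∑ i, (c i)⁻¹ ^ 2 * (v i * w i) - ∑ i, η * τ * (c i)⁻¹ * w i := by
    rw [← Finset.sum_sub_distrib]
    exact Finset.sum_congr rfl fun i _ => by ring
  have hbφ := hvw w hw
  rw [hb, hφ] at hbφ
  rw [hsum, map_add, LinearMap.add_apply]
  linarith

variable {η τ η' τ' : ℝ} {c v v' : I → ℝ}

lemma IsFlowStep.sum_sq_div_eq (hΦ : Φ.IsAlt) (hη : η ≠ 0) (hc : ∀ i, 0 < c i)
    (hcv : ∀ i, 0 < (c + v) i) (h : IsFlowStep V Φ η τ c v)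
    (h' : IsFlowStep V Φ η' τ' (c + v) v') :
    ∑ i, (v' i / (c + v) i) ^ 2 =
      ∑ i, (v i / c i) * (v' i / (c + v) i) * (η' / η * (1 + v i / c i) - η' * τ)
        + η' * (τ' - τ) * ∑ i, v' i / (c + v) i := by
  have hstep := h.2 v' h'.1
  have hstep' := h'.2 v' h'.1
  rw [apply_add_self_of_isAlt hΦ] at hstep'
  have hcompare : ∑ i, (v' i / (c + v) i - η' * τ') * v' i / (c + v) i =
      ∑ i, η' / η * ((v i / c i - η * τ) * v' i / c i) := by
    rw [← Finset.mul_sum, hstep, hstep']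
    field_simp
  rw [Finset.mul_sum, ← Finset.sum_add_distrib, ← sub_eq_zero, ← Finset.sum_sub_distrib,
    ← sub_eq_zero.2 hcompare, ← Finset.sum_sub_distrib]
  refine Finset.sum_congr rfl fun i _ => ?_
  have hci := (hc i).ne'
  have hcvi := (hcv i).ne'
  have hratio : v' i / c i = v' i / (c + v) i * (1 + v i / c i) := by
    simp only [Pi.add_apply] at hcvi ⊢
    field_simp
  rw [mul_div_assoc, mul_div_assoc, hratio]
  field_simp
  ring

lemma abs_rate_mul_sub_le {a s : ℝ} (hη : 0 < η) (hη' : 0 < η') (hηη : η' ≤ η) (hτ : 0 ≤ τ)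
    (ha : |a| ≤ s) (hs : s + η * τ ≤ 1) :
    |η' / η * (1 + a) - η' * τ| ≤ 1 + s - η' * τ := by
  have ha' := abs_le.1 ha
  have hητ : 0 ≤ η * τ := by positivity
  have hle : η' / η * (1 + a) ≤ 1 * (1 + s) :=
    mul_le_mul ((div_le_one hη).2 hηη) (by linarith) (by linarith) zero_le_one
  have heq : η' / η * (1 + a) - η' * τ = η' / η * (1 + a - η * τ) := by field_simp
  rw [abs_of_nonneg]
  · linarith
  · rw [heq]
    exact mul_nonneg (div_pos hη' hη).le (by linarith)

/-- Since `Φ` is alternating, it drops out of the first step tested against `v'` minus the second: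
what is left contracts at the rate `η' * τ` of the barrier. -/
theorem IsFlowStep.localNorm_le (hΦ : Φ.IsAlt) (hη : 0 < η) (hη' : 0 < η') (hηη : η' ≤ η)
    (hτ : 0 ≤ τ) (hc : ∀ i, 0 < c i) (hcv : ∀ i, 0 < (c + v) i)
    (hs : localNorm c v + η * τ ≤ 1) (h : IsFlowStep V Φ η τ c v)
    (h' : IsFlowStep V Φ η' τ' (c + v) v') :
    localNorm (c + v) v' ≤
      (1 + localNorm c v - η' * τ) * localNorm c v + η' * |τ' - τ| * √(Fintype.card I) := by
  set s := localNorm c v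
  set s' := localNorm (c + v) v' with hs'
  have hs0 : 0 ≤ s := localNorm_nonneg c v
  have hητ : η' * τ ≤ η * τ := mul_le_mul_of_nonneg_right hηη hτ
  have hfactor : 0 ≤ 1 + s - η' * τ := by linarith
  have hcontract :
      ∑ i, (v i / c i) * (v' i / (c + v) i) * (η' / η * (1 + v i / c i) - η' * τ) ≤
        (1 + s - η' * τ) * (s * s') := by
    refine le_trans (Finset.sum_le_sum fun i _ => ?_) ((Finset.mul_sum _ _ _).symm.le.trans
      (mul_le_mul_of_nonneg_left (sum_abs_div_mul_abs_div_le c v (c + v) v') hfactor))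
    refine (le_abs_self _).trans ?_
    rw [abs_mul, abs_mul, mul_comm]
    exact mul_le_mul_of_nonneg_right
      (abs_rate_mul_sub_le hη hη' hηη hτ (abs_div_le_localNorm c v i) hs) (by positivity)
  have hdrift : η' * (τ' - τ) * ∑ i, v' i / (c + v) i ≤
      η' * |τ' - τ| * (√(Fintype.card I) * s') := by
    refine (le_abs_self _).trans ?_
    rw [abs_mul, abs_mul, abs_of_pos hη']
    exact mul_le_mul_of_nonneg_left
      ((Finset.abs_sum_le_sum_abs _ _).trans (sum_abs_div_le _ _)) (by positivity)
  have hsq : s' * s' ≤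
      ((1 + s - η' * τ) * s + η' * |τ' - τ| * √(Fintype.card I)) * s' := by
    rw [← pow_two, hs', sq_localNorm, h.sum_sq_div_eq hΦ hη.ne' hc hcv h']
    linarith
  rcases (localNorm_nonneg (c + v) v').eq_or_lt with h0 | h0
  · rw [hs', ← h0]
    positivity
  · exact le_of_mul_le_mul_right hsq h0

end FlowStep

section BarrierStep

variable {I : Type*} [Fintype I]

/-- `z'` is the mirror step from `z` for the loss estimate `f` and the log-barrier regularizer of
strength `τ`, in the form of the first-order optimality condition on the tangent space `V`. -/
def IsBarrierStep (V : Submodule ℝ (I → ℝ)) (η τ : ℝ) (f z z' : I → ℝ) : Prop :=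
  ∀ w ∈ V, ∑ i, (1 / z' i - (1 - η * τ) / z i - η * f i) * w i = 0

variable {V : Submodule ℝ (I → ℝ)} {Φ : LinearMap.BilinForm ℝ (I → ℝ)} {η τ : ℝ}
  {f c v z z' : I → ℝ}

lemma IsBarrierStep.barrierSym_eq (hzV : z' - z ∈ V) (hz : ∀ i, 0 < z i) (hz' : ∀ i, 0 < z' i)
    (h : IsBarrierStep V η τ f z z') :
    barrierSym z' z = ∑ i, (η * τ - η * (f i * z i)) * (z' i / z i - 1) := by
  rw [barrierSym, ← sub_eq_zero, ← Finset.sum_sub_distrib, ← neg_eq_zero, ← h _ hzV,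
    ← Finset.sum_neg_distrib]
  refine Finset.sum_congr rfl fun i _ => ?_
  have hzi := (hz i).ne'
  have hzi' := (hz' i).ne'
  simp only [Pi.sub_apply]
  field_simp
  ring

lemma IsBarrierStep.barrierSym_le {B : ℝ} (hη : 0 < η) (hτ : 0 < τ) (hB : 0 ≤ B)
    (hρ : η * τ + η * B ≤ 1 / 4) (hzV : z' - z ∈ V) (hz : ∀ i, 0 < z i) (hz' : ∀ i, 0 < z' i)
    (hf : ∀ i, 0 ≤ f i) (hfz : ∑ i, f i * z i ≤ B) (h : IsBarrierStep V η τ f z z') :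
    barrierSym z' z ≤ 8 * Fintype.card I * (η * τ + η * B) ^ 2 := by
  set ρ := η * τ + η * B
  have hρ0 : 0 < ρ := by positivity
  have hcoord (i : I) : (η * τ - η * (f i * z i)) * (z' i / z i - 1) ≤
      4 * ρ ^ 2 + 1 / 2 * (z' i / z i + z i / z' i - 2) := by
    have hfi : f i * z i ≤ B := (Finset.single_le_sum (f := fun i => f i * z i)
      (fun j _ => mul_nonneg (hf j) (hz j).le) (Finset.mem_univ i)).trans hfz
    have hfi0 : 0 ≤ f i * z i := mul_nonneg (hf i) (hz i).le
    have hweight : |η * τ - η * (f i * z i)| ≤ ρ := by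
      have hητ : 0 < η * τ := by positivity
      have hle : η * (f i * z i) ≤ η * B := by gcongr
      have hnonneg : 0 ≤ η * (f i * z i) := by positivity
      exact abs_le.2 ⟨by linarith, by linarith⟩
    have hdiff := abs_div_sub_one_le (hz' i) (hz i) (g := 4 * ρ) (by positivity)
    have hX := div_add_div_sub_two_nonneg (hz' i) (hz i)
    set X := z' i / z i + z i / z' i - 2
    calc (η * τ - η * (f i * z i)) * (z' i / z i - 1)
        ≤ |η * τ - η * (f i * z i)| * |z' i / z i - 1| := by
          rw [← abs_mul]
          exact le_abs_self _
      _ ≤ ρ * (4 * ρ + X * ((1 + 4 * ρ) / (4 * ρ))) :=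
          mul_le_mul hweight hdiff (abs_nonneg _) hρ0.le
      _ = 4 * ρ ^ 2 + X * ((1 + 4 * ρ) / 4) := by field_simp
      _ ≤ 4 * ρ ^ 2 + 1 / 2 * X := by nlinarith
  have hsum : barrierSym z' z ≤ Fintype.card I * (4 * ρ ^ 2) + 1 / 2 * barrierSym z' z := by
    conv_lhs => rw [h.barrierSym_eq hzV hz hz']
    refine (Finset.sum_le_sum fun i _ => hcoord i).trans_eq ?_
    rw [Finset.sum_add_distrib, Finset.sum_const, ← Finset.mul_sum, Finset.card_univ,
      nsmul_eq_mul, barrierSym]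
  linarith

/-- The first two terms on the right are the optimality conditions of the mirror step and of the
flow step, which vanish, up to the game, when summed over the coordinates. -/
lemma ratioDiv_update_le {η τ f c v z z' : ℝ} (hc : 0 < c) (hz : 0 < z) (hz' : 0 < z')
    (hv : -(1 / 2) ≤ v / c) :
    ((c + v) / z' - 1 - Real.log ((c + v) / z')) - (c / z - 1 - Real.log (c / z)) ≤
      (1 / z' - (1 - η * τ) / z - η * f) * (c + v - z) + (v / c - η * τ) * (c - z) / c
        + ((z' / z + z / z' - 2) - η * τ * (c / z + z / c - 2) + η * (f * (c - z))
        + (v / c * (c / z + z / c - 2) + 2 * (v / c) ^ 2 - η * τ * (v / c) * (c / z)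
          + η * (f * v))) := by
  have hcv : c + v = c * (1 + v / c) := by field_simp
  have hlog : Real.log ((c + v) / z')
      = Real.log (c / z) + Real.log (1 + v / c) - Real.log (z' / z) := by
    have hne : 1 + v / c ≠ 0 := by linarith
    rw [hcv, Real.log_div (mul_ne_zero hc.ne' hne) hz'.ne', Real.log_mul hc.ne' hne,
      Real.log_div hc.ne' hz.ne', Real.log_div hz'.ne' hz.ne']
    ring
  have hlog_v := sub_two_mul_sq_le_log_one_add hv
  have hlog_z := Real.log_le_sub_one_of_pos (div_pos hz' hz)
  have hidentity : ((c + v) / z' - 1) - (c / z - 1) - v / c + (z' / z - 1) =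
      (1 / z' - (1 - η * τ) / z - η * f) * (c + v - z) + (v / c - η * τ) * (c - z) / c
        + ((z' / z + z / z' - 2) - η * τ * (c / z + z / c - 2) + η * (f * (c - z))
        + (v / c * (c / z + z / c - 2) - η * τ * (v / c) * (c / z) + η * (f * v))) := by
    field_simp
    ring
  linarith

lemma barrierDiv_update_le (hc : ∀ i, 0 < c i) (hz : ∀ i, 0 < z i) (hz' : ∀ i, 0 < z' i)
    (hv : ∀ i, -(1 / 2) ≤ v i / c i) (hcV : c - z ∈ V) (hcvV : c + v - z ∈ V)
    (hflow : IsFlowStep V Φ η τ c v) (hstep : IsBarrierStep V η τ f z z') :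
    barrierDiv (c + v) z' ≤ barrierDiv c z + barrierSym z' z - η * τ * barrierSym c z
      + η * (∑ i, f i * (c i - z i) - Φ (c + v) (c - z))
      + ∑ i, (v i / c i * (c i / z i + z i / c i - 2) + 2 * (v i / c i) ^ 2
          - η * τ * (v i / c i) * (c i / z i) + η * (f i * v i)) := by
  have hsum := Finset.sum_le_sum fun i (_ : i ∈ Finset.univ) =>
    ratioDiv_update_le (η := η) (τ := τ) (f := f i) (hc i) (hz i) (hz' i) (hv i)
  have hopt := hstep _ hcvV
  have hopt' := hflow.2 _ hcV
  simp only [Pi.add_apply, Pi.sub_apply] at hopt hopt'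
  have hsym : ∑ i, (z' i / z i + z i / z' i - 2 - η * τ * (c i / z i + z i / c i - 2)) =
      barrierSym z' z - η * τ * barrierSym c z := by
    rw [Finset.sum_sub_distrib, ← Finset.mul_sum, barrierSym, barrierSym]
  rw [Finset.sum_sub_distrib, Finset.sum_add_distrib, Finset.sum_add_distrib, hopt, hopt',
    Finset.sum_add_distrib, Finset.sum_add_distrib, hsym, ← Finset.mul_sum] at hsum
  simp only [barrierDiv, Pi.add_apply]
  linarith

lemma sum_flow_drift_le {B s : ℝ} (hη : 0 ≤ η) (hτ : 0 ≤ τ) (hs : 0 ≤ s) (hc : ∀ i, 0 < c i)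
    (hz : ∀ i, 0 < z i) (hv : ∀ i, |v i / c i| ≤ s) (hf : ∀ i, 0 ≤ f i)
    (hfz : ∑ i, f i * z i ≤ B) :
    ∑ i, (v i / c i * (c i / z i + z i / c i - 2) + 2 * (v i / c i) ^ 2
        - η * τ * (v i / c i) * (c i / z i) + η * (f i * v i)) ≤
      s * barrierSym c z + Fintype.card I * (2 * s ^ 2)
        + η * τ * s * (2 * Fintype.card I + barrierSym c z)
        + η * s * (2 + barrierSym c z) * B := by
  set S := barrierSym c z
  have hS : 0 ≤ S := barrierSym_nonneg hc hz
  have hcoord (i : I) : v i / c i * (c i / z i + z i / c i - 2) + 2 * (v i / c i) ^ 2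
        - η * τ * (v i / c i) * (c i / z i) + η * (f i * v i) ≤
      s * (c i / z i + z i / c i - 2) + 2 * s ^ 2
        + η * τ * s * (2 + (c i / z i + z i / c i - 2)) + η * s * (2 + S) * (f i * z i) := by
    have hci := (hc i).ne'
    have hzi := (hz i).ne'
    have hq := div_add_div_sub_two_nonneg (hc i) (hz i)
    have hqS : c i / z i + z i / c i - 2 ≤ S := coord_le_barrierSym hc hz i
    have hfv : f i * v i = f i * z i * (v i / c i * (c i / z i)) := by field_simp
    have hratio : |v i / c i * (c i / z i)| ≤ s * (2 + (c i / z i + z i / c i - 2)) := by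
      rw [abs_mul, abs_of_pos (div_pos (hc i) (hz i))]
      refine mul_le_mul (hv i) ?_ (div_pos (hc i) (hz i)).le hs
      linarith [div_pos (hz i) (hc i)]
    have hfz0 : 0 ≤ f i * z i := mul_nonneg (hf i) (hz i).le
    have h_metric := mul_le_mul_of_nonneg_right ((le_abs_self _).trans (hv i)) hq
    have h_sq : (v i / c i) ^ 2 ≤ s ^ 2 := sq_le_sq' (abs_le.1 (hv i)).1 (abs_le.1 (hv i)).2
    have h_barrier := mul_le_mul_of_nonneg_left ((neg_le_abs _).trans hratio) (mul_nonneg hη hτ)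
    have h_loss : f i * z i * (v i / c i * (c i / z i)) ≤ f i * z i * (s * (2 + S)) :=
      mul_le_mul_of_nonneg_left ((le_abs_self _).trans (hratio.trans (by gcongr))) hfz0
    have h_loss' := mul_le_mul_of_nonneg_left h_loss hη
    rw [hfv]
    linarith
  refine (Finset.sum_le_sum fun i _ => hcoord i).trans ?_
  simp only [Finset.sum_add_distrib, ← Finset.mul_sum, Finset.sum_const, Finset.card_univ,
    nsmul_eq_mul]
  have hloss : η * s * (2 + S) * ∑ i, f i * z i ≤ η * s * (2 + S) * B := by gcongr
  have hS_def : ∑ i, (c i / z i + z i / c i - 2) = S := rfl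
  rw [hS_def, mul_comm (2 : ℝ)]
  linarith

end BarrierStep

/-! ### Bilinear saddle-point problems -/

lemma abs_inv_smul_le {I : Type*} {α : ℝ} (hα : 0 < α) {u z : I → ℝ}
    (hu : ∀ i, |u i| ≤ α * z i) (i : I) :
    |(α⁻¹ • u) i| ≤ z i := by
  rw [Pi.smul_apply, smul_eq_mul, abs_mul, abs_inv, abs_of_pos hα, inv_mul_le_iff₀ hα]
  exact hu i

lemma abs_le_mul_of_abs_div_le {v c s : ℝ} (hc : 0 < c) (h : |v / c| ≤ s) :
    |v| ≤ s * c := by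
  rwa [abs_div, abs_of_pos hc, div_le_iff₀ hc] at h

lemma form_add_sub_of_isAlt {R E : Type*} [CommRing R] [AddCommGroup E] [Module R E]
    {Φ : LinearMap.BilinForm R E} (hΦ : Φ.IsAlt) (c v z : E) :
    Φ (c + v) (c - z) = Φ z (c - z) + (Φ v c - Φ v z) := by
  have h := hΦ.neg_eq c z
  simp only [map_add, map_sub, LinearMap.add_apply, hΦ c, hΦ z, ← h]
  ring

lemma tracking_error_le {n S a b s : ℝ} (hn : 0 ≤ n) (hS : 0 ≤ S) (ha : 0 ≤ a) (hb : 0 ≤ b)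
    (hs0 : 0 ≤ s) (hs : s ≤ a / 8) (hρ : a + b ≤ 1 / 4) :
    8 * n * (a + b) ^ 2 + 2 * s * b
        + (s * S + n * (2 * s ^ 2) + a * s * (2 * n + S) + s * (2 + S) * b) ≤
      a / 2 * S + (9 * n + 1) * (a + b) ^ 2 := by
  have hsS : s * S + a * s * S + s * S * b ≤ a / 2 * S := by
    have hrate : s * (a + b) ≤ s * 1 := by gcongr; linarith
    linarith [mul_le_mul_of_nonneg_right (by linarith : s + a * s + s * b ≤ a / 2) hS]
  have hs_sq : s ^ 2 ≤ ((a + b) / 8) ^ 2 := by gcongr; linarith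
  have has : a * s ≤ (a + b) * ((a + b) / 8) := by gcongr <;> linarith
  have hsb : s * b ≤ (a + b) / 8 * (a + b) := by gcongr <;> linarith
  nlinarith [mul_le_mul_of_nonneg_left hs_sq hn, mul_le_mul_of_nonneg_left has hn,
    mul_nonneg hn (sq_nonneg (a + b)), sq_nonneg (a + b)]

lemma add_pos_of_localNorm_lt_one {I : Type*} [Fintype I] {c v : I → ℝ}
    (hc : ∀ i, 0 < c i) (h : localNorm c v < 1) (i : I) : 0 < (c + v) i := by
  have hv := (abs_lt.1 ((abs_div_le_localNorm c v i).trans_lt h)).1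
  rw [lt_div_iff₀ (hc i)] at hv
  simp only [Pi.add_apply]
  linarith

/-- A bilinear saddle-point problem on a compact set `Q` of nonnegative vectors with tangent space
`V`. The joint strategy of the two players is one vector, and `form z (z - z')` is what they gain
together by deviating from `z` to `z'`; the game being zero-sum, the form is alternating. -/
structure SaddleProblem (I : Type*) [Fintype I] where
  V : Submodule ℝ (I → ℝ)
  Q : Set (I → ℝ)
  isCompact : IsCompact Q
  nonneg : ∀ z ∈ Q, ∀ i, 0 ≤ z i
  le_one : ∀ z ∈ Q, ∀ i, z i ≤ 1
  sub_mem : ∀ z ∈ Q, ∀ z' ∈ Q, z - z' ∈ V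
  add_mem : ∀ z ∈ Q, ∀ w ∈ V, (∀ i, 0 ≤ z i + w i) → z + w ∈ Q
  form : LinearMap.BilinForm ℝ (I → ℝ)
  isAlt : form.IsAlt
  bound : ℝ
  one_le_bound : 1 ≤ bound
  abs_form_le : ∀ z ∈ Q, ∀ z' ∈ Q, ∀ u w, (∀ i, |u i| ≤ z i) → (∀ i, |w i| ≤ z' i) →
    |form u w| ≤ bound

namespace SaddleProblem

variable {I : Type*} [Fintype I] (G : SaddleProblem I) {η τ s : ℝ} {f c v z z' : I → ℝ}

lemma bound_pos : 0 < G.bound := one_pos.trans_le G.one_le_bound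

lemma abs_form_le_mul {u w : I → ℝ} (hz : z ∈ G.Q) (hz' : z' ∈ G.Q) {α β : ℝ}
    (hα : 0 ≤ α) (hβ : 0 ≤ β) (hu : ∀ i, |u i| ≤ α * z i) (hw : ∀ i, |w i| ≤ β * z' i) :
    |G.form u w| ≤ α * β * G.bound := by
  rcases hα.eq_or_lt with rfl | hα
  · have hu0 : u = 0 := funext fun i => by simpa using hu i
    simp [hu0]
  rcases hβ.eq_or_lt with rfl | hβ
  · have hw0 : w = 0 := funext fun i => by simpa using hw i
    simp [hw0]
  have h := G.abs_form_le z hz z' hz' _ _ (abs_inv_smul_le hα hu) (abs_inv_smul_le hβ hw)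
  simp only [map_smul, LinearMap.smul_apply, smul_eq_mul, abs_mul, abs_inv, abs_of_pos hα,
    abs_of_pos hβ] at h
  rwa [inv_mul_le_iff₀ hβ, inv_mul_le_iff₀ hα, ← mul_assoc] at h

lemma abs_form_le_mul_left {u : I → ℝ} (hz : z ∈ G.Q) (hz' : z' ∈ G.Q) {α : ℝ} (hα : 0 ≤ α)
    (hu : ∀ i, |u i| ≤ α * z i) : |G.form u z'| ≤ α * G.bound := by
  simpa only [mul_one] using G.abs_form_le_mul hz hz' hα zero_le_one hu
    fun i => by rw [abs_of_nonneg (G.nonneg z' hz' i), one_mul]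

lemma abs_form_le_mul_right {w : I → ℝ} (hz : z ∈ G.Q) (hz' : z' ∈ G.Q) {β : ℝ} (hβ : 0 ≤ β)
    (hw : ∀ i, |w i| ≤ β * z' i) : |G.form z w| ≤ β * G.bound := by
  rw [← G.isAlt.neg_eq, abs_neg]
  exact G.abs_form_le_mul_left hz' hz hβ hw

theorem barrierDiv_step (hη : 0 < η) (hτ : 0 < τ)
    (hρ : η * τ + η * G.bound ≤ 1 / 4) (hs0 : 0 ≤ s) (hs : s ≤ η * τ / 8)
    (hc : c ∈ G.Q) (hcv : c + v ∈ G.Q) (hz : z ∈ G.Q) (hz' : z' ∈ G.Q)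
    (hcp : ∀ i, 0 < c i) (hzp : ∀ i, 0 < z i) (hzp' : ∀ i, 0 < z' i)
    (hv : ∀ i, |v i / c i| ≤ s) (hf : ∀ i, 0 ≤ f i)
    (hfz : ∑ i, f i * z i ≤ G.bound) (hflow : IsFlowStep G.V G.form η τ c v)
    (hstep : IsBarrierStep G.V η τ f z z') :
    barrierDiv (c + v) z' ≤ barrierDiv c z - η * τ / 2 * barrierSym c z
      + η * (∑ i, f i * (c i - z i) - G.form z (c - z))
      + (9 * Fintype.card I + 1) * (η * τ + η * G.bound) ^ 2 := by
  have hητ : 0 < η * τ := by positivity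
  have hηB : 0 < η * G.bound := mul_pos hη G.bound_pos
  have hvc i := abs_le_mul_of_abs_div_le (hcp i) (hv i)
  have hform : -(G.form v c - G.form v z) ≤ 2 * s * G.bound := by
    have hvc_le := abs_le.1 (G.abs_form_le_mul_left hc hc hs0 hvc)
    have hvz_le := abs_le.1 (G.abs_form_le_mul_left hc hz hs0 hvc)
    linarith
  have hform_η := mul_le_mul_of_nonneg_left hform hη.le
  have hupdate := barrierDiv_update_le hcp hzp hzp'
    (fun i => by linarith [(abs_le.1 (hv i)).1]) (G.sub_mem c hc z hz) (G.sub_mem _ hcv z hz)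
    hflow hstep
  have hmove := hstep.barrierSym_le hη hτ G.bound_pos.le hρ (G.sub_mem z' hz' z hz) hzp hzp' hf hfz
  have hdrift := sum_flow_drift_le hη.le hτ.le hs0 hcp hzp hv hf hfz
  have herror := tracking_error_le (Nat.cast_nonneg (Fintype.card I)) (barrierSym_nonneg hcp hzp)
    hητ.le hηB.le hs0 hs hρ
  rw [form_add_sub_of_isAlt G.isAlt] at hupdate
  linarith

lemma localNorm_le_of_sum_div_eq_zero (hη : 0 < η) (hcQ : c ∈ G.Q) (hc : ∀ i, 0 < c i)
    (hcen : ∀ w ∈ G.V, ∑ i, w i / c i = 0) (h : IsFlowStep G.V G.form η τ c v) :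
    localNorm c v ≤ η * G.bound := by
  have hsq : localNorm c v ^ 2 = -η * G.form c v := by
    rw [← apply_add_self_of_isAlt G.isAlt, ← h.2 v h.1, sq_localNorm, ← sub_eq_zero,
      ← Finset.sum_sub_distrib, ← mul_zero (η * τ), ← hcen v h.1, Finset.mul_sum]
    exact Finset.sum_congr rfl fun i _ => by ring
  have hform := (abs_le.1 (G.abs_form_le_mul_right hcQ hcQ (localNorm_nonneg c v)
    fun i => abs_le_mul_of_abs_div_le (hc i) (abs_div_le_localNorm c v i))).1
  rcases (localNorm_nonneg c v).eq_or_lt with h0 | h0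
  · rw [← h0]
    exact (mul_pos hη G.bound_pos).le
  · refine le_of_mul_le_mul_right ?_ h0
    linarith [mul_le_mul_of_nonneg_left hform hη.le]

/-- `c` is the analytic centre of `G.Q`, the minimizer of the log-barrier, where the deterministic
flow starts. -/
structure IsAnalyticCenter (c : I → ℝ) : Prop where
  mem : c ∈ G.Q
  pos : ∀ i, 0 < c i
  sum_log_le : ∀ z ∈ G.Q, (∀ i, 0 < z i) → ∑ i, Real.log (z i) ≤ ∑ i, Real.log (c i)

lemma exists_isAnalyticCenter (hz : z ∈ G.Q) (hzp : ∀ i, 0 < z i) :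
    ∃ c, G.IsAnalyticCenter c := by
  obtain ⟨c, hc, hmax⟩ := G.isCompact.exists_isMaxOn ⟨z, hz⟩
    (f := fun z : I → ℝ => ∏ i, z i) (by fun_prop)
  have hprod : 0 < ∏ i, c i := (Finset.prod_pos fun i _ => hzp i).trans_le (hmax hz)
  have hcp (i) : 0 < c i := (G.nonneg c hc i).lt_of_ne fun h =>
    hprod.ne' (Finset.prod_eq_zero (Finset.mem_univ i) h.symm)
  refine ⟨c, hc, hcp, fun z hz hzp => ?_⟩
  rw [← Real.log_prod fun i _ => (hzp i).ne', ← Real.log_prod fun i _ => (hcp i).ne']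
  exact Real.log_le_log (Finset.prod_pos fun i _ => hzp i) (hmax hz)

variable {G} in
lemma IsAnalyticCenter.sum_div_eq_zero (hc : G.IsAnalyticCenter c) {w : I → ℝ} (hw : w ∈ G.V) :
    ∑ i, w i / c i = 0 := by
  have hderiv : HasDerivAt (fun s : ℝ => ∑ i, Real.log (c i + s * w i)) (∑ i, w i / c i) 0 := by
    refine HasDerivAt.fun_sum fun i _ => ?_
    have hline : HasDerivAt (fun s : ℝ => c i + s * w i) (w i) 0 := by
      simpa using ((hasDerivAt_id (0 : ℝ)).mul_const (w i)).const_add (c i)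
    simpa using hline.log (by simpa using (hc.pos i).ne')
  have hpos : ∀ᶠ s : ℝ in nhds 0, ∀ i, 0 < c i + s * w i := by
    refine Filter.eventually_all.2 fun i => ?_
    have hcont : ContinuousAt (fun s : ℝ => c i + s * w i) 0 := by fun_prop
    exact hcont.eventually_const_lt (by simpa using hc.pos i)
  have hmax : IsLocalMax (fun s : ℝ => ∑ i, Real.log (c i + s * w i)) 0 := by
    filter_upwards [hpos] with s hs
    have hQ := G.add_mem c hc.mem (s • w) (G.V.smul_mem s hw) fun i => (hs i).le
    simpa using hc.sum_log_le _ hQ hs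
  exact hmax.hasDerivAt_eq_zero hderiv

/-- `c` is a trajectory of the deterministic flow in `G.Q`, with displacements `v`, learning rates
`η` and regularizations `τ`, whose relative speed stays below `η t * τ t / 8`. -/
structure IsFlow (η τ : ℕ → ℝ) (c v : ℕ → I → ℝ) : Prop where
  mem : ∀ t, c t ∈ G.Q
  pos : ∀ t i, 0 < c t i
  isFlowStep : ∀ t, IsFlowStep G.V G.form (η t) (τ t) (c t) (v t)
  succ : ∀ t, c (t + 1) = c t + v t
  speed : ∀ t, localNorm (c t) (v t) ≤ η t * τ t / 8

section Flow

variable {η τ : ℕ → ℝ} {c v : ℕ → I → ℝ}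

lemma isFlow_of_isFlowStep (hη : ∀ t, 0 < η t) (hηa : Antitone η)
    (hτ : ∀ t, 0 < τ t) (hsmall : ∀ t, η t * τ t ≤ 1 / 4)
    (hcontract : ∀ t, (1 + η t * τ t / 8 - η (t + 1) * τ t) * (η t * τ t / 8)
      + η (t + 1) * |τ (t + 1) - τ t| * √(Fintype.card I) ≤ η (t + 1) * τ (t + 1) / 8)
    (hτ0 : 8 * G.bound ≤ τ 0) (hc0 : G.IsAnalyticCenter (c 0))
    (hsucc : ∀ t, c (t + 1) = c t + v t)
    (hstep : ∀ t, (∀ i, 0 < c t i) → IsFlowStep G.V G.form (η t) (τ t) (c t) (v t)) :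
    G.IsFlow η τ c v := by
  have hητ t : 0 < η t * τ t := mul_pos (hη t) (hτ t)
  have hinv (t : ℕ) : c t ∈ G.Q ∧ (∀ i, 0 < c t i) ∧ localNorm (c t) (v t) ≤ η t * τ t / 8 := by
    induction t with
    | zero =>
      refine ⟨hc0.mem, hc0.pos, (G.localNorm_le_of_sum_div_eq_zero (hη 0) hc0.mem hc0.pos
        (fun w hw => hc0.sum_div_eq_zero hw) (hstep 0 hc0.pos)).trans ?_⟩
      linarith [mul_le_mul_of_nonneg_left hτ0 (hη 0).le]
    | succ t ih =>
      obtain ⟨hQ, hpos, hspeed⟩ := ih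
      have hpos' := add_pos_of_localNorm_lt_one hpos (by linarith [hsmall t] : _ < (1 : ℝ))
      rw [← hsucc] at hpos'
      have hQ' : c (t + 1) ∈ G.Q := by
        rw [hsucc]
        exact G.add_mem _ hQ _ (hstep t hpos).1 fun i => by simpa [hsucc] using (hpos' i).le
      refine ⟨hQ', hpos', le_trans ?_ (hcontract t)⟩
      have hnext := hstep (t + 1) hpos'
      rw [hsucc] at hnext hpos' ⊢
      refine (IsFlowStep.localNorm_le G.isAlt (hη t) (hη (t + 1)) (hηa t.le_succ) (hτ t).le hpos
        hpos' (by linarith [hsmall t]) (hstep t hpos) hnext).trans ?_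
      have hrate : η (t + 1) * τ t ≤ 1 / 4 :=
        (mul_le_mul_of_nonneg_right (hηa t.le_succ) (hτ t).le).trans (hsmall t)
      have hnonneg := localNorm_nonneg (c t) (v t)
      gcongr
      linarith [hητ t]
  exact ⟨fun t => (hinv t).1, fun t => (hinv t).2.1, fun t => hstep t (hinv t).2.1, hsucc,
    fun t => (hinv t).2.2⟩

theorem exists_isFlow (hη : ∀ t, 0 < η t) (hηa : Antitone η)
    (hτ : ∀ t, 0 < τ t) (hsmall : ∀ t, η t * τ t ≤ 1 / 4)
    (hcontract : ∀ t, (1 + η t * τ t / 8 - η (t + 1) * τ t) * (η t * τ t / 8)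
      + η (t + 1) * |τ (t + 1) - τ t| * √(Fintype.card I) ≤ η (t + 1) * τ (t + 1) / 8)
    (hτ0 : 8 * G.bound ≤ τ 0) {c₀ : I → ℝ} (hc₀ : G.IsAnalyticCenter c₀) :
    ∃ c v : ℕ → I → ℝ, c 0 = c₀ ∧ G.IsFlow η τ c v := by
  choose! step hstep using fun t c hc => exists_isFlowStep G.isAlt G.V (η t) (τ t) (c := c) hc
  let c (t : ℕ) : I → ℝ := Nat.rec c₀ (fun t c => c + step t c) t
  exact ⟨c, fun t => step t (c t), rfl, G.isFlow_of_isFlowStep hη hηa hτ hsmall hcontract hτ0 hc₀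
    (fun _ => rfl) fun t => hstep t (c t)⟩

end Flow

/-- At the endpoint of a flow step the loss equals `τ` times the gradient of the barrier at `c`, up
to the relative speed. -/
lemma form_add_sub_le (hη : 0 < η) (hτ : 0 < τ) (hητ : η * τ ≤ 1 / 8)
    (hc : ∀ i, 0 < c i) (hz : z ∈ G.Q) (hzp : ∀ i, 0 < z i) (hz' : z' ∈ G.Q)
    (hv : ∀ i, |v i / c i| ≤ η * τ / 8) (hclose : ∀ i, |(c i + v i) / z i - 1| ≤ 1 / 16)
    (hflow : IsFlowStep G.V G.form η τ c v) :
    G.form (c + v) (z - z') ≤ 5 / 4 * Fintype.card I * τ := by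
  have hcoord (i : I) : -((v i / c i - η * τ) * (z - z') i / c i) ≤ η * (5 / 4 * τ) := by
    have hv' := abs_le.1 (hv i)
    have hητ0 : 0 < η * τ := by positivity
    have hratio := div_le_of_abs_add_div_sub_one_le (hc i) (hzp i)
      ((hv i).trans (by linarith)) (hclose i)
    have hsub : (z i - z' i) / c i ≤ z i / c i :=
      div_le_div_of_nonneg_right (sub_le_self _ (G.nonneg z' hz' i)) (hc i).le
    calc -((v i / c i - η * τ) * (z - z') i / c i)
        = (η * τ - v i / c i) * ((z i - z' i) / c i) := by
          rw [Pi.sub_apply]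
          ring
      _ ≤ (η * τ - v i / c i) * (13 / 12) :=
          mul_le_mul_of_nonneg_left (hsub.trans hratio) (by linarith)
      _ ≤ η * (5 / 4 * τ) := by linarith
  have hsum := Finset.sum_le_sum fun i (_ : i ∈ Finset.univ) => hcoord i
  rw [Finset.sum_neg_distrib, hflow.2 _ (G.sub_mem z hz z' hz'), Finset.sum_const,
    Finset.card_univ, nsmul_eq_mul] at hsum
  refine le_of_mul_le_mul_left ?_ hη
  linarith

theorem form_sub_le {e : ℝ} (hη : 0 < η) (hτ : 0 < τ)
    (hητ : η * τ ≤ 1 / 8) (he0 : 0 ≤ e) (he : e ≤ 1 / 16)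
    (hc : ∀ i, 0 < c i) (hz : z ∈ G.Q) (hzp : ∀ i, 0 < z i)
    (hz' : z' ∈ G.Q) (hv : ∀ i, |v i / c i| ≤ η * τ / 8)
    (hclose : ∀ i, |(c + v) i / z i - 1| ≤ e) (hflow : IsFlowStep G.V G.form η τ c v) :
    G.form z (z - z') ≤ 5 / 4 * Fintype.card I * τ + 2 * e * G.bound := by
  have hflow_gap := G.form_add_sub_le hη hτ hητ hc hz hzp hz' hv
    (fun i => (hclose i).trans he) hflow
  have hdist (i : I) : |(z - (c + v)) i| ≤ e * z i := by
    refine abs_le_mul_of_abs_div_le (hzp i) ?_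
    rw [Pi.sub_apply, sub_div, div_self (hzp i).ne', abs_sub_comm]
    exact hclose i
  have hz_le := abs_le.1 (G.abs_form_le_mul_left hz hz he0 hdist)
  have hz'_le := abs_le.1 (G.abs_form_le_mul_left hz hz' he0 hdist)
  have hsplit : G.form z (z - z') = G.form (c + v) (z - z')
      + (G.form (z - (c + v)) z - G.form (z - (c + v)) z') := by
    simp only [map_sub, LinearMap.sub_apply]
    ring
  linarith

end SaddleProblem

/-! ### Conditional laws and exponential supermartingales -/

section ConditionalLaw

/-- Given `m`, the discrete random variable `Z` has the conditional law `p`. -/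
structure HasCondLaw {Ω ζ : Type*} [Fintype ζ] {mΩ : MeasurableSpace Ω} (P : Measure Ω)
    (m : MeasurableSpace Ω) (Z : Ω → ζ) (p : ζ → Ω → ℝ) : Prop where
  measurableSet_eq : ∀ j, MeasurableSet[mΩ] {ω | Z ω = j}
  measurable : ∀ j, Measurable[m] (p j)
  nonneg : ∀ j ω, 0 ≤ p j ω
  sum_eq_one : ∀ ω, ∑ j, p j ω = 1
  condExp_ae_eq : ∀ j, P[Set.indicator {ω | Z ω = j} (fun _ => (1 : ℝ)) | m] =ᵐ[P] p j

variable {Ω : Type*} {m mΩ : MeasurableSpace Ω} {P : Measure Ω}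

lemma trim_restrict_eq_trim_withDensity [IsFiniteMeasure P] (hm : m ≤ mΩ) {s : Set Ω}
    (hs : MeasurableSet s) {p : Ω → ℝ} (hp0 : ∀ ω, 0 ≤ p ω)
    (h : P[s.indicator (fun _ => (1 : ℝ)) | m] =ᵐ[P] p) :
    (P.restrict s).trim hm = (P.withDensity fun ω => ENNReal.ofReal (p ω)).trim hm := by
  refine @Measure.ext _ m _ _ fun u hu => ?_
  have hind : Integrable (s.indicator (fun _ => (1 : ℝ))) P := (integrable_const 1).indicator hs
  have hp : Integrable p P := integrable_condExp.congr h
  have hint : ∫ ω in u, p ω ∂P = ∫ ω in u, s.indicator (fun _ => (1 : ℝ)) ω ∂P := by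
    rw [← setIntegral_condExp hm hind hu]
    exact setIntegral_congr_ae (hm u hu) (h.mono fun _ hω _ => hω.symm)
  rw [trim_measurableSet_eq hm hu, trim_measurableSet_eq hm hu, Measure.restrict_apply (hm u hu),
    withDensity_apply _ (hm u hu),
    ← ofReal_integral_eq_lintegral_ofReal hp.integrableOn (Filter.Eventually.of_forall hp0),
    hint, integral_indicator hs, Measure.restrict_restrict hs, setIntegral_const, smul_eq_mul,
    mul_one, measureReal_def, ENNReal.ofReal_toReal (measure_ne_top _ _), Set.inter_comm]

lemma setLIntegral_eq_lintegral_mul_of_condExp [IsFiniteMeasure P] (hm : m ≤ mΩ) {s : Set Ω}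
    (hs : MeasurableSet s) {p : Ω → ℝ} (hp : Measurable[m] p) (hp0 : ∀ ω, 0 ≤ p ω)
    (h : P[s.indicator (fun _ => (1 : ℝ)) | m] =ᵐ[P] p) {f : Ω → ENNReal}
    (hf : Measurable[m] f) :
    ∫⁻ ω in s, f ω ∂P = ∫⁻ ω, ENNReal.ofReal (p ω) * f ω ∂P := by
  rw [← lintegral_trim hm hf, trim_restrict_eq_trim_withDensity hm hs hp0 h, lintegral_trim hm hf,
    lintegral_withDensity_eq_lintegral_mul _ (hp.mono hm le_rfl).ennreal_ofReal
      (hf.mono hm le_rfl)]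
  rfl

variable {ζ : Type*} [Fintype ζ]

lemma lintegral_comp_eq_sum_setLIntegral {Z : Ω → ζ} (hZ : ∀ j, MeasurableSet {ω | Z ω = j})
    {f : ζ → Ω → ENNReal} (hf : ∀ j, Measurable (f j)) :
    ∫⁻ ω, f (Z ω) ω ∂P = ∑ j, ∫⁻ ω in {ω | Z ω = j}, f j ω ∂P := by
  classical
  simp_rw [← lintegral_indicator (hZ _)]
  rw [← lintegral_finsetSum' _ fun j _ => ((hf j).indicator (hZ j)).aemeasurable]
  simp [Set.indicator_apply]

lemma HasCondLaw.setLIntegral_comp_eq [IsFiniteMeasure P] {Z : Ω → ζ} {p : ζ → Ω → ℝ}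
    (hlaw : HasCondLaw P m Z p) (hm : m ≤ mΩ) {s : Set Ω} (hs : MeasurableSet[m] s)
    {g : ζ → Ω → ℝ} (hg : ∀ j, Measurable[m] (g j)) (hg0 : ∀ j ω, 0 ≤ g j ω) :
    ∫⁻ ω in s, ENNReal.ofReal (g (Z ω) ω) ∂P =
      ∫⁻ ω in s, ENNReal.ofReal (∑ j, p j ω * g j ω) ∂P := by
  classical
  have hgs (j : ζ) : Measurable[m] (s.indicator fun ω => ENNReal.ofReal (g j ω)) :=
    Measurable.indicator (hg j).ennreal_ofReal hs
  have hgs' (j : ζ) : Measurable (s.indicator fun ω => ENNReal.ofReal (g j ω)) :=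
    (hgs j).mono hm le_rfl
  have hp (j : ζ) : Measurable fun ω => ENNReal.ofReal (p j ω) :=
    ((hlaw.measurable j).mono hm le_rfl).ennreal_ofReal
  calc ∫⁻ ω in s, ENNReal.ofReal (g (Z ω) ω) ∂P
      = ∫⁻ ω, s.indicator (fun ω' => ENNReal.ofReal (g (Z ω) ω')) ω ∂P := by
        rw [← lintegral_indicator (hm s hs)]
        exact lintegral_congr fun ω => by simp only [Set.indicator_apply]
    _ = ∑ j, ∫⁻ ω, ENNReal.ofReal (p j ω) * s.indicator (fun ω => ENNReal.ofReal (g j ω)) ω ∂P := by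
        rw [lintegral_comp_eq_sum_setLIntegral hlaw.measurableSet_eq
          (f := fun j => s.indicator fun ω => ENNReal.ofReal (g j ω)) hgs']
        exact Finset.sum_congr rfl fun j _ => setLIntegral_eq_lintegral_mul_of_condExp hm
          (hlaw.measurableSet_eq j) (hlaw.measurable j) (hlaw.nonneg j) (hlaw.condExp_ae_eq j)
          (hgs j)
    _ = ∫⁻ ω in s, ENNReal.ofReal (∑ j, p j ω * g j ω) ∂P := by
        rw [← lintegral_finsetSum _ fun j _ => by exact (hp j).mul (hgs' j),
          ← lintegral_indicator (hm s hs)]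
        refine lintegral_congr fun ω => ?_
        by_cases hω : ω ∈ s
        · simp only [Set.indicator_of_mem hω]
          rw [ENNReal.ofReal_sum_of_nonneg fun j _ => mul_nonneg (hlaw.nonneg j ω) (hg0 j ω)]
          exact Finset.sum_congr rfl fun j _ => (ENNReal.ofReal_mul (hlaw.nonneg j ω)).symm
        · simp [hω]

end ConditionalLaw

section MaximalInequality

variable {Ω : Type*} {mΩ : MeasurableSpace Ω} {P : Measure Ω}

theorem setLIntegral_le_of_drift [IsProbabilityMeasure P] {ℱ : Filtration ℕ mΩ}
    {ζ : Type*} [Fintype ζ] {Z : ℕ → Ω → ζ} {p g : ℕ → ζ → Ω → ℝ} {Y : ℕ → Ω → ℝ}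
    {S : ℕ → Set Ω} {k : ℕ → ℝ} {U : ℝ}
    (hlaw : ∀ t, HasCondLaw P (ℱ t) (Z t) (p t)) (hS : Antitone S)
    (hSm : ∀ t, MeasurableSet[ℱ t] (S (t + 1))) (hg : ∀ t j, Measurable[ℱ t] (g t j))
    (hg0 : ∀ t j ω, 0 ≤ g t j ω) (hk0 : ∀ t, 0 ≤ k t) (hk1 : ∀ t, k t ≤ 1) (hU : 0 ≤ U)
    (hinit : ∀ ω, Y 0 ω ≤ U) (hstep : ∀ t, ∀ ω ∈ S (t + 1), Y (t + 1) ω ≤ g t (Z t ω) ω)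
    (hmean : ∀ t, ∀ ω ∈ S (t + 1), ∑ j, p t j ω * g t j ω ≤ (1 - k t) * Y t ω + k t * U)
    (t : ℕ) :
    ∫⁻ ω in S t, ENNReal.ofReal (Y t ω) ∂P ≤ ENNReal.ofReal U := by
  induction t with
  | zero =>
    calc ∫⁻ ω in S 0, ENNReal.ofReal (Y 0 ω) ∂P ≤ ∫⁻ _ in S 0, ENNReal.ofReal U ∂P :=
          lintegral_mono fun ω => ENNReal.ofReal_le_ofReal (hinit ω)
      _ ≤ ENNReal.ofReal U := by
          rw [setLIntegral_const]
          exact mul_le_of_le_one_right' prob_le_one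
  | succ t ih =>
    have hk : 0 ≤ 1 - k t := sub_nonneg.2 (hk1 t)
    have hSm' : MeasurableSet (S (t + 1)) := ℱ.le t _ (hSm t)
    calc ∫⁻ ω in S (t + 1), ENNReal.ofReal (Y (t + 1) ω) ∂P
        ≤ ∫⁻ ω in S (t + 1), ENNReal.ofReal (g t (Z t ω) ω) ∂P :=
          setLIntegral_mono' hSm' fun ω hω => ENNReal.ofReal_le_ofReal (hstep t ω hω)
      _ = ∫⁻ ω in S (t + 1), ENNReal.ofReal (∑ j, p t j ω * g t j ω) ∂P :=
          (hlaw t).setLIntegral_comp_eq (ℱ.le t) (hSm t) (hg t) (hg0 t)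
      _ ≤ ∫⁻ ω in S (t + 1), (ENNReal.ofReal (1 - k t) * ENNReal.ofReal (Y t ω)
            + ENNReal.ofReal (k t * U)) ∂P := by
          refine setLIntegral_mono' hSm' fun ω hω => ?_
          rw [← ENNReal.ofReal_mul hk]
          exact (ENNReal.ofReal_le_ofReal (hmean t ω hω)).trans ENNReal.ofReal_add_le
      _ ≤ ENNReal.ofReal (1 - k t) * ENNReal.ofReal U + ENNReal.ofReal (k t * U) := by
          rw [lintegral_add_right _ measurable_const,
            lintegral_const_mul' _ _ ENNReal.ofReal_ne_top, setLIntegral_const]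
          exact add_le_add (mul_le_mul_right ((lintegral_mono_set (hS t.le_succ)).trans ih) _)
            (mul_le_of_le_one_right' prob_le_one)
      _ = ENNReal.ofReal U := by
          rw [← ENNReal.ofReal_mul hk, ← ENNReal.ofReal_add (mul_nonneg hk hU)
            (mul_nonneg (hk0 t) hU), ← add_mul, sub_add_cancel, one_mul]

lemma measurableSet_forall_lt_le {m : MeasurableSpace Ω} {X : ℕ → Ω → ℝ} {t : ℕ}
    (hX : ∀ s < t, Measurable[m] (X s)) (R : ℝ) :
    MeasurableSet[m] {ω | ∀ s < t, X s ω ≤ R} := by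
  simp only [Set.ofPred_forall]
  exact MeasurableSet.iInter fun s => MeasurableSet.iInter fun hs => hX s hs measurableSet_Iic

lemma measure_inter_lt_le_of_setLIntegral_exp_le {X : Ω → ℝ} (hX : Measurable X) {S : Set Ω}
    (hS : MeasurableSet S) {r b q U : ℝ} (hr : 0 ≤ r)
    (h : ∫⁻ ω in S, ENNReal.ofReal (Real.exp (r * X ω)) ∂P ≤ ENNReal.ofReal U)
    (hU : U ≤ q * Real.exp (r * b)) : P (S ∩ {ω | b < X ω}) ≤ ENNReal.ofReal q := by
  have hpos := Real.exp_pos (r * b)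
  refine (ENNReal.mul_le_mul_iff_right (by simpa using hpos) ENNReal.ofReal_ne_top).1 ?_
  calc ENNReal.ofReal (Real.exp (r * b)) * P (S ∩ {ω | b < X ω})
      = ∫⁻ _ in S ∩ {ω | b < X ω}, ENNReal.ofReal (Real.exp (r * b)) ∂P := by
        rw [setLIntegral_const]
    _ ≤ ∫⁻ ω in S ∩ {ω | b < X ω}, ENNReal.ofReal (Real.exp (r * X ω)) ∂P := by
        refine setLIntegral_mono' (hS.inter (hX measurableSet_Ioi)) fun ω hω => ?_
        exact ENNReal.ofReal_le_ofReal
          (Real.exp_le_exp.2 (mul_le_mul_of_nonneg_left (le_of_lt hω.2) hr))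
    _ ≤ ENNReal.ofReal U := (lintegral_mono_set Set.inter_subset_left).trans h
    _ ≤ ENNReal.ofReal (Real.exp (r * b)) * ENNReal.ofReal q := by
        rw [← ENNReal.ofReal_mul hpos.le, mul_comm]
        exact ENNReal.ofReal_le_ofReal hU

/-- Before the first time at which some level `b t` is exceeded, `X` is below `R`, so that the
exponential moments on the stopped events suffice for the union bound. -/
theorem one_sub_le_measureReal_forall_le [IsProbabilityMeasure P] {X : ℕ → Ω → ℝ}
    {r b w : ℕ → ℝ} {δ R U : ℝ} (hδ : 0 < δ) (hX : ∀ t, Measurable (X t))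
    (hmoment : ∀ t, ∫⁻ ω in {ω | ∀ s < t, X s ω ≤ R}, ENNReal.ofReal (Real.exp (r t * X t ω)) ∂P
      ≤ ENNReal.ofReal U)
    (hr : ∀ t, 0 ≤ r t) (hb : ∀ t, b t ≤ R)
    (hw : ∀ t, U ≤ δ * w t * Real.exp (r t * b t)) (hw0 : ∀ t, 0 ≤ w t)
    (hsum : ∀ n, ∑ t ∈ Finset.range n, w t ≤ 1) :
    1 - δ ≤ P.real {ω | ∀ t, X t ω ≤ b t} := by
  have htail (t : ℕ) : P ({ω | ∀ s < t, X s ω ≤ R} ∩ {ω | b t < X t ω}) ≤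
      ENNReal.ofReal (δ * w t) :=
    measure_inter_lt_le_of_setLIntegral_exp_le (hX t)
      (measurableSet_forall_lt_le (fun s _ => hX s) R) (hr t) (hmoment t) (hw t)
  have hsub : {ω | ∀ t, X t ω ≤ b t}ᶜ ⊆ ⋃ t, {ω | ∀ s < t, X s ω ≤ R} ∩ {ω | b t < X t ω} := by
    intro ω hω
    simp only [Set.mem_compl_iff, Set.mem_ofPred_eq, not_forall, not_le] at hω
    classical
    refine Set.mem_iUnion.2 ⟨Nat.find hω, fun s hs => ?_, Nat.find_spec hω⟩
    exact (not_lt.1 (Nat.find_min hω hs)).trans (hb s)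
  have hcompl : P {ω | ∀ t, X t ω ≤ b t}ᶜ ≤ ENNReal.ofReal δ := by
    refine ((measure_mono hsub).trans (measure_iUnion_le _)).trans
      ((ENNReal.tsum_le_tsum htail).trans (ENNReal.tsum_le_of_sum_range_le fun n => ?_))
    rw [← ENNReal.ofReal_sum_of_nonneg fun t _ => mul_nonneg hδ.le (hw0 t), ← Finset.mul_sum]
    exact ENNReal.ofReal_le_ofReal (mul_le_of_le_one_right hδ.le (hsum n))
  have hmeas : MeasurableSet {ω | ∀ t, X t ω ≤ b t} := by
    rw [Set.ofPred_forall]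
    exact MeasurableSet.iInter fun t => hX t measurableSet_Iic
  have hreal : P.real {ω | ∀ t, X t ω ≤ b t}ᶜ ≤ δ :=
    ENNReal.toReal_le_of_le_ofReal hδ.le hcompl
  linarith [probReal_compl_eq_one_sub (μ := P) hmeas]

end MaximalInequality

/-! ### Tracking the flow -/

section Schedule

/-- The level below which the divergence to the flow is kept: a constant as long as the
regularization is strong, then of the order of its square. -/
noncomputable def divLevel (R : ℝ) (τ : ℕ → ℝ) (t : ℕ) : ℝ :=
  if 1 ≤ τ t then R else (τ t / 48) ^ 2

lemma divLevel_le {R : ℝ} {τ : ℕ → ℝ} {t : ℕ} (hR : 1 ≤ R) (hτ : 0 ≤ τ t) :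
    divLevel R τ t ≤ R := by
  unfold divLevel
  split_ifs with h
  · exact le_rfl
  · have : (τ t / 48) ^ 2 ≤ 1 ^ 2 := by gcongr; linarith [not_le.1 h]
    linarith

/-- Learning rates `η` and regularization `τ` for which a flow in dimension `n` with form bounded
by `B` keeps a relative speed of at most `η τ / 8`. -/
structure IsFlowSchedule (n B : ℝ) (η τ : ℕ → ℝ) : Prop where
  eta_pos : ∀ t, 0 < η t
  eta_anti : Antitone η
  tau_pos : ∀ t, 0 < τ t
  small : ∀ t, η t * τ t + η t * B ≤ 1 / 8
  speed : ∀ t, (1 + η t * τ t / 8 - η (t + 1) * τ t) * (η t * τ t / 8)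
      + η (t + 1) * |τ (t + 1) - τ t| * √n ≤ η (t + 1) * τ (t + 1) / 8
  tau_zero : 8 * B ≤ τ 0

/-- A flow schedule along which the divergence to the flow stays below `divLevel R τ` with
probability `1 - δ`. Here `d₀` bounds the initial divergence, the `r t` are inverse temperatures,
under which the exponential moments contract at rates `k t` to `exp u`, and the `w t` distribute the
failure probability `δ` over time. -/
structure IsTrackingSchedule (n B d₀ R δ : ℝ) (η τ r k w : ℕ → ℝ) (u : ℝ) : Prop
    extends IsFlowSchedule n B η τ where
  tau_succ : ∀ t, τ t ≤ 7 / 5 * τ (t + 1)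
  r_nonneg : ∀ t, 0 ≤ r t
  r_small : ∀ t, r (t + 1) * (η t * (2 * B * (2 * R + 2))) ≤ 1
  r_tau : ∀ t, r (t + 1) * (η t * (4 * B ^ 2 * (2 * R + 2))) ≤ τ t / 4
  k_nonneg : ∀ t, 0 ≤ k t
  k_le_one : ∀ t, k t ≤ 1
  contract : ∀ t, r (t + 1) * (1 - η t * τ t / 4) ≤ (1 - k t) * r t
  drift : ∀ t, r (t + 1) * ((9 * n + 1) * (η t * τ t + η t * B) ^ 2) ≤ k t * u
  start : r 0 * d₀ ≤ u
  level : ∀ t, Real.exp u ≤ δ * w t * Real.exp (r t * divLevel R τ t)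
  w_nonneg : ∀ t, 0 ≤ w t
  w_sum : ∀ n, ∑ t ∈ Finset.range n, w t ≤ 1
  one_le : 1 ≤ R

end Schedule

section ExponentialMoment

lemma sum_mul_exp_le {ζ : Type*} [Fintype ζ] {p x : ζ → ℝ} {y : ℝ} (hp : ∀ z, 0 ≤ p z)
    (hp1 : ∑ z, p z = 1) (hx : ∑ z, p z * x z = 0) (hx1 : ∀ z, |x z| ≤ 1)
    (hy : ∀ z, x z ^ 2 ≤ y) : ∑ z, p z * Real.exp (x z) ≤ Real.exp y := by
  calc ∑ z, p z * Real.exp (x z) ≤ ∑ z, (p z * (1 + y) + p z * x z) := by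
        refine Finset.sum_le_sum fun z _ => ?_
        rw [← mul_add]
        refine mul_le_mul_of_nonneg_left ?_ (hp z)
        linarith [hy z, (abs_le.1 (Real.abs_exp_sub_one_sub_id_le (hx1 z))).2]
    _ = 1 + y := by rw [Finset.sum_add_distrib, hx, ← Finset.sum_mul, hp1]; ring
    _ ≤ Real.exp y := by linarith [Real.add_one_le_exp y]

lemma exp_contract_le {r r' k u a X S E : ℝ} (hX : 0 ≤ X) (hXS : X ≤ S) (ha : 0 ≤ a)
    (hr' : 0 ≤ r') (hk0 : 0 ≤ k) (hk1 : k ≤ 1) (hcontract : r' * (1 - a) ≤ (1 - k) * r)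
    (hdrift : r' * E ≤ k * u) :
    Real.exp (r' * (X - a * S + E)) ≤ (1 - k) * Real.exp (r * X) + k * Real.exp u := by
  have hexponent : r' * (X - a * S + E) ≤ (1 - k) * (r * X) + k * u := by
    have hS : r' * (a * X) ≤ r' * (a * S) := by gcongr
    linarith [mul_le_mul_of_nonneg_right hcontract hX]
  have hconvex := convexOn_exp.2 (Set.mem_univ (r * X)) (Set.mem_univ u)
    (sub_nonneg.2 hk1) hk0 (sub_add_cancel 1 k)
  simp only [smul_eq_mul] at hconvex
  exact (Real.exp_le_exp.2 hexponent).trans hconvex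

end ExponentialMoment

section Measurability

variable {Ω I : Type*} [Fintype I] {m : MeasurableSpace Ω} {z : Ω → I → ℝ}

lemma measurable_barrierDiv (c : I → ℝ) (hz : ∀ i, Measurable fun ω => z ω i) :
    Measurable fun ω => barrierDiv c (z ω) := by
  unfold barrierDiv
  fun_prop

lemma measurable_barrierSym (c : I → ℝ) (hz : ∀ i, Measurable fun ω => z ω i) :
    Measurable fun ω => barrierSym c (z ω) := by
  unfold barrierSym
  fun_prop

end Measurability

namespace SaddleProblem

variable {I : Type*} [Fintype I] (G : SaddleProblem I)

section Fluctuation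

variable {f c z : I → ℝ} {R : ℝ}

/-- The noise in direction `c - z` of an estimate `f` of the linear form `form z`. -/
def fluctuation (f c z : I → ℝ) : ℝ :=
  ∑ i, f i * (c i - z i) - G.form z (c - z)

lemma abs_fluctuation_le {x : ℝ} (hx : 0 ≤ x) (hz : z ∈ G.Q)
    (hzp : ∀ i, 0 < z i) (hf : ∀ i, 0 ≤ f i) (hfz : ∑ i, f i * z i ≤ G.bound)
    (h : ∀ i, |c i / z i - 1| ≤ x) : |G.fluctuation f c z| ≤ 2 * G.bound * x := by
  have hdist (i : I) : |c i - z i| ≤ x * z i := by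
    refine abs_le_mul_of_abs_div_le (hzp i) ?_
    rw [sub_div, div_self (hzp i).ne']
    exact h i
  have hestimate : |∑ i, f i * (c i - z i)| ≤ G.bound * x := by
    calc |∑ i, f i * (c i - z i)| ≤ ∑ i, |f i * (c i - z i)| := Finset.abs_sum_le_sum_abs _ _
      _ ≤ ∑ i, f i * z i * x := by
          refine Finset.sum_le_sum fun i _ => ?_
          rw [abs_mul, abs_of_nonneg (hf i)]
          linarith [mul_le_mul_of_nonneg_left (hdist i) (hf i)]
      _ = (∑ i, f i * z i) * x := by rw [Finset.sum_mul]
      _ ≤ G.bound * x := mul_le_mul_of_nonneg_right hfz hx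
  have hform : |G.form z (c - z)| ≤ x * G.bound := G.abs_form_le_mul_right hz hz hx hdist
  calc |G.fluctuation f c z| ≤ |∑ i, f i * (c i - z i)| + |G.form z (c - z)| := abs_sub _ _
    _ ≤ 2 * G.bound * x := by linarith

lemma sq_fluctuation_le (hz : z ∈ G.Q) (hcp : ∀ i, 0 < c i) (hzp : ∀ i, 0 < z i)
    (hf : ∀ i, 0 ≤ f i) (hfz : ∑ i, f i * z i ≤ G.bound) (hR : barrierDiv c z ≤ R) :
    G.fluctuation f c z ^ 2 ≤ 4 * G.bound ^ 2 * (2 * R + 2) * barrierSym c z := by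
  have hR0 : 0 ≤ R := (barrierDiv_nonneg hcp hzp).trans hR
  have hRS : 0 ≤ (2 * R + 2) * barrierSym c z :=
    mul_nonneg (by linarith) (barrierSym_nonneg hcp hzp)
  have habs := G.abs_fluctuation_le (Real.sqrt_nonneg _) hz hzp hf hfz fun i =>
    Real.abs_le_sqrt (sq_div_sub_one_le_of_barrierDiv_le hcp hzp hR i)
  calc G.fluctuation f c z ^ 2 ≤ (2 * G.bound * √((2 * R + 2) * barrierSym c z)) ^ 2 := by
        rw [← sq_abs]
        gcongr
    _ = 4 * G.bound ^ 2 * (2 * R + 2) * barrierSym c z := by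
        rw [mul_pow, Real.sq_sqrt hRS]
        ring

variable {ζ : Type*} [Fintype ζ] {p : ζ → ℝ} {f : ζ → I → ℝ}

lemma sum_mul_fluctuation_eq_zero (hp1 : ∑ j, p j = 1)
    (hunb : ∑ j, p j * ∑ i, f j i * (c - z) i = G.form z (c - z)) :
    ∑ j, p j * G.fluctuation (f j) c z = 0 := by
  simp only [fluctuation, mul_sub (p _), Finset.sum_sub_distrib, ← Finset.sum_mul, hp1, one_mul]
  exact sub_eq_zero.2 hunb

lemma sum_mul_exp_fluctuation_le {ε τ : ℝ} (hε : 0 ≤ ε) (hz : z ∈ G.Q)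
    (hcp : ∀ i, 0 < c i) (hzp : ∀ i, 0 < z i) (hf : ∀ j i, 0 ≤ f j i)
    (hfz : ∀ j, ∑ i, f j i * z i ≤ G.bound) (hp : ∀ j, 0 ≤ p j) (hp1 : ∑ j, p j = 1)
    (hunb : ∑ j, p j * ∑ i, f j i * (c - z) i = G.form z (c - z))
    (hR : barrierDiv c z ≤ R) (hε1 : ε * (2 * G.bound * (2 * R + 2)) ≤ 1)
    (hετ : ε * (4 * G.bound ^ 2 * (2 * R + 2)) ≤ τ) :
    ∑ j, p j * Real.exp (ε * G.fluctuation (f j) c z) ≤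
      Real.exp (ε * (τ * barrierSym c z)) := by
  have hR0 : 0 ≤ R := (barrierDiv_nonneg hcp hzp).trans hR
  have hS := barrierSym_nonneg hcp hzp
  refine sum_mul_exp_le hp hp1 ?_ (fun j => ?_) fun j => ?_
  · simp only [mul_left_comm (p _) ε, ← Finset.mul_sum,
      G.sum_mul_fluctuation_eq_zero hp1 hunb, mul_zero]
  · rw [abs_mul, abs_of_nonneg hε]
    refine (mul_le_mul_of_nonneg_left ?_ hε).trans hε1
    exact G.abs_fluctuation_le (by linarith) hz hzp (hf j) (hfz j)
      fun i => abs_div_sub_one_le_of_barrierDiv_le hcp hzp hR i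
  · calc (ε * G.fluctuation (f j) c z) ^ 2
        ≤ ε ^ 2 * (4 * G.bound ^ 2 * (2 * R + 2) * barrierSym c z) := by
          rw [mul_pow]
          exact mul_le_mul_of_nonneg_left
            (G.sq_fluctuation_le hz hcp hzp (hf j) (hfz j) hR) (sq_nonneg ε)
      _ = ε * (ε * (4 * G.bound ^ 2 * (2 * R + 2)) * barrierSym c z) := by ring
      _ ≤ ε * (τ * barrierSym c z) := by gcongr

end Fluctuation

section StepBound

variable {f c z v z' : I → ℝ} {η τ : ℝ}

/-- The bound of `barrierDiv_step` on the divergence to the flow after one step. -/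
noncomputable def stepBound (η τ : ℝ) (f c z : I → ℝ) : ℝ :=
  barrierDiv c z - η * τ / 2 * barrierSym c z + η * G.fluctuation f c z
    + (9 * Fintype.card I + 1) * (η * τ + η * G.bound) ^ 2

lemma sum_mul_exp_stepBound_le {ζ : Type*} [Fintype ζ] {p : ζ → ℝ} {f : ζ → I → ℝ}
    {R r r' k u : ℝ} (hη : 0 ≤ η) (hτ : 0 ≤ τ) (hr' : 0 ≤ r') (hz : z ∈ G.Q)
    (hcp : ∀ i, 0 < c i) (hzp : ∀ i, 0 < z i) (hf : ∀ j i, 0 ≤ f j i)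
    (hfz : ∀ j, ∑ i, f j i * z i ≤ G.bound) (hp : ∀ j, 0 ≤ p j) (hp1 : ∑ j, p j = 1)
    (hunb : ∑ j, p j * ∑ i, f j i * (c - z) i = G.form z (c - z)) (hR : barrierDiv c z ≤ R)
    (hsmall : r' * (η * (2 * G.bound * (2 * R + 2))) ≤ 1)
    (hrτ : r' * (η * (4 * G.bound ^ 2 * (2 * R + 2))) ≤ τ / 4)
    (hk0 : 0 ≤ k) (hk1 : k ≤ 1) (hcontract : r' * (1 - η * τ / 4) ≤ (1 - k) * r)
    (hdrift : r' * ((9 * Fintype.card I + 1) * (η * τ + η * G.bound) ^ 2) ≤ k * u) :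
    ∑ j, p j * Real.exp (r' * G.stepBound η τ (f j) c z) ≤
      (1 - k) * Real.exp (r * barrierDiv c z) + k * Real.exp u := by
  set X := barrierDiv c z
  set S := barrierSym c z
  set E := (9 * Fintype.card I + 1) * (η * τ + η * G.bound) ^ 2
  have hnoise := G.sum_mul_exp_fluctuation_le (mul_nonneg hr' hη) hz hcp hzp hf hfz hp hp1 hunb hR
    (by linarith) (by linarith : r' * η * (4 * G.bound ^ 2 * (2 * R + 2)) ≤ τ / 4)
  calc ∑ j, p j * Real.exp (r' * G.stepBound η τ (f j) c z)
      = Real.exp (r' * (X - η * τ / 2 * S + E))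
          * ∑ j, p j * Real.exp (r' * η * G.fluctuation (f j) c z) := by
        rw [Finset.mul_sum]
        refine Finset.sum_congr rfl fun j _ => ?_
        rw [mul_left_comm, ← Real.exp_add, stepBound]
        congr 2
        ring
    _ ≤ Real.exp (r' * (X - η * τ / 2 * S + E)) * Real.exp (r' * η * (τ / 4 * S)) :=
        mul_le_mul_of_nonneg_left hnoise (Real.exp_pos _).le
    _ = Real.exp (r' * (X - η * τ / 4 * S + E)) := by
        rw [← Real.exp_add]
        congr 1
        ring
    _ ≤ (1 - k) * Real.exp (r * X) + k * Real.exp u :=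
        exp_contract_le (barrierDiv_nonneg hcp hzp) (barrierDiv_le_barrierSym hcp hzp)
          (by positivity) hr' hk0 hk1 hcontract hdrift

lemma measurable_stepBound {Ω : Type*} {m : MeasurableSpace Ω} {f z : Ω → I → ℝ} (η τ : ℝ)
    (c : I → ℝ) (hf : ∀ i, Measurable fun ω => f ω i) (hz : ∀ i, Measurable fun ω => z ω i) :
    Measurable fun ω => G.stepBound η τ (f ω) c (z ω) := by
  have hform : Measurable fun ω => G.form (z ω) (c - z ω) := by
    have hflip : (fun ω => G.form (z ω) (c - z ω)) = fun ω => G.form.flip c (z ω) := by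
      funext ω
      rw [map_sub, G.isAlt, sub_zero, LinearMap.BilinForm.flip_apply]
    rw [hflip]
    exact (LinearMap.continuous_of_finiteDimensional _).measurable.comp (measurable_pi_lambda _ hz)
  have hX := measurable_barrierDiv c hz
  have hS := measurable_barrierSym c hz
  unfold stepBound fluctuation
  fun_prop

end StepBound

lemma IsAnalyticCenter.barrierDiv_le {G : SaddleProblem I} {c z : I → ℝ} {m : ℝ}
    (hc : G.IsAnalyticCenter c) (hm : 0 < m) (hz : z ∈ G.Q) (hmz : ∀ i, m ≤ z i) :
    barrierDiv c z ≤ Fintype.card I * m⁻¹ := by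
  have hzp (i) : 0 < z i := hm.trans_le (hmz i)
  have hcoord (i) : c i / z i - 1 - Real.log (c i / z i) ≤
      m⁻¹ + (Real.log (z i) - Real.log (c i)) := by
    rw [Real.log_div (hc.pos i).ne' (hzp i).ne']
    have : c i / z i ≤ 1 / m := div_le_div₀ zero_le_one (G.le_one c hc.mem i) hm (hmz i)
    rw [one_div] at this
    linarith
  calc barrierDiv c z ≤ ∑ i, (m⁻¹ + (Real.log (z i) - Real.log (c i))) :=
        Finset.sum_le_sum fun i _ => hcoord i
    _ ≤ Fintype.card I * m⁻¹ := by
        rw [Finset.sum_add_distrib, Finset.sum_sub_distrib]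
        simp only [Finset.sum_const, Finset.card_univ, nsmul_eq_mul]
        linarith [hc.sum_log_le z hz hzp]

section Tracking

variable {Ω : Type*} {mΩ : MeasurableSpace Ω} {P : Measure Ω} {ℱ : Filtration ℕ mΩ}
  {ζ : Type*} [Fintype ζ]

/-- Regularized mirror descent `z` with estimates `f t (Z t)` of the linear forms
`form (z t)`, nonnegative and unbiased on the tangent space, where `Z t` has the law `p t` given
the past `ℱ t`. -/
structure IsMirrorDescent (P : Measure Ω) (ℱ : Filtration ℕ mΩ) (η τ : ℕ → ℝ) (Z : ℕ → Ω → ζ)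
    (p : ℕ → ζ → Ω → ℝ) (f : ℕ → ζ → Ω → I → ℝ) (z : ℕ → Ω → I → ℝ) : Prop where
  hasCondLaw : ∀ t, HasCondLaw P (ℱ t) (Z t) (p t)
  measurable : ∀ t i, Measurable[ℱ t] fun ω => z t ω i
  mem : ∀ t ω, z t ω ∈ G.Q
  pos : ∀ t ω i, 0 < z t ω i
  measurable_estimate : ∀ t j i, Measurable[ℱ t] fun ω => f t j ω i
  estimate_nonneg : ∀ t j ω i, 0 ≤ f t j ω i
  sum_estimate_mul_le : ∀ t j ω, ∑ i, f t j ω i * z t ω i ≤ G.bound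
  unbiased : ∀ t ω, ∀ x ∈ G.V, ∑ j, p t j ω * ∑ i, f t j ω i * x i = G.form (z t ω) x
  isBarrierStep : ∀ t ω, IsBarrierStep G.V (η t) (τ t) (f t (Z t ω) ω) (z t ω) (z (t + 1) ω)

variable {G} {η τ r k w : ℕ → ℝ} {d₀ R δ u : ℝ} {Z : ℕ → Ω → ζ} {p : ℕ → ζ → Ω → ℝ}
  {f : ℕ → ζ → Ω → I → ℝ} {z : ℕ → Ω → I → ℝ} {c v : ℕ → I → ℝ}

lemma IsFlowSchedule.exists_isFlow (hs : IsFlowSchedule (Fintype.card I) G.bound η τ) {c₀ : I → ℝ}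
    (hc₀ : G.IsAnalyticCenter c₀) : ∃ c v : ℕ → I → ℝ, c 0 = c₀ ∧ G.IsFlow η τ c v :=
  G.exists_isFlow hs.eta_pos hs.eta_anti hs.tau_pos
    (fun t => by linarith [hs.small t, mul_pos (hs.eta_pos t) G.bound_pos]) hs.speed hs.tau_zero hc₀

lemma IsFlow.form_sub_le (hc : G.IsFlow η τ c v)
    (hs : IsFlowSchedule (Fintype.card I) G.bound η τ) (hτ : ∀ t, τ t ≤ 7 / 5 * τ (t + 1)) {t : ℕ}
    (ht : τ t < 1) {z z' : I → ℝ} (hz : z ∈ G.Q) (hzp : ∀ i, 0 < z i) (hz' : z' ∈ G.Q)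
    (hdiv : barrierDiv (c t) z ≤ (τ t / 48) ^ 2) :
    G.form z (z - z') ≤ (7 / 4 * Fintype.card I + G.bound / 8) * τ t := by
  cases t with
  | zero => linarith [hs.tau_zero, G.one_le_bound]
  | succ t =>
    have hτ0 := hs.tau_pos (t + 1)
    have hclose := abs_div_sub_one_le_of_barrierDiv_le_sq (hc.pos _) hzp (by positivity)
      (by linarith) hdiv
    rw [hc.succ] at hclose
    have hgap := G.form_sub_le (hs.eta_pos t) (hs.tau_pos t)
      (by linarith [hs.small t, mul_pos (hs.eta_pos t) G.bound_pos])
      (by positivity) (by linarith) (hc.pos t) hz hzp hz'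
      (fun i => (abs_div_le_localNorm _ _ i).trans (hc.speed t)) hclose (hc.isFlowStep t)
    have : 5 / 4 * Fintype.card I * τ t ≤ 5 / 4 * Fintype.card I * (7 / 5 * τ (t + 1)) := by
      gcongr
      exact hτ t
    linarith

lemma IsMirrorDescent.barrierDiv_succ_le (hz : G.IsMirrorDescent P ℱ η τ Z p f z)
    (hc : G.IsFlow η τ c v) (hs : IsFlowSchedule (Fintype.card I) G.bound η τ) (t : ℕ) (ω : Ω) :
    barrierDiv (c (t + 1)) (z (t + 1) ω) ≤
      G.stepBound (η t) (τ t) (f t (Z t ω) ω) (c t) (z t ω) := by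
  have hητ : 0 < η t * τ t := mul_pos (hs.eta_pos t) (hs.tau_pos t)
  rw [hc.succ]
  exact G.barrierDiv_step (hs.eta_pos t) (hs.tau_pos t) (by linarith [hs.small t])
    (by linarith) le_rfl (hc.mem t) (hc.succ t ▸ hc.mem (t + 1)) (hz.mem t ω) (hz.mem (t + 1) ω)
    (hc.pos t) (hz.pos t ω) (hz.pos (t + 1) ω)
    (fun i => (abs_div_le_localNorm _ _ i).trans (hc.speed t))
    (hz.estimate_nonneg t _ ω) (hz.sum_estimate_mul_le t _ ω) (hc.isFlowStep t)
    (hz.isBarrierStep t ω)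

variable [IsProbabilityMeasure P]

lemma IsMirrorDescent.setLIntegral_exp_le (hz : G.IsMirrorDescent P ℱ η τ Z p f z)
    (hc : G.IsFlow η τ c v)
    (hs : IsTrackingSchedule (Fintype.card I) G.bound d₀ R δ η τ r k w u)
    (hd₀ : ∀ ω, barrierDiv (c 0) (z 0 ω) ≤ d₀) (t : ℕ) :
    ∫⁻ ω in {ω | ∀ s < t, barrierDiv (c s) (z s ω) ≤ R},
      ENNReal.ofReal (Real.exp (r t * barrierDiv (c t) (z t ω))) ∂P ≤
        ENNReal.ofReal (Real.exp u) := by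
  refine setLIntegral_le_of_drift (Y := fun t ω => Real.exp (r t * barrierDiv (c t) (z t ω)))
    (S := fun t => {ω | ∀ s < t, barrierDiv (c s) (z s ω) ≤ R})
    (g := fun t j ω => Real.exp (r (t + 1) * G.stepBound (η t) (τ t) (f t j ω) (c t) (z t ω)))
    hz.hasCondLaw (fun s t hst ω hω s' hs' => hω s' (hs'.trans_le hst))
    (fun t => measurableSet_forall_lt_le (fun s hst =>
      (measurable_barrierDiv (c s) (hz.measurable s)).mono (ℱ.mono (Nat.lt_succ_iff.1 hst))
        le_rfl) R)
    (fun t j => Real.measurable_exp.comp (Measurable.const_mul (G.measurable_stepBound _ _ _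
      (hz.measurable_estimate t j) (hz.measurable t)) _))
    (fun _ _ _ => (Real.exp_pos _).le) hs.k_nonneg hs.k_le_one (Real.exp_pos u).le
    (fun ω => Real.exp_le_exp.2
      ((mul_le_mul_of_nonneg_left (hd₀ ω) (hs.r_nonneg 0)).trans hs.start))
    (fun t ω _ => Real.exp_le_exp.2 (mul_le_mul_of_nonneg_left
      (hz.barrierDiv_succ_le hc hs.toIsFlowSchedule t ω) (hs.r_nonneg _)))
    (fun t ω hω => ?_) t
  exact G.sum_mul_exp_stepBound_le (hs.eta_pos t).le (hs.tau_pos t).le (hs.r_nonneg _)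
    (hz.mem t ω) (hc.pos t) (hz.pos t ω) (fun j => hz.estimate_nonneg t j ω)
    (fun j => hz.sum_estimate_mul_le t j ω) (fun j => (hz.hasCondLaw t).nonneg j ω)
    ((hz.hasCondLaw t).sum_eq_one ω)
    (hz.unbiased t ω _ (G.sub_mem _ (hc.mem t) _ (hz.mem t ω))) (hω t t.lt_succ_self)
    (hs.r_small t) (hs.r_tau t) (hs.k_nonneg t) (hs.k_le_one t) (hs.contract t) (hs.drift t)

lemma IsMirrorDescent.one_sub_le_measureReal_barrierDiv_le
    (hz : G.IsMirrorDescent P ℱ η τ Z p f z) (hc : G.IsFlow η τ c v)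
    (hs : IsTrackingSchedule (Fintype.card I) G.bound d₀ R δ η τ r k w u) (hδ : 0 < δ)
    (hd₀ : ∀ ω, barrierDiv (c 0) (z 0 ω) ≤ d₀) :
    1 - δ ≤ P.real {ω | ∀ t, barrierDiv (c t) (z t ω) ≤ divLevel R τ t} :=
  one_sub_le_measureReal_forall_le hδ
    (fun t => (measurable_barrierDiv (c t) (hz.measurable t)).mono (ℱ.le t) le_rfl)
    (hz.setLIntegral_exp_le hc hs hd₀) hs.r_nonneg
    (fun t => divLevel_le hs.one_le (hs.tau_pos t).le) hs.level hs.w_nonneg hs.w_sum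

theorem IsMirrorDescent.one_sub_le_measureReal_form_sub_le {m : ℝ}
    (hz : G.IsMirrorDescent P ℱ η τ Z p f z)
    (hs : IsTrackingSchedule (Fintype.card I) G.bound (Fintype.card I * m⁻¹) R δ η τ r k w u)
    (hδ : 0 < δ) (hm : 0 < m) (hz₀ : ∀ ω i, m ≤ z 0 ω i) :
    1 - δ ≤ P.real {ω | ∀ t, τ t < 1 → ∀ z' ∈ G.Q, G.form (z t ω) (z t ω - z') ≤
      (7 / 4 * Fintype.card I + G.bound / 8) * τ t} := by
  obtain ⟨ω₀⟩ := nonempty_of_isProbabilityMeasure P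
  obtain ⟨c₀, hc₀⟩ := G.exists_isAnalyticCenter (hz.mem 0 ω₀) (hz.pos 0 ω₀)
  obtain ⟨c, v, rfl, hc⟩ := IsFlowSchedule.exists_isFlow hs.toIsFlowSchedule hc₀
  refine (hz.one_sub_le_measureReal_barrierDiv_le hc hs hδ fun ω =>
    hc₀.barrierDiv_le hm (hz.mem 0 ω) (hz₀ ω)).trans (measureReal_mono ?_ (measure_ne_top _ _))
  intro ω hω t ht z' hz'
  have hdiv := hω t
  rw [divLevel, if_neg (not_le.2 ht)] at hdiv
  exact hc.form_sub_le hs.toIsFlowSchedule hs.tau_succ ht (hz.mem t ω) (hz.pos t ω) hz' hdiv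

end Tracking

end SaddleProblem

/-! ### Learning rates and regularization strengths -/

section SlowSchedule

/-- Decreasing learning rates `η` and regularization strengths `τ` that change slowly: one
iteration changes them by a factor of at most `1 + y t`, where `y t` is small compared with the
contraction rate `η t * τ t` of the flow. -/
structure IsSlowSchedule (K : ℝ) (y η τ : ℕ → ℝ) : Prop where
  eta_pos : ∀ t, 0 < η t
  eta_anti : Antitone η
  eta_le : ∀ t, η t ≤ (1 + y t) * η (t + 1)
  tau_pos : ∀ t, 0 < τ t
  tau_anti : Antitone τ
  tau_le : ∀ t, τ t ≤ (1 + y t) * τ (t + 1)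
  y_nonneg : ∀ t, 0 ≤ y t
  y_le : ∀ t, y t ≤ 1 / 4
  y_le_mul : ∀ t, 120 * K * y t ≤ η t * τ t
  mul_le : ∀ t, η t * τ t ≤ 1 / 16

lemma one_sub_mul_le_of_le_one_add_mul {y a b : ℝ} (hb : 0 ≤ b) (hy : y ≤ 1)
    (h : a ≤ (1 + y) * b) : (1 - y) * a ≤ b := by
  nlinarith [mul_le_mul_of_nonneg_left h (sub_nonneg.2 hy), mul_nonneg (sq_nonneg y) hb]

lemma speed_le {n y e e' s s' : ℝ} (hn : 1 ≤ n) (he : 0 < e) (hs : 0 < s) (he' : 0 ≤ e')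
    (hs' : 0 ≤ s') (hee : e' ≤ e) (hss : s' ≤ s) (hey : e ≤ (1 + y) * e')
    (hsy : s ≤ (1 + y) * s') (hy₀ : 0 ≤ y) (hy : y ≤ 1 / 4) (hyes : 120 * n * y ≤ e * s) :
    (1 + e * s / 8 - e' * s) * (e * s / 8) + e' * |s' - s| * √n ≤ e' * s' / 8 := by
  have he_lower : (1 - y) * e ≤ e' := one_sub_mul_le_of_le_one_add_mul he' (by linarith) hey
  have hs_lower : (1 - y) * s ≤ s' := one_sub_mul_le_of_le_one_add_mul hs' (by linarith) hsy
  have hes : 0 < e * s := mul_pos he hs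
  have hmixed : (1 - y) * (e * s) ≤ e' * s := by
    linarith [mul_le_mul_of_nonneg_right he_lower hs.le]
  have hproduct : (1 - 2 * y) * (e * s) ≤ e' * s' := by
    have := mul_le_mul he_lower hs_lower (mul_nonneg (by linarith) hs.le) he'
    nlinarith [mul_nonneg (sq_nonneg y) hes.le]
  have hshift : e' * |s' - s| * √n ≤ e * s * (y * n) := by
    have hsqrt : √n ≤ n := Real.sqrt_le_iff.2 ⟨by linarith, by nlinarith⟩
    have habs : |s' - s| ≤ y * s := by
      rw [abs_sub_comm, abs_of_nonneg (sub_nonneg.2 hss)]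
      linarith
    calc e' * |s' - s| * √n ≤ e * (y * s) * n := by gcongr
      _ = e * s * (y * n) := by ring
  have hspeed : (1 + e * s / 8 - e' * s) * (e * s / 8) ≤
      (1 + e * s / 8 - (1 - y) * (e * s)) * (e * s / 8) := by gcongr
  have hyn : y ≤ y * n := le_mul_of_one_le_right hy₀ hn
  have hslack : 8 * (y * n) + 2 * y ≤ e * s * (7 / 8 - y) := by
    have : e * s * (5 / 8) ≤ e * s * (7 / 8 - y) := by gcongr; linarith
    linarith
  linarith [mul_le_mul_of_nonneg_left hslack hes.le]

/-- The inverse temperatures at which the tracking error is exponentially integrable. -/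
noncomputable def invTemp (κ : ℝ) (η τ : ℕ → ℝ) (t : ℕ) : ℝ := κ * min 1 (τ t) / η t

/-- The scale of the inverse temperatures for an initial divergence of at most `d₀`. -/
noncomputable def tempScale (K d₀ : ℝ) : ℝ := 1 / (128 * K ^ 2 * (2 * (d₀ + 1) + 2))

lemma tempScale_pos {K d₀ : ℝ} (hK : 1 ≤ K) (hd : 0 ≤ d₀) : 0 < tempScale K d₀ := by
  unfold tempScale
  positivity

lemma tempScale_mul_sq_le {K d₀ : ℝ} (hK : 1 ≤ K) (hd : 0 ≤ d₀) :
    tempScale K d₀ * K ^ 2 ≤ 1 / 512 := by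
  unfold tempScale
  rw [one_div_mul_eq_div, div_le_div_iff₀ (by positivity) (by norm_num)]
  nlinarith [mul_nonneg (sq_nonneg K) hd]

lemma tempScale_le {K d₀ : ℝ} (hK : 1 ≤ K) (hd : 0 ≤ d₀) : tempScale K d₀ ≤ 1 / 512 :=
  (le_mul_of_one_le_right (tempScale_pos hK hd).le (one_le_pow₀ hK)).trans
    (tempScale_mul_sq_le hK hd)

lemma min_one_mul_sq_le {K s s₀ : ℝ} (hK : 1 ≤ K) (hs : 0 < s) (hss : s ≤ s₀) (hs₀ : 1 ≤ s₀) :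
    min 1 s * (s + 2 * K) ^ 2 ≤ s * (9 * K ^ 2 * s₀) := by
  rcases le_total s 1 with h | h
  · calc min 1 s * (s + 2 * K) ^ 2 ≤ s * (3 * K) ^ 2 := by
          gcongr
          · exact min_le_right _ _
          · linarith
      _ = s * (9 * K ^ 2 * 1) := by ring
      _ ≤ s * (9 * K ^ 2 * s₀) := by gcongr
  · calc min 1 s * (s + 2 * K) ^ 2 ≤ 1 * (3 * K * s) ^ 2 := by
          gcongr
          · exact min_le_left _ _
          · nlinarith
      _ = s * (9 * K ^ 2 * s) := by ring
      _ ≤ s * (9 * K ^ 2 * s₀) := by gcongr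

namespace IsSlowSchedule

variable {K d₀ κ : ℝ} {y η τ : ℕ → ℝ} (h : IsSlowSchedule K y η τ)
include h

lemma isFlowSchedule (hK : 1 ≤ K) (hη : η 0 * (2 * K) ≤ 1 / 16) (hτ : 16 * K ≤ τ 0) :
    IsFlowSchedule K (2 * K) η τ where
  eta_pos := h.eta_pos
  eta_anti := h.eta_anti
  tau_pos := h.tau_pos
  small t := by
    have : η t * (2 * K) ≤ η 0 * (2 * K) := by
      gcongr
      exact h.eta_anti t.zero_le
    linarith [h.mul_le t]
  speed t := speed_le hK (h.eta_pos t) (h.tau_pos t) (h.eta_pos _).le (h.tau_pos _).le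
    (h.eta_anti t.le_succ) (h.tau_anti t.le_succ) (h.eta_le t) (h.tau_le t) (h.y_nonneg t)
    (h.y_le t) (h.y_le_mul t)
  tau_zero := by linarith

lemma invTemp_pos (hκ : 0 < κ) (t : ℕ) : 0 < invTemp κ η τ t :=
  div_pos (mul_pos hκ (lt_min one_pos (h.tau_pos t))) (h.eta_pos t)

lemma invTemp_succ_le (hκ : 0 < κ) (t : ℕ) :
    invTemp κ η τ (t + 1) ≤ (1 + y t) * invTemp κ η τ t := by
  have hη := h.eta_pos t
  calc invTemp κ η τ (t + 1) ≤ κ * min 1 (τ t) / η (t + 1) := by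
        unfold invTemp
        have := h.eta_pos (t + 1)
        gcongr
        exact h.tau_anti t.le_succ
    _ = invTemp κ η τ t * (η t / η (t + 1)) := by
        unfold invTemp
        field_simp
    _ ≤ invTemp κ η τ t * (1 + y t) := by
        refine mul_le_mul_of_nonneg_left ?_ (h.invTemp_pos hκ t).le
        exact (div_le_iff₀ (h.eta_pos (t + 1))).2 (h.eta_le t)
    _ = (1 + y t) * invTemp κ η τ t := mul_comm _ _

lemma invTemp_succ_mul_le (hκ : 0 < κ) (t : ℕ) :
    invTemp κ η τ (t + 1) * η t ≤ 2 * κ * min 1 (τ t) := by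
  have hη := h.eta_pos t
  have hr := h.invTemp_pos hκ t
  calc invTemp κ η τ (t + 1) * η t ≤ 2 * invTemp κ η τ t * η t := by
        gcongr
        refine (h.invTemp_succ_le hκ t).trans ?_
        gcongr
        linarith [h.y_le t]
    _ = 2 * κ * min 1 (τ t) := by
        unfold invTemp
        field_simp

lemma invTemp_succ_mul_one_sub_le (hK : 1 ≤ K) (hκ : 0 < κ) (t : ℕ) :
    invTemp κ η τ (t + 1) * (1 - η t * τ t / 4) ≤ (1 - η t * τ t / 8) * invTemp κ η τ t := by
  have hr := h.invTemp_pos hκ t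
  have hmul := h.mul_le t
  have hy : y t ≤ η t * τ t / 8 := by
    linarith [h.y_le_mul t, h.y_nonneg t, le_mul_of_one_le_left (h.y_nonneg t) hK]
  calc invTemp κ η τ (t + 1) * (1 - η t * τ t / 4)
      ≤ (1 + η t * τ t / 8) * invTemp κ η τ t * (1 - η t * τ t / 4) := by
        have : 0 ≤ 1 - η t * τ t / 4 := by linarith
        gcongr
        refine (h.invTemp_succ_le hκ t).trans ?_
        gcongr
    _ = (1 + η t * τ t / 8) * (1 - η t * τ t / 4) * invTemp κ η τ t := by ring
    _ ≤ (1 - η t * τ t / 8) * invTemp κ η τ t := by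
        gcongr
        nlinarith [sq_nonneg (η t * τ t)]

lemma invTemp_succ_mul_drift_le (hK : 1 ≤ K) (hκ : 0 < κ) (hκK : κ * K ^ 2 ≤ 1 / 512)
    (hτ : 1 ≤ τ 0) (t : ℕ) :
    invTemp κ η τ (t + 1) * ((9 * K + 1) * (η t * τ t + η t * (2 * K)) ^ 2) ≤
      η t * τ t / 8 * (3 * K * τ 0) := by
  have hη := h.eta_pos t
  have hτt := h.tau_pos t
  have hmin := min_one_mul_sq_le hK hτt (h.tau_anti t.zero_le) hτ
  calc invTemp κ η τ (t + 1) * ((9 * K + 1) * (η t * τ t + η t * (2 * K)) ^ 2)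
      = invTemp κ η τ (t + 1) * η t * ((9 * K + 1) * η t * (τ t + 2 * K) ^ 2) := by ring
    _ ≤ 2 * κ * min 1 (τ t) * ((9 * K + 1) * η t * (τ t + 2 * K) ^ 2) := by
        exact mul_le_mul_of_nonneg_right (h.invTemp_succ_mul_le hκ t) (by positivity)
    _ = 2 * κ * (9 * K + 1) * η t * (min 1 (τ t) * (τ t + 2 * K) ^ 2) := by ring
    _ ≤ 2 * κ * (10 * K) * η t * (τ t * (9 * K ^ 2 * τ 0)) := by
        gcongr
        linarith
    _ = 180 * (κ * K ^ 2) * (η t * τ t) * K * τ 0 := by ring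
    _ ≤ 180 * (1 / 512) * (η t * τ t) * K * τ 0 := by gcongr
    _ ≤ η t * τ t / 8 * (3 * K * τ 0) := by
        have : 0 < η t * τ t * K * τ 0 := by positivity
        linarith

lemma invTemp_succ_mul_le_of_mul_le {a b : ℝ} (hκ : 0 < κ) (ha : 0 ≤ a) (t : ℕ)
    (hab : 2 * κ * a ≤ b) : invTemp κ η τ (t + 1) * (η t * a) ≤ b * min 1 (τ t) := by
  have hmin : 0 < min 1 (τ t) := lt_min one_pos (h.tau_pos t)
  calc invTemp κ η τ (t + 1) * (η t * a) = invTemp κ η τ (t + 1) * η t * a := by ring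
    _ ≤ 2 * κ * min 1 (τ t) * a := mul_le_mul_of_nonneg_right (h.invTemp_succ_mul_le hκ t) ha
    _ = 2 * κ * a * min 1 (τ t) := by ring
    _ ≤ b * min 1 (τ t) := by gcongr

lemma add_le_invTemp_mul_of_one_le {t : ℕ} {L : ℝ} (hκ : 0 < κ) (hK : 0 ≤ K) (hd : 0 ≤ d₀)
    (hτt : 1 ≤ τ t) (hηL : η t * L ≤ κ / 2) (hητ : 6 * K * (η 0 * τ 0) ≤ κ) :
    κ * d₀ / η 0 + 3 * K * τ 0 + L ≤ invTemp κ η τ t * (d₀ + 1) := by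
  have hη := h.eta_pos t
  have hη_le : η t ≤ η 0 := h.eta_anti t.zero_le
  have hinit : κ * d₀ / η 0 ≤ κ * d₀ / η t := by gcongr
  have hrest : 3 * K * τ 0 + L ≤ κ / η t := by
    rw [le_div_iff₀ hη]
    have : K * (η t * τ 0) ≤ K * (η 0 * τ 0) := by
      gcongr
      exact (h.tau_pos 0).le
    linarith
  rw [invTemp, min_eq_left hτt, mul_one, mul_add_one, div_mul_eq_mul_div]
  linarith

lemma add_le_invTemp_mul_of_le_one {t : ℕ} {L : ℝ} (hκ : 0 < κ) (hτt : τ t ≤ 1)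
    (hτ₀ : 1 ≤ τ 0) (hd : 6912 * d₀ ≤ τ 0) (hη₀ : 20736 * K * η 0 ≤ κ)
    (hratio : τ 0 ^ 3 / η 0 ≤ τ t ^ 3 / η t) (hL : 6912 * L ≤ κ * (τ t ^ 3 / η t)) :
    κ * d₀ / η 0 + 3 * K * τ 0 + L ≤ invTemp κ η τ t * (τ t / 48) ^ 2 := by
  have hη := h.eta_pos 0
  have hcube : τ 0 ≤ τ 0 ^ 3 := le_self_pow₀ hτ₀ (by norm_num)
  have hbase : κ * (τ 0 ^ 3 / η 0) ≤ κ * (τ t ^ 3 / η t) := by gcongr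
  have hinit : 6912 * (κ * d₀ / η 0) ≤ κ * (τ 0 ^ 3 / η 0) := by
    calc 6912 * (κ * d₀ / η 0) = κ * (6912 * d₀ / η 0) := by ring
      _ ≤ κ * (τ 0 ^ 3 / η 0) := by
          gcongr
          exact hd.trans hcube
  have hdrift : 6912 * (3 * K * τ 0) ≤ κ * (τ 0 ^ 3 / η 0) := by
    rw [mul_div_assoc', le_div_iff₀ hη]
    calc 6912 * (3 * K * τ 0) * η 0 = 20736 * K * η 0 * τ 0 := by ring
      _ ≤ κ * τ 0 ^ 3 := by gcongr
  have hsplit : invTemp κ η τ t * (τ t / 48) ^ 2 = 3 * (κ * (τ t ^ 3 / η t)) / 6912 := by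
    rw [invTemp, min_eq_right hτt]
    ring
  rw [hsplit, le_div_iff₀ (by norm_num)]
  linarith

lemma add_le_invTemp_mul_divLevel {t : ℕ} {L : ℝ} (hκ : 0 < κ) (hK : 0 ≤ K) (hd : 0 ≤ d₀)
    (hτ₀ : 1 ≤ τ 0) (hτd : 6912 * d₀ ≤ τ 0) (hη : 20736 * K * η 0 ≤ κ)
    (hητ : 6 * K * (η 0 * τ 0) ≤ κ) (hηL : η t * L ≤ κ / 2)
    (hratio : τ 0 ^ 3 / η 0 ≤ τ t ^ 3 / η t) (hL : 6912 * L ≤ κ * (τ t ^ 3 / η t)) :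
    κ * d₀ / η 0 + 3 * K * τ 0 + L ≤ invTemp κ η τ t * divLevel (d₀ + 1) τ t := by
  unfold divLevel
  split_ifs with hτt
  · exact h.add_le_invTemp_mul_of_one_le hκ hK hd hτt hηL hητ
  · exact h.add_le_invTemp_mul_of_le_one hκ (not_le.1 hτt).le hτ₀ hτd hη hratio hL

theorem isTrackingSchedule {δ : ℝ} {w L : ℕ → ℝ} (hK : 1 ≤ K) (hd : 0 ≤ d₀)
    (hκ : κ = tempScale K d₀) (hτK : 16 * K ≤ τ 0) (hτd : 6912 * d₀ ≤ τ 0)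
    (hη : 20736 * K * η 0 ≤ κ) (hητ : 6 * K * (η 0 * τ 0) ≤ κ)
    (hηL : ∀ t, η t * L t ≤ κ / 2) (hratio : ∀ t, τ 0 ^ 3 / η 0 ≤ τ t ^ 3 / η t)
    (hL : ∀ t, 6912 * L t ≤ κ * (τ t ^ 3 / η t)) (hw : ∀ t, 0 ≤ w t)
    (hw_sum : ∀ n, ∑ t ∈ Finset.range n, w t ≤ 1) (hwL : ∀ t, Real.exp (-L t) ≤ δ * w t) :
    IsTrackingSchedule K (2 * K) d₀ (d₀ + 1) δ η τ (invTemp κ η τ) (fun t => η t * τ t / 8) w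
      (κ * d₀ / η 0 + 3 * K * τ 0) := by
  have hκ₀ : 0 < κ := hκ ▸ tempScale_pos hK hd
  have hκK : κ * K ^ 2 ≤ 1 / 512 := hκ ▸ tempScale_mul_sq_le hK hd
  have hκ_le : κ ≤ 1 / 512 := hκ ▸ tempScale_le hK hd
  have hκ_mul : κ * (128 * K ^ 2 * (2 * (d₀ + 1) + 2)) = 1 := by
    rw [hκ, tempScale]
    field_simp
  have hτ₀ : 1 ≤ τ 0 := by linarith
  refine
  { h.isFlowSchedule hK (by linarith) hτK with
    tau_succ := fun t => ?_
    r_nonneg := fun t => (h.invTemp_pos hκ₀ t).le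
    r_small := fun t => ?_
    r_tau := fun t => ?_
    k_nonneg := fun t => by linarith [mul_pos (h.eta_pos t) (h.tau_pos t)]
    k_le_one := fun t => by linarith [h.mul_le t]
    contract := h.invTemp_succ_mul_one_sub_le hK hκ₀
    drift := fun t => ?_
    start := ?_
    level := fun t => ?_
    w_nonneg := hw
    w_sum := hw_sum
    one_le := by linarith }
  · nlinarith [h.tau_le t, h.y_le t, h.tau_pos (t + 1)]
  · refine (h.invTemp_succ_mul_le_of_mul_le (b := 1) hκ₀ (by positivity) t ?_).trans ?_
    · nlinarith [mul_nonneg (mul_nonneg hκ₀.le (by positivity : 0 ≤ K * (2 * (d₀ + 1) + 2)))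
        (sub_nonneg.2 hK)]
    · linarith [min_le_left 1 (τ t)]
  · refine (h.invTemp_succ_mul_le_of_mul_le (b := 1 / 4) hκ₀ (by positivity) t ?_).trans ?_
    · linarith
    · linarith [min_le_right 1 (τ t)]
  · refine (h.invTemp_succ_mul_drift_le hK hκ₀ hκK hτ₀ t).trans ?_
    have hη₀ := h.eta_pos 0
    gcongr
    · linarith [mul_pos (h.eta_pos t) (h.tau_pos t)]
    · exact le_add_of_nonneg_left (by positivity)
  · rw [invTemp, min_eq_left hτ₀, mul_one, div_mul_eq_mul_div]
    exact le_add_of_nonneg_right (by positivity)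
  · have hlevel := h.add_le_invTemp_mul_divLevel hκ₀ (by linarith) hd hτ₀ hτd hη hητ (hηL t)
      (hratio t) (hL t)
    refine le_trans ?_ (mul_le_mul_of_nonneg_right (hwL t) (Real.exp_pos _).le)
    rw [← Real.exp_add, Real.exp_le_exp]
    linarith

end IsSlowSchedule

end SlowSchedule

section Rates

variable {δ η τ : ℝ} {T₀ : ℕ}

lemma sum_range_inv_sq_le_one (hT : 2 ≤ T₀) (n : ℕ) :
    ∑ t ∈ Finset.range n, (((t : ℝ) + T₀) ^ 2)⁻¹ ≤ 1 := by
  obtain ⟨k, rfl⟩ := Nat.exists_eq_add_of_le' hT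
  calc ∑ t ∈ Finset.range n, (((t : ℝ) + (k + 2 : ℕ)) ^ 2)⁻¹
      = ∑ i ∈ Finset.Ioo (k + 1) (k + 2 + n), ((i : ℝ) ^ 2)⁻¹ := by
        rw [← Finset.Ico_add_one_left_eq_Ioo, Finset.sum_Ico_eq_sum_range,
          show k + 2 + n - (k + 1 + 1) = n by omega]
        exact Finset.sum_congr rfl fun t _ => by push_cast; ring
    _ ≤ 2 / ((k + 1 : ℕ) + 1) := sum_Ioo_inv_sq_le _ _
    _ ≤ 1 := by
        rw [div_le_one (by positivity)]
        push_cast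
        linarith [(Nat.cast_nonneg k : (0 : ℝ) ≤ k)]

lemma rpow_neg_le_mul_rpow_neg {x a : ℝ} (hx : 0 < x) (ha : a ≤ 1) :
    x ^ (-a) ≤ (1 + 1 / x) * (x + 1) ^ (-a) := by
  have hdiv : 1 + 1 / x = (x + 1) / x := by field_simp
  have hbase : 1 ≤ (x + 1) / x := (one_le_div hx).2 (by linarith)
  calc x ^ (-a) = ((x + 1) / x) ^ a * (x + 1) ^ (-a) := by
        rw [Real.div_rpow (by linarith) hx.le, Real.rpow_neg hx.le, Real.rpow_neg (by linarith)]
        have := Real.rpow_pos_of_pos (by linarith : 0 < x + 1) a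
        field_simp
    _ ≤ (1 + 1 / x) * (x + 1) ^ (-a) := by
        rw [hdiv]
        gcongr
        exact Real.rpow_le_self_of_one_le hbase ha

lemma learningRate_pos (hη : 0 < η) (hT : 0 < T₀) (t : ℕ) : 0 < learningRate η T₀ t := by
  unfold learningRate
  positivity

lemma learningRate_antitone (hη : 0 ≤ η) (hT : 0 < T₀) : Antitone (learningRate η T₀) := by
  intro s t hst
  unfold learningRate
  gcongr ?_ * ?_
  exact Real.rpow_le_rpow_of_nonpos (by positivity) (by gcongr) (by norm_num)

lemma learningRate_le (hη : 0 ≤ η) (hT : 0 < T₀) (t : ℕ) : learningRate η T₀ t ≤ η := by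
  have : (1 : ℝ) ≤ T₀ := by exact_mod_cast hT
  refine mul_le_of_le_one_right hη (Real.rpow_le_one_of_one_le_of_nonpos ?_ (by norm_num))
  linarith [(Nat.cast_nonneg t : (0 : ℝ) ≤ t)]

lemma learningRate_le_mul_succ (hη : 0 ≤ η) (hT : 0 < T₀) (t : ℕ) :
    learningRate η T₀ t ≤ (1 + 1 / ((t : ℝ) + T₀)) * learningRate η T₀ (t + 1) := by
  have hx : 0 < (t : ℝ) + T₀ := by positivity
  have := rpow_neg_le_mul_rpow_neg (a := 3 / 4) hx (by norm_num)
  unfold learningRate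
  rw [Nat.cast_succ, add_right_comm, mul_left_comm]
  gcongr

lemma log_div_nonneg_of_le_one {x : ℝ} (hδ : 0 < δ) (hδ₁ : δ ≤ 1) (hx : 1 ≤ x) :
    0 ≤ Real.log (x / δ) :=
  Real.log_nonneg ((one_le_div hδ).2 (hδ₁.trans hx))

lemma regStrength_le_mul_succ (hδ : 0 < δ) (hδ₁ : δ ≤ 1) (hτ : 0 ≤ τ) (hT : 0 < T₀) (t : ℕ) :
    regStrength δ τ T₀ t ≤ (1 + 1 / ((t : ℝ) + T₀)) * regStrength δ τ T₀ (t + 1) := by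
  have hx : 0 < (t : ℝ) + T₀ := by positivity
  have hpow := rpow_neg_le_mul_rpow_neg (a := 1 / 4) hx (by norm_num)
  have : (1 : ℝ) ≤ t + T₀ := by exact_mod_cast Nat.le_add_left_of_le hT
  have hlog : 0 ≤ Real.log (((t : ℝ) + T₀ + 1) / δ) :=
    log_div_nonneg_of_le_one hδ hδ₁ (by linarith)
  have hlog_mono : Real.log (((t : ℝ) + T₀) / δ) ≤ Real.log (((t : ℝ) + T₀ + 1) / δ) :=
    Real.log_le_log (by positivity) (div_le_div_of_nonneg_right (by linarith) hδ.le)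
  unfold regStrength
  rw [Nat.cast_succ, add_right_comm (t : ℝ) 1, mul_left_comm]
  gcongr

lemma regStrength_pos (hδ : 0 < δ) (hδ₁ : δ < 1) (hτ : 0 < τ) (hT : 0 < T₀) (t : ℕ) :
    0 < regStrength δ τ T₀ t := by
  have hx₁ : (1 : ℝ) ≤ t + T₀ := by exact_mod_cast Nat.le_add_left_of_le hT
  have hlog : 0 < Real.log (((t : ℝ) + T₀) / δ) :=
    Real.log_pos ((one_lt_div hδ).2 (hδ₁.trans_le hx₁))
  unfold regStrength
  positivity

lemma regStrength_antitone (hδ : 0 < δ) (hδ₁ : δ ≤ 1) (hτ : 0 ≤ τ) (hT : Real.exp 4 ≤ T₀) :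
    Antitone (regStrength δ τ T₀) := by
  have hscale (t : ℕ) : regStrength δ τ T₀ t = τ * δ ^ (-(1 / 4) : ℝ) *
      (Real.log (((t : ℝ) + T₀) / δ) / (((t : ℝ) + T₀) / δ) ^ (1 / 4 : ℝ)) := by
    rw [regStrength, Real.rpow_neg (by positivity), Real.rpow_neg hδ.le,
      Real.div_rpow (by positivity) hδ.le]
    field_simp
  have hmem (t : ℕ) : ((t : ℝ) + T₀) / δ ∈ Set.Ici (Real.exp (1 / 4 : ℝ)⁻¹) := by
    rw [Set.mem_Ici, le_div_iff₀ hδ]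
    norm_num
    nlinarith [Real.exp_pos 4]
  intro s t hst
  rw [hscale, hscale]
  gcongr ?_ * ?_
  exact Real.log_div_self_rpow_antitoneOn (by norm_num) (hmem s) (hmem t) (by gcongr)

lemma learningRate_mul_regStrength (hT : 0 < T₀) (t : ℕ) :
    learningRate η T₀ t * regStrength δ τ T₀ t =
      η * τ * Real.log (((t : ℝ) + T₀) / δ) / ((t : ℝ) + T₀) := by
  have hx : 0 < (t : ℝ) + T₀ := by positivity
  calc learningRate η T₀ t * regStrength δ τ T₀ t
      = η * τ * Real.log (((t : ℝ) + T₀) / δ) *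
          (((t : ℝ) + T₀) ^ (-(3 / 4) : ℝ) * ((t : ℝ) + T₀) ^ (-(1 / 4) : ℝ)) := by
        rw [learningRate, regStrength]
        ring
    _ = η * τ * Real.log (((t : ℝ) + T₀) / δ) / ((t : ℝ) + T₀) := by
        rw [← Real.rpow_add hx, show (-(3 / 4) + -(1 / 4) : ℝ) = -1 by norm_num, Real.rpow_neg_one,
          ← div_eq_mul_inv]

lemma regStrength_pow_div_learningRate (hT : 0 < T₀) (t : ℕ) :
    regStrength δ τ T₀ t ^ 3 / learningRate η T₀ t =
      (τ * Real.log (((t : ℝ) + T₀) / δ)) ^ 3 / η := by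
  have hx : 0 < (t : ℝ) + T₀ := by positivity
  have hpow : (((t : ℝ) + T₀) ^ (-(1 / 4) : ℝ)) ^ 3 = ((t : ℝ) + T₀) ^ (-(3 / 4) : ℝ) := by
    rw [← Real.rpow_mul_natCast hx.le]
    norm_num
  have := Real.rpow_pos_of_pos hx (-(3 / 4))
  rw [regStrength, learningRate, mul_pow, hpow]
  field_simp

lemma learningRate_mul_log_le (hδ : 0 < δ) (hδ₁ : δ ≤ 1) (hη : 0 ≤ η) (hT : 0 < T₀) (t : ℕ) :
    learningRate η T₀ t * Real.log (((t : ℝ) + T₀) / δ) ≤ η * (2 + Real.log (1 / δ)) := by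
  have hx : (1 : ℝ) ≤ t + T₀ := by exact_mod_cast Nat.le_add_left_of_le hT
  set x := (t : ℝ) + T₀
  have hpow : 1 ≤ x ^ (3 / 4 : ℝ) := Real.one_le_rpow hx (by norm_num)
  have hlog : Real.log x ≤ x ^ (3 / 4 : ℝ) / (3 / 4) :=
    Real.log_le_rpow_div (by linarith) (by norm_num)
  have hδlog : 0 ≤ Real.log (1 / δ) := log_div_nonneg_of_le_one hδ hδ₁ le_rfl
  have hsum : Real.log (x / δ) = Real.log x + Real.log (1 / δ) := by
    rw [div_eq_mul_one_div, Real.log_mul (by linarith) (by positivity)]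
  rw [learningRate, Real.rpow_neg (by linarith), ← div_eq_mul_inv, div_mul_eq_mul_div,
    div_le_iff₀ (by linarith), mul_assoc, hsum]
  gcongr
  nlinarith

lemma exp_neg_two_mul_log_le (hδ : 0 < δ) (hδ₁ : δ ≤ 1) {x : ℝ} (hx : 0 < x) :
    Real.exp (-(2 * Real.log (x / δ))) ≤ δ * (x ^ 2)⁻¹ := by
  have hδx : 0 < x / δ := by positivity
  calc Real.exp (-(2 * Real.log (x / δ))) = δ ^ 2 * (x ^ 2)⁻¹ := by
        rw [Real.exp_neg, two_mul, Real.exp_add, Real.exp_log hδx]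
        field_simp
    _ ≤ δ * (x ^ 2)⁻¹ := by
        gcongr
        nlinarith

lemma eight_le_log_div (hδ : 0 < δ) (hδ₁ : δ ≤ 1) (hT : Real.exp 8 ≤ T₀) (t : ℕ) :
    8 ≤ Real.log (((t : ℝ) + T₀) / δ) := by
  have hT₀ : (0 : ℝ) < T₀ := (Real.exp_pos 8).trans_le hT
  rw [Real.le_log_iff_exp_le (by positivity), le_div_iff₀ hδ]
  nlinarith [(Nat.cast_nonneg t : (0 : ℝ) ≤ t)]

lemma isSlowSchedule_rates {K : ℝ} (hδ : 0 < δ) (hδ₁ : δ < 1) (hη : 0 < η) (hτ : 0 < τ)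
    (hT : Real.exp 8 ≤ T₀) (hητ : 15 * K ≤ η * τ)
    (hzero : learningRate η T₀ 0 * regStrength δ τ T₀ 0 ≤ 1 / 16) :
    IsSlowSchedule K (fun t => 1 / ((t : ℝ) + T₀)) (learningRate η T₀) (regStrength δ τ T₀) := by
  have hT₀ : 0 < T₀ := by exact_mod_cast (Real.exp_pos 8).trans_le hT
  have hη_anti := learningRate_antitone hη.le hT₀
  have hτ_anti := regStrength_antitone hδ hδ₁.le hτ.le
    ((Real.exp_le_exp.2 (by norm_num)).trans hT)
  exact
  { eta_pos := learningRate_pos hη hT₀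
    eta_anti := hη_anti
    eta_le := learningRate_le_mul_succ hη.le hT₀
    tau_pos := regStrength_pos hδ hδ₁ hτ hT₀
    tau_anti := hτ_anti
    tau_le := regStrength_le_mul_succ hδ hδ₁.le hτ.le hT₀
    y_nonneg := fun t => by positivity
    y_le := fun t => one_div_le_one_div_of_le (by norm_num) <| by
      linarith [Real.add_one_le_exp 8, (Nat.cast_nonneg t : (0 : ℝ) ≤ t)]
    y_le_mul := fun t => by
      rw [learningRate_mul_regStrength hT₀, mul_one_div]
      refine div_le_div_of_nonneg_right ?_ (by positivity)
      nlinarith [eight_le_log_div hδ hδ₁.le hT t, mul_pos hη hτ]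
    mul_le := fun t => (mul_le_mul (hη_anti t.zero_le) (hτ_anti t.zero_le)
      (regStrength_pos hδ hδ₁ hτ hT₀ t).le (learningRate_pos hη hT₀ 0).le).trans hzero }

theorem isTrackingSchedule_rates {K d₀ : ℝ} (hK : 1 ≤ K) (hd : 0 ≤ d₀) (hδ : 0 < δ)
    (hδ₁ : δ < 1) (hη : 0 < η) (hτ : 1 ≤ τ) (hT : Real.exp 8 ≤ T₀) (hητ : 15 * K ≤ η * τ)
    (hηK : 20736 * K * η ≤ tempScale K d₀)
    (hηδ : 4 * (η * (2 + Real.log (1 / δ))) ≤ tempScale K d₀)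
    (hzero : 6 * K * (learningRate η T₀ 0 * regStrength δ τ T₀ 0) ≤ tempScale K d₀)
    (hτK : 16 * K ≤ regStrength δ τ T₀ 0) (hτd : 6912 * d₀ ≤ regStrength δ τ T₀ 0) :
    ∃ r k w : ℕ → ℝ, ∃ u : ℝ, IsTrackingSchedule K (2 * K) d₀ (d₀ + 1) δ (learningRate η T₀)
      (regStrength δ τ T₀) r k w u := by
  have hT₀ : 0 < T₀ := by exact_mod_cast (Real.exp_pos 8).trans_le hT
  have hT₂ : 2 ≤ T₀ := by
    have : (2 : ℝ) ≤ T₀ := by linarith [Real.add_one_le_exp 8]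
    exact_mod_cast this
  have hlog := eight_le_log_div hδ hδ₁.le hT
  have hzero_le : learningRate η T₀ 0 * regStrength δ τ T₀ 0 ≤ 1 / 16 := by
    have := mul_pos (learningRate_pos hη hT₀ 0) (regStrength_pos hδ hδ₁ (by linarith) hT₀ 0)
    nlinarith [tempScale_le hK hd]
  refine ⟨_, _, _, _, (isSlowSchedule_rates hδ hδ₁ hη (by linarith) hT hητ
    hzero_le).isTrackingSchedule (L := fun t => 2 * Real.log (((t : ℝ) + T₀) / δ)) hK hd rfl hτK
    hτd ?_ hzero (fun t => ?_) (fun t => ?_) (fun t => ?_) (fun t => by positivity)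
    (sum_range_inv_sq_le_one hT₂) fun t => exp_neg_two_mul_log_le hδ hδ₁.le (by positivity)⟩
  · refine le_trans ?_ hηK
    gcongr
    exact learningRate_le hη.le hT₀ 0
  · linarith [learningRate_mul_log_le hδ hδ₁.le hη.le hT₀ t]
  · rw [regStrength_pow_div_learningRate hT₀, regStrength_pow_div_learningRate hT₀]
    have := hlog 0
    gcongr
    exact t.zero_le
  · rw [regStrength_pow_div_learningRate hT₀, mul_div_assoc', le_div_iff₀ hη]
    have hcube : Real.log (((t : ℝ) + T₀) / δ) ≤ (τ * Real.log (((t : ℝ) + T₀) / δ)) ^ 3 :=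
      (le_mul_of_one_le_left (by linarith [hlog t]) hτ).trans
        (le_self_pow₀ (by nlinarith [hlog t]) (by norm_num))
    have hη_le : 13824 * η ≤ tempScale K d₀ := by nlinarith
    have := hlog t
    calc 6912 * (2 * Real.log (((t : ℝ) + T₀) / δ)) * η
        = 13824 * η * Real.log (((t : ℝ) + T₀) / δ) := by ring
      _ ≤ tempScale K d₀ * (τ * Real.log (((t : ℝ) + T₀) / δ)) ^ 3 := by
          have := tempScale_pos hK hd
          gcongr

lemma lt_log_of_exp_div_lt {x N : ℝ} (hx : 2 ≤ x)
    (h : Real.exp N / Real.log 2 ^ 4 < x / Real.log x ^ 4) : N < Real.log x := by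
  by_contra! hN
  have hx_le : x ≤ Real.exp N := (Real.log_le_iff_le_exp (by linarith)).1 hN
  have : 0 < Real.log 2 := Real.log_pos one_lt_two
  refine h.not_ge ?_
  gcongr

lemma learningRate_mul_regStrength_zero_le (hδ : 0 < δ) (hδ₁ : δ ≤ 1)
    (hT : 1 ≤ Real.log T₀) (hητ : η * τ ≤ T₀ / Real.log T₀ ^ 4) :
    learningRate η T₀ 0 * regStrength δ τ T₀ 0 ≤ (1 + Real.log (1 / δ)) / Real.log T₀ := by
  have hT₀ : 0 < T₀ := Nat.pos_of_ne_zero fun h => by norm_num [h] at hT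
  have hl : 0 ≤ Real.log (1 / δ) := log_div_nonneg_of_le_one hδ hδ₁ le_rfl
  have hsum : Real.log (T₀ / δ) = Real.log T₀ + Real.log (1 / δ) := by
    rw [div_eq_mul_one_div, Real.log_mul (by positivity) (by positivity)]
  rw [learningRate_mul_regStrength hT₀, Nat.cast_zero, zero_add, hsum]
  calc η * τ * (Real.log T₀ + Real.log (1 / δ)) / T₀
      ≤ T₀ / Real.log T₀ ^ 4 * (Real.log T₀ * (1 + Real.log (1 / δ))) / T₀ := by
        gcongr
        nlinarith
    _ = (1 + Real.log (1 / δ)) / Real.log T₀ ^ 3 := by field_simp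
    _ ≤ (1 + Real.log (1 / δ)) / Real.log T₀ := by
        gcongr
        exact le_self_pow₀ hT (by norm_num)

lemma le_regStrength_zero {N : ℝ} (hδ : 0 < δ) (hδ₁ : δ ≤ 1) (hτ : 0 ≤ τ)
    (hT₀ : 0 < T₀) (hN : N ^ 2 ≤ Real.log T₀) (hT : T₀ ≤ Real.log (1 / δ) ^ 2 * τ ^ 4) :
    N ≤ regStrength δ τ T₀ 0 := by
  have hl : 0 ≤ Real.log (1 / δ) := log_div_nonneg_of_le_one hδ hδ₁ le_rfl
  have : 0 ≤ Real.log T₀ := (sq_nonneg N).trans hN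
  have hsum : Real.log (T₀ / δ) = Real.log T₀ + Real.log (1 / δ) := by
    rw [div_eq_mul_one_div, Real.log_mul (by positivity) (by positivity)]
  have hroot : ((T₀ : ℝ) ^ (1 / 4 : ℝ)) ^ 4 = T₀ := by
    rw [← Real.rpow_mul_natCast (by positivity)]
    norm_num
  rw [regStrength, Nat.cast_zero, zero_add, Real.rpow_neg (by positivity), ← div_eq_mul_inv,
    le_div_iff₀ (by positivity), hsum]
  refine le_of_pow_le_pow_left₀ (n := 4) (by norm_num) (by positivity) ?_
  calc (N * (T₀ : ℝ) ^ (1 / 4 : ℝ)) ^ 4 = (N ^ 2) ^ 2 * T₀ := by rw [mul_pow, hroot]; ring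
    _ ≤ Real.log T₀ ^ 2 * (Real.log (1 / δ) ^ 2 * τ ^ 4) := by gcongr
    _ = (Real.log T₀ * Real.log (1 / δ)) ^ 2 * τ ^ 4 := by ring
    _ ≤ ((Real.log T₀ + Real.log (1 / δ)) ^ 2) ^ 2 * τ ^ 4 := by
        gcongr
        nlinarith [sq_nonneg (Real.log T₀), sq_nonneg (Real.log (1 / δ))]
    _ = (τ * (Real.log T₀ + Real.log (1 / δ))) ^ 4 := by ring

theorem exists_isTrackingSchedule {K d₀ : ℝ} (hK : 1 ≤ K) (hd : 0 ≤ d₀) (hδ : 0 < δ)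
    (hδ₁ : δ < 1) :
    ∃ c : ℝ, 0 < c ∧ ∀ (η τ : ℝ) (T₀ : ℕ), 0 < η → 0 < τ → 1 < T₀ → 1 / (η * τ) ≤ c → η ≤ c →
      η * τ ≤ T₀ / Real.log T₀ ^ 4 → T₀ ≤ Real.log (1 / δ) ^ 2 * τ ^ 4 →
      ∃ r k w : ℕ → ℝ, ∃ u : ℝ, IsTrackingSchedule K (2 * K) d₀ (d₀ + 1) δ (learningRate η T₀)
        (regStrength δ τ T₀) r k w u := by
  have hκ := tempScale_pos hK hd
  have hκ_le := tempScale_le hK hd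
  set κ := tempScale K d₀
  set l := Real.log (1 / δ)
  have hl : 0 ≤ l := log_div_nonneg_of_le_one hδ hδ₁.le le_rfl
  obtain ⟨N, hN8, hNK, hNd, hNκ⟩ : ∃ N : ℝ, 8 ≤ N ∧ (16 * K) ^ 2 ≤ N ∧ (6912 * d₀) ^ 2 ≤ N ∧
      6 * K * (1 + l) / κ ≤ N :=
    ⟨max (max 8 ((16 * K) ^ 2)) (max ((6912 * d₀) ^ 2) (6 * K * (1 + l) / κ)), by simp, by simp,
      by simp, by simp⟩
  set M := Real.exp N / Real.log 2 ^ 4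
  have : 0 < M := div_pos (Real.exp_pos N) (pow_pos (Real.log_pos one_lt_two) 4)
  refine ⟨min (min (κ / (20736 * K)) (κ / (4 * (2 + l)))) (min (1 / (15 * K)) (1 / (M + 1))),
    by positivity, fun η τ T₀ hη hτ hT₀ hητ_inv hη_le hητ_le hT₀_le => ?_⟩
  have hητ : 0 < η * τ := mul_pos hη hτ
  obtain ⟨hητK, hητM⟩ : 15 * K ≤ η * τ ∧ M + 1 ≤ η * τ := by
    simp only [le_min_iff] at hητ_inv
    exact ⟨(one_div_le_one_div hητ (by positivity)).1 hητ_inv.2.1,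
      (one_div_le_one_div hητ (by positivity)).1 hητ_inv.2.2⟩
  obtain ⟨hηK, hηl⟩ : η * (20736 * K) ≤ κ ∧ η * (4 * (2 + l)) ≤ κ := by
    simp only [le_min_iff] at hη_le
    exact ⟨(le_div_iff₀ (by positivity)).1 hη_le.1.1, (le_div_iff₀ (by positivity)).1 hη_le.1.2⟩
  have hNT : N < Real.log T₀ :=
    lt_log_of_exp_div_lt (by exact_mod_cast hT₀) (by linarith)
  have hτ₁ : 1 ≤ τ := by nlinarith
  refine isTrackingSchedule_rates hK hd hδ hδ₁ hη hτ₁ ?_ hητK (by linarith) (by linarith) ?_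
    (le_regStrength_zero hδ hδ₁.le hτ.le (by omega) (hNK.trans hNT.le) hT₀_le)
    (le_regStrength_zero hδ hδ₁.le hτ.le (by omega) (hNd.trans hNT.le) hT₀_le)
  · exact (Real.le_log_iff_exp_le (by positivity)).1 (by linarith)
  · calc 6 * K * (learningRate η T₀ 0 * regStrength δ τ T₀ 0)
        ≤ 6 * K * ((1 + l) / Real.log T₀) := by
          gcongr
          exact learningRate_mul_regStrength_zero_le hδ hδ₁.le (by linarith) hητ_le
      _ ≤ κ := by
          rw [mul_div_assoc', div_le_iff₀ (by linarith), ← div_le_iff₀' hκ]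
          exact hNκ.trans hNT.le

end Rates

/-! ### Markov chains and decision trees -/

section Chain

variable {W : Type*} {q : W → ℝ} {k : W → W → ℝ} {d : W → ℕ} {N n : ℕ}

/-- The weight of a trajectory of a Markov chain with initial weights `q` and kernel `k`. -/
def chainWeight (q : W → ℝ) (k : W → W → ℝ) {n : ℕ} (z : Fin n → W) : ℝ :=
  ∏ h : Fin n, if (h : ℕ) = 0 then q (z h)
    else k (z ⟨(h : ℕ) - 1, lt_of_le_of_lt (Nat.sub_le _ _) h.isLt⟩) (z h)

lemma chainWeight_snoc (q : W → ℝ) (k : W → W → ℝ) (z : Fin (n + 1) → W) (w : W) :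
    chainWeight q k (Fin.snoc z w : Fin (n + 2) → W) =
      chainWeight q k z * k (z (Fin.last n)) w := by
  have hlast : (Fin.snoc z w : Fin (n + 2) → W) (Fin.last (n + 1)) = w := Fin.snoc_last ..
  have hcast (j : Fin (n + 1)) : (Fin.snoc z w : Fin (n + 2) → W) j.castSucc = z j :=
    Fin.snoc_castSucc ..
  unfold chainWeight
  rw [Fin.prod_univ_castSucc]
  congr 1
  · refine Finset.prod_congr rfl fun h _ => ?_
    rw [hcast]
    exact if_congr Iff.rfl rfl (congrArg (k · (z h))
      (hcast ⟨(h : ℕ) - 1, lt_of_le_of_lt (Nat.sub_le _ _) h.isLt⟩))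
  · rw [hlast, if_neg (by simp)]
    exact congrArg (k · w) (hcast (Fin.last n))

lemma depth_eq_of_chainWeight_ne_zero (hq : ∀ w, q w ≠ 0 → d w = 0)
    (hk : ∀ w w', k w w' ≠ 0 → d w' = d w + 1) {z : Fin n → W} (hz : chainWeight q k z ≠ 0)
    (h : Fin n) : d (z h) = h := by
  have hfactor := Finset.prod_ne_zero_iff.1 hz
  obtain ⟨j, hj⟩ := h
  induction j with
  | zero => exact hq _ (hfactor ⟨0, hj⟩ (Finset.mem_univ _))
  | succ j ih =>
    exact (hk _ _ (hfactor ⟨j + 1, hj⟩ (Finset.mem_univ _))).trans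
      (congrArg (· + 1) (ih (by omega)))

variable [Fintype W]

lemma sum_eq_sum_sum_snoc (F : (Fin (n + 1) → W) → ℝ) :
    ∑ z, F z = ∑ z : Fin n → W, ∑ w, F (Fin.snoc z w) := by
  rw [← (Fin.snocEquiv fun _ : Fin (n + 1) => W).sum_comp, Fintype.sum_prod_type_right]
  rfl

lemma sum_chainWeight_snoc (hq : ∀ w, q w ≠ 0 → d w = 0)
    (hk : ∀ w w', k w w' ≠ 0 → d w' = d w + 1) (hsum : ∀ w, d w + 1 < N → ∑ w', k w w' = 1)
    (hn : n + 1 < N) (z : Fin (n + 1) → W) :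
    ∑ w, chainWeight q k (Fin.snoc z w : Fin (n + 2) → W) = chainWeight q k z := by
  simp only [chainWeight_snoc, ← Finset.mul_sum]
  by_cases hz : chainWeight q k z = 0
  · rw [hz, zero_mul]
  · rw [hsum _ (by rwa [depth_eq_of_chainWeight_ne_zero hq hk hz, Fin.val_last]), mul_one]

theorem sum_chainWeight_mul {marg : ℕ → W → ℝ} (hq : ∀ w, q w ≠ 0 → d w = 0)
    (hk : ∀ w w', k w w' ≠ 0 → d w' = d w + 1) (hsum : ∀ w, d w + 1 < N → ∑ w', k w w' = 1)
    (hzero : ∀ w, marg 0 w = q w) (hsucc : ∀ j w', marg (j + 1) w' = ∑ w, marg j w * k w w')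
    (hn : n ≤ N) (j : Fin n) (f : W → ℝ) :
    ∑ z : Fin n → W, chainWeight q k z * f (z j) = ∑ w, marg j w * f w := by
  induction n generalizing f with
  | zero => exact j.elim0
  | succ n ih =>
    cases n with
    | zero =>
      obtain rfl : j = 0 := Fin.ext (by omega)
      rw [← (Equiv.funUnique (Fin 1) W).symm.sum_comp]
      simp [chainWeight, hzero]
    | succ n =>
      rw [sum_eq_sum_sum_snoc]
      refine Fin.lastCases ?_ (fun j => ?_) j
      · simp only [Fin.snoc_last, chainWeight_snoc, Fin.val_last, hsucc]
        rw [Finset.sum_comm]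
        simp only [← Finset.sum_mul]
        exact Finset.sum_congr rfl fun w _ =>
          congrArg (· * f w) (ih (by omega) (Fin.last n) fun w' => k w' w)
      · have hcast (z : Fin (n + 1) → W) (w : W) :
            (Fin.snoc z w : Fin (n + 2) → W) j.castSucc = z j := Fin.snoc_castSucc ..
        simp only [hcast, ← Finset.sum_mul, sum_chainWeight_snoc hq hk hsum (by omega : n + 1 < N)]
        exact ih (by omega) j f

end Chain

section LogBarrier

variable {X A : Type*} [Fintype X] [Fintype A]

lemma pairing_add_smul (f m w : X → A → ℝ) (s : ℝ) :
    pairing f (m + s • w) = pairing f m + s * pairing f w := by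
  simp only [pairing, Pi.add_apply, Pi.smul_apply, smul_eq_mul, Finset.mul_sum,
    ← Finset.sum_add_distrib]
  exact Finset.sum_congr rfl fun x _ => Finset.sum_congr rfl fun a _ => by ring

lemma hasDerivAt_pairing_add_smul (f m w : X → A → ℝ) :
    HasDerivAt (fun s : ℝ => pairing f (m + s • w)) (pairing f w) 0 := by
  simp only [pairing_add_smul]
  simpa using ((hasDerivAt_id (0 : ℝ)).mul_const (pairing f w)).const_add (pairing f m)

lemma hasDerivAt_logBarrier_add_smul {m : X → A → ℝ} (hm : ∀ x a, 0 < m x a) (w : X → A → ℝ) :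
    HasDerivAt (fun s : ℝ => logBarrier (m + s • w)) (pairing (logBarrierGrad m) w) 0 := by
  have hlog (x : X) (a : A) :
      HasDerivAt (fun s : ℝ => Real.log ((m + s • w) x a)) (w x a / m x a) 0 := by
    have hline : HasDerivAt (fun s : ℝ => m x a + s * w x a) (w x a) 0 := by
      simpa using ((hasDerivAt_id (0 : ℝ)).mul_const (w x a)).const_add (m x a)
    simpa using hline.log (by simpa using (hm x a).ne')
  refine (HasDerivAt.fun_sum fun x _ => HasDerivAt.fun_sum fun a _ => hlog x a).fun_neg.congr_deriv
    ?_
  simp only [pairing, logBarrierGrad, ← Finset.sum_neg_distrib]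
  exact Finset.sum_congr rfl fun x _ => Finset.sum_congr rfl fun a _ => by ring

lemma hasDerivAt_logBarrierDiv_add_smul {m : X → A → ℝ} (hm : ∀ x a, 0 < m x a)
    (m' w : X → A → ℝ) :
    HasDerivAt (fun s : ℝ => logBarrierDiv (m + s • w) m')
      (pairing (logBarrierGrad m) w - pairing (logBarrierGrad m') w) 0 := by
  simp only [logBarrierDiv, add_sub_right_comm m]
  exact ((hasDerivAt_logBarrier_add_smul hm w).sub_const _).sub
    (hasDerivAt_pairing_add_smul _ (m - m') w)

end LogBarrier

section Policy

variable {X A : Type*} [Fintype A]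

lemma isInteriorPolicy_uniformPolicy [Nonempty A] : IsInteriorPolicy (uniformPolicy X A) :=
  ⟨⟨fun _ _ => by unfold uniformPolicy; positivity, fun _ => by simp [uniformPolicy]⟩,
    fun _ _ => by unfold uniformPolicy; positivity⟩

lemma IsPolicy.nonempty {μ : X → A → ℝ} (hμ : IsPolicy μ) (x : X) : Nonempty A := by
  by_contra hA
  rw [not_nonempty_iff] at hA
  simpa using hμ.2 x

end Policy

namespace DecisionTree

variable {X A : Type*} (T : DecisionTree X A)

/-- Flow conservation with inflow `c` at the initial points: the flow `m` out of each decision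
point equals the flow into it. Sequence forms are the nonnegative flows with `c = 1`, and `c = 0`
gives the differences of sequence forms. -/
def Conserves [Fintype A] (c : ℝ) (m : X → A → ℝ) : Prop :=
  ∀ x, ∑ a, m x a = (T.prev x).elim c fun p => m p.1 p.2

lemma seqForm_eq (μ : X → A → ℝ) (x : X) (a : A) :
    T.seqForm μ x a = μ x a * (T.prev x).elim 1 fun p => T.seqForm μ p.1 p.2 := by
  rw [seqForm]
  congr 1
  split <;> rename_i h <;> rw [h] <;> rfl

variable {T} in
lemma seqForm_of_prev_eq_none {μ : X → A → ℝ} {x : X} (h : T.prev x = none) (a : A) :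
    T.seqForm μ x a = μ x a := by
  rw [seqForm_eq, h, Option.elim_none, mul_one]

variable {T} in
lemma seqForm_of_prev_eq_some {μ : X → A → ℝ} {x : X} {p : X × A} (h : T.prev x = some p)
    (a : A) : T.seqForm μ x a = μ x a * T.seqForm μ p.1 p.2 := by
  rw [seqForm_eq, h, Option.elim_some]

@[elab_as_elim]
lemma depth_induction {motive : X → Prop} (x : X) (initial : ∀ x, T.prev x = none → motive x)
    (step : ∀ x p, T.prev x = some p → motive p.1 → motive x) : motive x := by
  induction h : T.depth x using Nat.strong_induction_on generalizing x with
  | _ n ih =>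
    rcases hp : T.prev x with _ | p
    · exact initial x hp
    · exact step x p hp (ih _ (by have := T.depth_of_some x p hp; omega) p.1 rfl)

lemma depth_map {S C : Type*} {T' : DecisionTree S C} {f : S → X} {g : C → A}
    (h : ∀ s, T.prev (f s) = (T'.prev s).map fun p => (f p.1, g p.2)) (s : S) :
    T.depth (f s) = T'.depth s := by
  induction s using T'.depth_induction with
  | initial s hs => rw [T'.depth_of_none s hs, T.depth_of_none _ (by rw [h, hs, Option.map_none])]
  | step s p hs ih =>
    rw [T'.depth_of_some s p hs, T.depth_of_some _ _ (by rw [h, hs, Option.map_some]), ih]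

lemma measurable_seqForm {Ω : Type*} {m : MeasurableSpace Ω} {μ : Ω → X → A → ℝ}
    (hμ : ∀ x a, Measurable fun ω => μ ω x a) (x : X) (a : A) :
    Measurable fun ω => T.seqForm (μ ω) x a := by
  induction x using T.depth_induction generalizing a with
  | initial x h => simpa only [seqForm_of_prev_eq_none h] using hμ x a
  | step x p h ih =>
    simp only [seqForm_of_prev_eq_some h]
    exact (hμ x a).mul (ih p.2)

variable {T} [Fintype A] {c d : ℝ} {m n μ : X → A → ℝ}

lemma Conserves.add (hm : T.Conserves c m) (hn : T.Conserves d n) :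
    T.Conserves (c + d) (m + n) := by
  intro x
  simp only [Pi.add_apply, Finset.sum_add_distrib, hm x, hn x]
  cases T.prev x <;> rfl

lemma Conserves.smul (r : ℝ) (hm : T.Conserves c m) : T.Conserves (r * c) (r • m) := by
  intro x
  simp only [Pi.smul_apply, smul_eq_mul, ← Finset.mul_sum, hm x]
  cases T.prev x <;> rfl

lemma Conserves.sub (hm : T.Conserves c m) (hn : T.Conserves d n) :
    T.Conserves (c - d) (m - n) := by
  intro x
  simp only [Pi.sub_apply, Finset.sum_sub_distrib, hm x, hn x]
  cases T.prev x <;> rfl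

lemma Conserves.le_one (hm : T.Conserves 1 m) (hm₀ : ∀ x a, 0 ≤ m x a) (x : X) (a : A) :
    m x a ≤ 1 := by
  have hle (x : X) (a : A) : m x a ≤ (T.prev x).elim 1 fun p => m p.1 p.2 := by
    rw [← hm x]
    exact Finset.single_le_sum (f := fun a => m x a) (fun b _ => hm₀ x b) (Finset.mem_univ a)
  induction x using T.depth_induction generalizing a with
  | initial x h => simpa only [h, Option.elim_none] using hle x a
  | step x p h ih =>
    have hparent : m x a ≤ m p.1 p.2 := by simpa only [h, Option.elim_some] using hle x a
    exact hparent.trans (ih p.2)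

variable (T) in
lemma isClosed_setOf_conserves (c : ℝ) : IsClosed {m : X → A → ℝ | T.Conserves c m} := by
  simp only [Conserves, Set.ofPred_forall]
  refine isClosed_iInter fun x => isClosed_eq (by fun_prop) ?_
  cases T.prev x with
  | none => exact continuous_const
  | some p => exact (continuous_apply p.2).comp (continuous_apply p.1)

variable (T) in
/-- The vectors of zero inflow, the tangent space of the set of sequence forms. -/
def tangent : Submodule ℝ (X → A → ℝ) where
  carrier := {w | T.Conserves 0 w}
  add_mem' hv hw := by simpa using Conserves.add hv hw
  zero_mem' x := by cases h : T.prev x <;> simp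
  smul_mem' r w hw := by simpa using Conserves.smul r hw

lemma conserves_seqForm (hμ : IsPolicy μ) : T.Conserves 1 (T.seqForm μ) := by
  intro x
  simp only [T.seqForm_eq μ x, ← Finset.sum_mul, hμ.2 x, one_mul]

lemma seqForm_nonneg (hμ : IsPolicy μ) (x : X) (a : A) : 0 ≤ T.seqForm μ x a := by
  induction x using T.depth_induction generalizing a with
  | initial x h => exact (seqForm_of_prev_eq_none h a).symm ▸ hμ.1 x a
  | step x p h ih =>
    rw [seqForm_of_prev_eq_some h]
    exact mul_nonneg (hμ.1 x a) (ih p.2)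

lemma seqForm_pos (hμ : IsInteriorPolicy μ) (x : X) (a : A) : 0 < T.seqForm μ x a := by
  induction x using T.depth_induction generalizing a with
  | initial x h => exact (seqForm_of_prev_eq_none h a).symm ▸ hμ.2 x a
  | step x p h ih =>
    rw [seqForm_of_prev_eq_some h]
    exact mul_pos (hμ.2 x a) (ih p.2)

lemma seqForm_uniformPolicy (x : X) (a : A) :
    T.seqForm (uniformPolicy X A) x a = (1 / (Fintype.card A : ℝ)) ^ (T.depth x + 1) := by
  induction x using T.depth_induction generalizing a with
  | initial x h => simp [seqForm_of_prev_eq_none h, T.depth_of_none x h, uniformPolicy]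
  | step x p h ih =>
    rw [seqForm_of_prev_eq_some h, T.depth_of_some x p h, pow_succ', ih p.2, uniformPolicy]

lemma Conserves.exists_isInteriorPolicy (hm : T.Conserves 1 m) (hm₀ : ∀ x a, 0 < m x a) :
    ∃ κ, IsInteriorPolicy κ ∧ T.seqForm κ = m := by
  have hin (x : X) : 0 < (T.prev x).elim 1 fun p => m p.1 p.2 := by
    cases T.prev x with
    | none => exact one_pos
    | some p => exact hm₀ _ _
  let κ : X → A → ℝ := fun x a => m x a / (T.prev x).elim 1 fun p => m p.1 p.2
  have hκ₀ (x : X) (a : A) : 0 < κ x a := div_pos (hm₀ x a) (hin x)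
  have hκ₁ (x : X) : ∑ a, κ x a = 1 := by
    simp only [κ, ← Finset.sum_div, hm x]
    exact div_self (hin x).ne'
  refine ⟨κ, ⟨⟨fun x a => (hκ₀ x a).le, hκ₁⟩, hκ₀⟩, ?_⟩
  ext x a
  induction x using T.depth_induction generalizing a with
  | initial x h => simp [seqForm_of_prev_eq_none h, κ, h]
  | step x p h ih =>
    simp only [seqForm_of_prev_eq_some h, κ, h, Option.elim_some, ih p.2]
    exact div_mul_cancel₀ _ (hm₀ _ _).ne'

section MirrorStep

variable [Fintype X] {ξ μ' w : X → A → ℝ}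

lemma IsMirrorStep.isLocalMin (h : T.IsMirrorStep c ξ μ μ') (hw : T.Conserves 0 w) :
    IsLocalMin (fun s : ℝ => logBarrierDiv (T.seqForm μ' + s • w) (T.seqForm μ)
      + c * pairing ξ (T.seqForm μ' + s • w)) 0 := by
  have hpos : ∀ᶠ s : ℝ in nhds 0, ∀ x a, 0 < (T.seqForm μ' + s • w) x a := by
    refine Filter.eventually_all.2 fun x => Filter.eventually_all.2 fun a => ?_
    have hcont : ContinuousAt (fun s : ℝ => (T.seqForm μ' + s • w) x a) 0 := by
      simp only [Pi.add_apply, Pi.smul_apply, smul_eq_mul]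
      fun_prop
    exact hcont.eventually_const_lt (by simpa using seqForm_pos h.1 x a)
  filter_upwards [hpos] with s hs
  have hcons : T.Conserves 1 (T.seqForm μ' + s • w) := by
    simpa using (conserves_seqForm h.1.1).add (hw.smul s)
  obtain ⟨κ, hκ, hκm⟩ := hcons.exists_isInteriorPolicy hs
  simpa only [hκm, zero_smul, add_zero] using isMinOn_iff.1 h.2 κ hκ

theorem IsMirrorStep.pairing_eq_zero (h : T.IsMirrorStep c ξ μ μ') (hw : T.Conserves 0 w) :
    pairing (logBarrierGrad (T.seqForm μ')) w - pairing (logBarrierGrad (T.seqForm μ)) w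
      + c * pairing ξ w = 0 :=
  (h.isLocalMin hw).hasDerivAt_eq_zero
    ((hasDerivAt_logBarrierDiv_add_smul (seqForm_pos h.1) _ w).add
      ((hasDerivAt_pairing_add_smul ξ _ w).const_mul c))

lemma IsMirrorStep.sum_eq_zero {τ : ℝ} {f : X → A → ℝ}
    (h : T.IsMirrorStep c (f + τ • logBarrierGrad (T.seqForm μ)) μ μ') (hw : T.Conserves 0 w) :
    ∑ x, ∑ a, (1 / T.seqForm μ' x a - (1 - c * τ) / T.seqForm μ x a - c * f x a) * w x a
      = 0 := by
  rw [← neg_eq_zero, ← h.pairing_eq_zero hw]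
  simp only [pairing, logBarrierGrad, Pi.add_apply, Pi.smul_apply, smul_eq_mul, Finset.mul_sum,
    ← Finset.sum_neg_distrib, ← Finset.sum_sub_distrib, ← Finset.sum_add_distrib]
  exact Finset.sum_congr rfl fun x _ => Finset.sum_congr rfl fun a _ => by ring

end MirrorStep

end DecisionTree

/-! ### Occupancy measures of extensive-form games -/

section ImportanceSample

variable {X A ι : Type*} [Fintype ι]

open Classical in
/-- The importance-sampling estimate of a loss vector from the losses `l h` of the visited pairs
`(u h, b h)`, each visited with probability proportional to `m`. It covers the estimates of both
players. -/
noncomputable def importanceSample (m : X → A → ℝ) (l : ι → ℝ) (u : ι → X) (b : ι → A) :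
    X → A → ℝ :=
  fun x a => ∑ h, if u h = x ∧ b h = a then l h / m x a else 0

lemma importanceSample_nonneg {m : X → A → ℝ} (hm : ∀ x a, 0 < m x a) {l : ι → ℝ}
    (hl : ∀ h, 0 ≤ l h) (u : ι → X) (b : ι → A) (x : X) (a : A) :
    0 ≤ importanceSample m l u b x a := by
  classical
  refine Finset.sum_nonneg fun h _ => ?_
  split_ifs
  exacts [div_nonneg (hl h) (hm x a).le, le_rfl]

lemma measurable_importanceSample {Ω : Type*} {mΩ : MeasurableSpace Ω} {m : Ω → X → A → ℝ}
    {x : X} {a : A} (hm : Measurable fun ω => m ω x a) (l : ι → ℝ) (u : ι → X) (b : ι → A) :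
    Measurable fun ω => importanceSample (m ω) l u b x a := by
  classical
  refine Finset.measurable_fun_sum _ fun h _ => ?_
  split_ifs
  exacts [measurable_const.div hm, measurable_const]

variable [Fintype X] [Fintype A]

lemma sum_importanceSample_mul (m : X → A → ℝ) (l : ι → ℝ) (u : ι → X) (b : ι → A)
    (w : X → A → ℝ) :
    ∑ x, ∑ a, importanceSample m l u b x a * w x a =
      ∑ h, l h / m (u h) (b h) * w (u h) (b h) := by
  classical
  simp only [importanceSample, Finset.sum_mul]
  rw [Finset.sum_congr rfl fun x _ => Finset.sum_comm, Finset.sum_comm]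
  refine Finset.sum_congr rfl fun h _ => ?_
  rw [Finset.sum_eq_single_of_mem (u h) (Finset.mem_univ _) fun x _ hx => by simp [hx.symm],
    Finset.sum_eq_single_of_mem (b h) (Finset.mem_univ _) fun a _ ha => by simp [ha.symm],
    if_pos ⟨rfl, rfl⟩]

lemma sum_importanceSample_mul_self_le {m : X → A → ℝ} (hm : ∀ x a, 0 < m x a) {l : ι → ℝ}
    (hl : ∀ h, l h ≤ 1) (u : ι → X) (b : ι → A) :
    ∑ x, ∑ a, importanceSample m l u b x a * m x a ≤ Fintype.card ι := by
  rw [sum_importanceSample_mul, Fintype.card_eq_sum_ones, Nat.cast_sum, Nat.cast_one]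
  gcongr with h
  rw [div_mul_cancel₀ _ (hm _ _).ne']
  exact hl h

end ImportanceSample

namespace ExtensiveGame

variable {S X Y A B : Type*} [Fintype S] (G : ExtensiveGame S X Y A B)

/-- The probability that the environment leads to the state `s`, given the actions on the path
to `s`. -/
noncomputable def reach (G : ExtensiveGame S X Y A B) (s : S) : ℝ :=
  match _h : G.tree.prev s with
  | none => 1
  | some p => G.reach p.1 * G.trans p.1 p.2.1 p.2.2 s
termination_by G.tree.depth s
decreasing_by
  have := G.tree.depth_of_some s p _h
  omega

lemma reach_eq (s : S) : G.reach s =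
    (G.tree.prev s).elim 1 fun p => G.reach p.1 * G.trans p.1 p.2.1 p.2.2 s := by
  rw [reach]
  split <;> rename_i h <;> rw [h] <;> rfl

lemma reach_nonneg (s : S) : 0 ≤ G.reach s := by
  induction s using G.tree.depth_induction with
  | initial s h =>
    rw [reach_eq, h]
    exact zero_le_one
  | step s p h ih =>
    rw [reach_eq, h]
    exact mul_nonneg ih (G.trans_nonneg _ _ _ _)

lemma depth_infoMin (s : S) : G.minTree.depth (G.infoMin s) = G.tree.depth s :=
  G.minTree.depth_map G.recall_min s

lemma depth_infoMax (s : S) : G.maxTree.depth (G.infoMax s) = G.tree.depth s :=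
  G.maxTree.depth_map G.recall_max s

lemma depth_eq_zero_iff (s : S) : G.tree.depth s = 0 ↔ s = G.root := by
  rw [← G.prev_eq_none_iff]
  refine ⟨fun h => ?_, G.tree.depth_of_none s⟩
  rcases hprev : G.tree.prev s with _ | p
  · rfl
  · have := G.tree.depth_of_some s p hprev
    omega

lemma depth_eq_succ_of_trans_ne_zero {s s' : S} {a : A} {b : B} (h : G.trans s a b s' ≠ 0) :
    G.tree.depth s' = G.tree.depth s + 1 :=
  G.tree.depth_of_some _ _ (G.trans_tree _ _ _ _ h)

lemma exists_depth_eq [Nonempty A] [Nonempty B] {h : ℕ} (hh : h < G.H) :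
    ∃ s, G.tree.depth s = h := by
  induction h with
  | zero => exact ⟨G.root, (G.depth_eq_zero_iff _).2 rfl⟩
  | succ h ih =>
    obtain ⟨s, hs⟩ := ih (by omega)
    obtain ⟨a⟩ := ‹Nonempty A›
    obtain ⟨b⟩ := ‹Nonempty B›
    have hsum : ∑ s', G.trans s a b s' ≠ 0 := by
      rw [G.trans_sum s a b (by omega)]
      exact one_ne_zero
    obtain ⟨s', -, hs'⟩ := Finset.exists_ne_zero_of_sum_ne_zero hsum
    exact ⟨s', by rw [G.depth_eq_succ_of_trans_ne_zero hs', hs]⟩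

lemma height_le_card [Fintype X] [Nonempty A] [Nonempty B] : G.H ≤ Fintype.card X := by
  choose s hs using fun h : Fin G.H => G.exists_depth_eq h.isLt
  have hinj : Function.Injective fun h : Fin G.H => G.infoMin (s h) := by
    intro h h' heq
    have := congrArg G.minTree.depth heq
    simp only [depth_infoMin, hs] at this
    exact Fin.ext this
  simpa using Fintype.card_le_of_injective _ hinj

/-- The occupancy measure on triples of a state and two actions: for the sequence forms `m` and
`n` of two policies, the probability that the triple `w` occurs in an episode. -/
noncomputable def occ (m : X → A → ℝ) (n : Y → B → ℝ) (w : S × A × B) : ℝ :=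
  G.reach w.1 * m (G.infoMin w.1) w.2.1 * n (G.infoMax w.1) w.2.2

/-- The part of the occupancy measure at depth `h`. -/
noncomputable def occAt (m : X → A → ℝ) (n : Y → B → ℝ) (h : ℕ) (w : S × A × B) : ℝ :=
  if G.tree.depth w.1 = h then G.occ m n w else 0

/-- The probability that an episode starts with the triple `w`. -/
noncomputable def startWeight (μ : X → A → ℝ) (ν : Y → B → ℝ) (w : S × A × B) : ℝ :=
  open Classical in
  (if w.1 = G.root then 1 else 0) * μ (G.infoMin w.1) w.2.1 * ν (G.infoMax w.1) w.2.2

/-- The probability that the triple `w` is followed by the triple `w'`. -/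
def stepWeight (μ : X → A → ℝ) (ν : Y → B → ℝ) (w w' : S × A × B) : ℝ :=
  G.trans w.1 w.2.1 w.2.2 w'.1 * μ (G.infoMin w'.1) w'.2.1 * ν (G.infoMax w'.1) w'.2.2

lemma playProb_eq_chainWeight (μ : X → A → ℝ) (ν : Y → B → ℝ) (z : G.Play) :
    G.playProb μ ν z = chainWeight (G.startWeight μ ν) (G.stepWeight μ ν) z := by
  refine Finset.prod_congr rfl fun h _ => ?_
  unfold arrivalProb
  by_cases hh : (h : ℕ) = 0
  · rw [if_pos hh, if_pos hh]
    rfl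
  · rw [if_neg hh, if_neg hh]
    rfl

lemma depth_eq_zero_of_startWeight_ne_zero {μ : X → A → ℝ} {ν : Y → B → ℝ} {w : S × A × B}
    (hw : G.startWeight μ ν w ≠ 0) : G.tree.depth w.1 = 0 := by
  rw [depth_eq_zero_iff]
  by_contra hroot
  exact hw (by simp [startWeight, hroot])

lemma depth_eq_succ_of_stepWeight_ne_zero {μ : X → A → ℝ} {ν : Y → B → ℝ} {w w' : S × A × B}
    (hw : G.stepWeight μ ν w w' ≠ 0) : G.tree.depth w'.1 = G.tree.depth w.1 + 1 :=
  G.depth_eq_succ_of_trans_ne_zero (left_ne_zero_of_mul (left_ne_zero_of_mul hw))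

lemma occ_seqForm (μ : X → A → ℝ) (ν : Y → B → ℝ) (w : S × A × B) :
    G.occ (G.minTree.seqForm μ) (G.maxTree.seqForm ν) w =
      ((G.tree.prev w.1).elim 1 fun p => G.trans p.1 p.2.1 p.2.2 w.1 *
        G.occ (G.minTree.seqForm μ) (G.maxTree.seqForm ν) p) *
      μ (G.infoMin w.1) w.2.1 * ν (G.infoMax w.1) w.2.2 := by
  simp only [occ]
  rw [DecisionTree.seqForm_eq, DecisionTree.seqForm_eq, reach_eq, G.recall_min, G.recall_max]
  rcases G.tree.prev w.1 with _ | p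
  · simp
  · simp only [Option.elim_some, Option.map_some]
    ring

lemma occAt_seqForm_zero (μ : X → A → ℝ) (ν : Y → B → ℝ) (w : S × A × B) :
    G.occAt (G.minTree.seqForm μ) (G.maxTree.seqForm ν) 0 w = G.startWeight μ ν w := by
  by_cases hroot : w.1 = G.root
  · rw [occAt, if_pos ((G.depth_eq_zero_iff _).2 hroot), occ_seqForm,
      (G.prev_eq_none_iff _).2 hroot, Option.elim_none, startWeight, if_pos hroot]
  · rw [occAt, if_neg (mt (G.depth_eq_zero_iff _).1 hroot), startWeight, if_neg hroot, zero_mul,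
      zero_mul]

lemma playProb_nonneg [Fintype A] [Fintype B] {μ : X → A → ℝ} {ν : Y → B → ℝ}
    (hμ : IsPolicy μ) (hν : IsPolicy ν) (z : G.Play) : 0 ≤ G.playProb μ ν z := by
  refine Finset.prod_nonneg fun h _ => mul_nonneg (mul_nonneg ?_ (hμ.1 _ _)) (hν.1 _ _)
  unfold arrivalProb
  split_ifs
  exacts [zero_le_one, le_rfl, G.trans_nonneg _ _ _ _]

variable {m u μ : X → A → ℝ} {n v ν : Y → B → ℝ}

lemma sum_fin_occAt (m : X → A → ℝ) (n : Y → B → ℝ) (w : S × A × B) :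
    ∑ h : Fin G.H, G.occAt m n h w = G.occ m n w := by
  simp only [occAt]
  rw [Finset.sum_eq_single_of_mem ⟨G.tree.depth w.1, G.depth_lt w.1⟩ (Finset.mem_univ _)
    fun h _ hh => if_neg fun hdepth => hh (Fin.ext hdepth.symm), if_pos rfl]

lemma abs_occ_le (hu : ∀ x a, |u x a| ≤ m x a) (hv : ∀ y b, |v y b| ≤ n y b)
    (w : S × A × B) : |G.occ u v w| ≤ G.occ m n w := by
  have hreach := G.reach_nonneg w.1
  have hm : 0 ≤ m (G.infoMin w.1) w.2.1 := (abs_nonneg _).trans (hu _ _)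
  rw [occ, abs_mul, abs_mul, abs_of_nonneg hreach]
  exact mul_le_mul (mul_le_mul_of_nonneg_left (hu _ _) hreach) (hv _ _) (abs_nonneg _)
    (mul_nonneg hreach hm)

lemma estimateMin_eq_importanceSample (μ : X → A → ℝ) (z : G.Play) :
    G.estimateMin μ z = importanceSample (G.minTree.seqForm μ) (G.playLoss z)
      (fun h => G.infoMin (z h).1) fun h => (z h).2.1 :=
  rfl

lemma estimateMax_eq_importanceSample (ν : Y → B → ℝ) (z : G.Play) :
    G.estimateMax ν z = importanceSample (G.maxTree.seqForm ν) (fun h => 1 - G.playLoss z h)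
      (fun h => G.infoMax (z h).1) fun h => (z h).2.2 :=
  rfl

variable [Fintype A] [Fintype B] {c d : ℝ}

lemma sum_trans_mul (s : S) (g : S × A × B → ℝ) :
    ∑ w : S × A × B, G.trans w.1 w.2.1 w.2.2 s * g w =
      (G.tree.prev s).elim 0 fun p => G.trans p.1 p.2.1 p.2.2 s * g p := by
  have htrans (w : S × A × B) (hw : G.tree.prev s ≠ some w) :
      G.trans w.1 w.2.1 w.2.2 s * g w = 0 := by
    rw [not_not.1 (mt (G.trans_tree _ _ _ s) hw), zero_mul]
  rcases hs : G.tree.prev s with _ | p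
  · exact Finset.sum_eq_zero fun w _ => htrans w (by simp [hs])
  · exact Finset.sum_eq_single_of_mem p (Finset.mem_univ _) fun w _ hw =>
      htrans w (by simpa [hs] using hw.symm)

lemma sum_trans_mul_occAt (m : X → A → ℝ) (n : Y → B → ℝ) (h : ℕ) (s : S) :
    ∑ w : S × A × B, G.trans w.1 w.2.1 w.2.2 s * G.occAt m n h w =
      if G.tree.depth s = h + 1 then
        (G.tree.prev s).elim 0 fun p => G.trans p.1 p.2.1 p.2.2 s * G.occ m n p
      else 0 := by
  rw [sum_trans_mul]
  rcases hs : G.tree.prev s with _ | p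
  · simp
  · simp [G.tree.depth_of_some s p hs, occAt]

lemma occAt_seqForm_succ (μ : X → A → ℝ) (ν : Y → B → ℝ) (h : ℕ) (w' : S × A × B) :
    G.occAt (G.minTree.seqForm μ) (G.maxTree.seqForm ν) (h + 1) w' =
      ∑ w, G.occAt (G.minTree.seqForm μ) (G.maxTree.seqForm ν) h w * G.stepWeight μ ν w w' := by
  trans (∑ w : S × A × B, G.trans w.1 w.2.1 w.2.2 w'.1 *
    G.occAt (G.minTree.seqForm μ) (G.maxTree.seqForm ν) h w) *
      μ (G.infoMin w'.1) w'.2.1 * ν (G.infoMax w'.1) w'.2.2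
  · rw [sum_trans_mul_occAt, occAt]
    split_ifs with hdepth
    · rw [occ_seqForm]
      rcases hs : G.tree.prev w'.1 with _ | p
      · rw [G.tree.depth_of_none _ hs] at hdepth
        omega
      · rfl
    · simp
  · simp only [stepWeight, Finset.sum_mul]
    exact Finset.sum_congr rfl fun w _ => by ring

lemma sum_stepWeight (hμ : IsPolicy μ) (hν : IsPolicy ν) {w : S × A × B}
    (hw : G.tree.depth w.1 + 1 < G.H) : ∑ w', G.stepWeight μ ν w w' = 1 := by
  simp only [Fintype.sum_prod_type, stepWeight, ← Finset.mul_sum, hμ.2, hν.2, mul_one]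
  exact G.trans_sum _ _ _ hw

theorem sum_playProb_mul (hμ : IsPolicy μ) (hν : IsPolicy ν) (h : Fin G.H)
    (f : S × A × B → ℝ) :
    ∑ z : G.Play, G.playProb μ ν z * f (z h) =
      ∑ w, G.occAt (G.minTree.seqForm μ) (G.maxTree.seqForm ν) h w * f w := by
  simp only [playProb_eq_chainWeight]
  exact sum_chainWeight_mul (d := fun w => G.tree.depth w.1)
    (fun w => G.depth_eq_zero_of_startWeight_ne_zero)
    (fun w w' => G.depth_eq_succ_of_stepWeight_ne_zero) (fun w => G.sum_stepWeight hμ hν)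
    (G.occAt_seqForm_zero μ ν) (G.occAt_seqForm_succ μ ν) le_rfl h f

lemma sum_occ_actions (hm : G.minTree.Conserves c m) (hn : G.maxTree.Conserves d n) (s : S) :
    ∑ a, ∑ b, G.occ m n (s, a, b) =
      (G.tree.prev s).elim (c * d) fun p => G.trans p.1 p.2.1 p.2.2 s * G.occ m n p := by
  have hprod : ∑ a, ∑ b, G.occ m n (s, a, b) =
      G.reach s * ((∑ a, m (G.infoMin s) a) * ∑ b, n (G.infoMax s) b) := by
    rw [Finset.sum_mul_sum]
    simp only [occ, Finset.mul_sum, mul_assoc]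
  rw [hprod, hm, hn, G.recall_min, G.recall_max, reach_eq]
  rcases G.tree.prev s with _ | p
  · simp
  · simp only [Option.elim_some, Option.map_some, occ]
    ring

lemma sum_occAt_actions (hm : G.minTree.Conserves c m) (hn : G.maxTree.Conserves d n) (h : ℕ)
    (s : S) :
    ∑ a, ∑ b, G.occAt m n h (s, a, b) = if G.tree.depth s = h then
      (G.tree.prev s).elim (c * d) fun p => G.trans p.1 p.2.1 p.2.2 s * G.occ m n p else 0 := by
  rw [← G.sum_occ_actions hm hn s]
  simp only [occAt]
  split_ifs
  · rfl
  · simp only [Finset.sum_const_zero]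

lemma sum_occAt_zero (hm : G.minTree.Conserves c m) (hn : G.maxTree.Conserves d n) :
    ∑ w, G.occAt m n 0 w = c * d := by
  classical
  simp only [Fintype.sum_prod_type, G.sum_occAt_actions hm hn, G.depth_eq_zero_iff]
  rw [Finset.sum_ite_eq' Finset.univ, if_pos (Finset.mem_univ _), (G.prev_eq_none_iff _).2 rfl,
    Option.elim_none]

lemma sum_occAt_succ (hm : G.minTree.Conserves c m) (hn : G.maxTree.Conserves d n) {h : ℕ}
    (hh : h + 1 < G.H) : ∑ w, G.occAt m n (h + 1) w = ∑ w, G.occAt m n h w := by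
  have hchildren (s : S) : ∑ a, ∑ b, G.occAt m n (h + 1) (s, a, b) =
      ∑ w : S × A × B, G.trans w.1 w.2.1 w.2.2 s * G.occAt m n h w := by
    rw [G.sum_occAt_actions hm hn, sum_trans_mul_occAt]
    split_ifs with hdepth
    · rcases hs : G.tree.prev s with _ | p
      · rw [G.tree.depth_of_none s hs] at hdepth
        omega
      · rfl
    · rfl
  trans ∑ s, ∑ w : S × A × B, G.trans w.1 w.2.1 w.2.2 s * G.occAt m n h w
  · rw [Fintype.sum_prod_type]
    exact Finset.sum_congr rfl fun s _ => (Fintype.sum_prod_type _).trans (hchildren s)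
  · rw [Finset.sum_comm]
    refine Finset.sum_congr rfl fun w _ => ?_
    rw [← Finset.sum_mul, occAt]
    split_ifs with hdepth
    · rw [G.trans_sum _ _ _ (by omega), one_mul]
    · rw [mul_zero]

theorem sum_occAt (hm : G.minTree.Conserves c m) (hn : G.maxTree.Conserves d n) {h : ℕ}
    (hh : h < G.H) : ∑ w, G.occAt m n h w = c * d := by
  induction h with
  | zero => exact G.sum_occAt_zero hm hn
  | succ h ih => rw [G.sum_occAt_succ hm hn hh, ih (by omega)]

theorem sum_occ (hm : G.minTree.Conserves c m) (hn : G.maxTree.Conserves d n) :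
    ∑ w, G.occ m n w = G.H * (c * d) := by
  simp only [← sum_fin_occAt]
  rw [Finset.sum_comm, Finset.sum_congr rfl fun h _ => G.sum_occAt hm hn h.isLt]
  simp

lemma sum_playProb (hμ : IsPolicy μ) (hν : IsPolicy ν) : ∑ z : G.Play, G.playProb μ ν z = 1 := by
  simpa [G.sum_occAt (DecisionTree.conserves_seqForm hμ) (DecisionTree.conserves_seqForm hν)
    G.H_pos] using G.sum_playProb_mul hμ hν ⟨0, G.H_pos⟩ fun _ => 1

lemma sum_playProb_mul_sum (hμ : IsPolicy μ) (hν : IsPolicy ν) (f : S × A × B → ℝ) :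
    ∑ z : G.Play, G.playProb μ ν z * ∑ h, f (z h) =
      ∑ w, G.occ (G.minTree.seqForm μ) (G.maxTree.seqForm ν) w * f w := by
  simp only [Finset.mul_sum, ← sum_fin_occAt, Finset.sum_mul]
  exact Finset.sum_comm.trans <|
    (Finset.sum_congr rfl fun h _ => G.sum_playProb_mul hμ hν h f).trans Finset.sum_comm

/-- The expected loss as a bilinear form in the sequence forms of the two policies. -/
noncomputable def lossForm : (X → A → ℝ) →ₗ[ℝ] (Y → B → ℝ) →ₗ[ℝ] ℝ :=
  LinearMap.mk₂ ℝ (fun m n => ∑ w : S × A × B, G.occ m n w * G.loss w.1 w.2.1 w.2.2)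
    (fun m m' n => by
      simp only [occ, Pi.add_apply, ← Finset.sum_add_distrib]
      exact Finset.sum_congr rfl fun w _ => by ring)
    (fun r m n => by
      simp only [occ, Pi.smul_apply, smul_eq_mul, Finset.mul_sum]
      exact Finset.sum_congr rfl fun w _ => by ring)
    (fun m n n' => by
      simp only [occ, Pi.add_apply, ← Finset.sum_add_distrib]
      exact Finset.sum_congr rfl fun w _ => by ring)
    (fun r m n => by
      simp only [occ, Pi.smul_apply, smul_eq_mul, Finset.mul_sum]
      exact Finset.sum_congr rfl fun w _ => by ring)

lemma lossForm_apply (m : X → A → ℝ) (n : Y → B → ℝ) :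
    G.lossForm m n = ∑ w : S × A × B, G.occ m n w * G.loss w.1 w.2.1 w.2.2 :=
  rfl

lemma value_eq_lossForm (hμ : IsPolicy μ) (hν : IsPolicy ν) :
    G.value μ ν = G.lossForm (G.minTree.seqForm μ) (G.maxTree.seqForm ν) :=
  G.sum_playProb_mul_sum hμ hν fun w => G.loss w.1 w.2.1 w.2.2

lemma abs_lossForm_le (hm : G.minTree.Conserves 1 m) (hn : G.maxTree.Conserves 1 n)
    (hu : ∀ x a, |u x a| ≤ m x a) (hv : ∀ y b, |v y b| ≤ n y b) : |G.lossForm u v| ≤ G.H := by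
  calc |G.lossForm u v| ≤ ∑ w : S × A × B, |G.occ u v w * G.loss w.1 w.2.1 w.2.2| :=
        Finset.abs_sum_le_sum_abs _ _
    _ ≤ ∑ w, G.occ m n w := by
        refine Finset.sum_le_sum fun w _ => ?_
        obtain ⟨hloss₀, hloss₁⟩ := G.loss_mem w.1 w.2.1 w.2.2
        rw [abs_mul, abs_of_nonneg hloss₀]
        exact (mul_le_of_le_one_right (abs_nonneg _) hloss₁).trans (G.abs_occ_le hu hv w)
    _ = G.H := by rw [G.sum_occ hm hn, mul_one, mul_one]

lemma sum_playProb_mul_sum_estimateMin_mul [Fintype X] (hμ : IsInteriorPolicy μ)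
    (hν : IsPolicy ν) (w : X → A → ℝ) :
    ∑ z, G.playProb μ ν z * ∑ x, ∑ a, G.estimateMin μ z x a * w x a =
      G.lossForm w (G.maxTree.seqForm ν) := by
  simp only [estimateMin_eq_importanceSample, sum_importanceSample_mul, playLoss]
  refine (G.sum_playProb_mul_sum hμ.1 hν fun p => G.loss p.1 p.2.1 p.2.2 /
    G.minTree.seqForm μ (G.infoMin p.1) p.2.1 * w (G.infoMin p.1) p.2.1).trans
      (Finset.sum_congr rfl fun p _ => ?_)
  have hpos := (DecisionTree.seqForm_pos (T := G.minTree) hμ (G.infoMin p.1) p.2.1).ne'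
  simp only [occ]
  field_simp

lemma sum_playProb_mul_sum_estimateMax_mul [Fintype Y] (hμ : IsPolicy μ)
    (hν : IsInteriorPolicy ν) {w : Y → B → ℝ} (hw : G.maxTree.Conserves 0 w) :
    ∑ z, G.playProb μ ν z * ∑ y, ∑ b, G.estimateMax ν z y b * w y b =
      -G.lossForm (G.minTree.seqForm μ) w := by
  -- The constant loss `1` has no effect along tangent directions, which have total mass zero.
  have hmass : ∑ p, G.occ (G.minTree.seqForm μ) w p = 0 := by
    rw [G.sum_occ (DecisionTree.conserves_seqForm hμ) hw, mul_zero, mul_zero]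
  simp only [estimateMax_eq_importanceSample, sum_importanceSample_mul, playLoss]
  refine (G.sum_playProb_mul_sum hμ hν.1 fun p => (1 - G.loss p.1 p.2.1 p.2.2) /
    G.maxTree.seqForm ν (G.infoMax p.1) p.2.2 * w (G.infoMax p.1) p.2.2).trans ?_
  rw [← zero_sub, ← hmass, lossForm_apply, ← Finset.sum_sub_distrib]
  refine Finset.sum_congr rfl fun p _ => ?_
  have hpos := (DecisionTree.seqForm_pos (T := G.maxTree) hν (G.infoMax p.1) p.2.2).ne'
  simp only [occ]
  field_simp

end ExtensiveGame

/-! ### The saddle-point problem of a game -/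

section Joint

variable {X Y A B : Type*}

/-- A vector of the min-player and a vector of the max-player as one vector. -/
def joint (m : X → A → ℝ) (n : Y → B → ℝ) : (X × A) ⊕ (Y × B) → ℝ :=
  Sum.elim (fun i => m i.1 i.2) fun j => n j.1 j.2

/-- The part of a joint vector that belongs to the min-player. -/
def minPart : ((X × A) ⊕ (Y × B) → ℝ) →ₗ[ℝ] X → A → ℝ where
  toFun z := fun x a => z (Sum.inl (x, a))
  map_add' _ _ := rfl
  map_smul' _ _ := rfl

/-- The part of a joint vector that belongs to the max-player. -/
def maxPart : ((X × A) ⊕ (Y × B) → ℝ) →ₗ[ℝ] Y → B → ℝ where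
  toFun z := fun y b => z (Sum.inr (y, b))
  map_add' _ _ := rfl
  map_smul' _ _ := rfl

variable {m : X → A → ℝ} {n : Y → B → ℝ}

lemma forall_joint {p : ℝ → Prop} (hm : ∀ x a, p (m x a)) (hn : ∀ y b, p (n y b)) :
    ∀ i, p (joint m n i)
  | .inl (x, a) => hm x a
  | .inr (y, b) => hn y b

lemma measurable_joint {Ω : Type*} {_ : MeasurableSpace Ω} {m : Ω → X → A → ℝ}
    {n : Ω → Y → B → ℝ} (hm : ∀ x a, Measurable fun ω => m ω x a)
    (hn : ∀ y b, Measurable fun ω => n ω y b) :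
    ∀ i, Measurable fun ω => joint (m ω) (n ω) i
  | .inl (x, a) => hm x a
  | .inr (y, b) => hn y b

variable [Fintype X] [Fintype Y] [Fintype A] [Fintype B]

lemma sum_joint (g : (X × A) ⊕ (Y × B) → ℝ) :
    ∑ i, g i = ∑ x, ∑ a, g (Sum.inl (x, a)) + ∑ y, ∑ b, g (Sum.inr (y, b)) := by
  rw [Fintype.sum_sum_type, Fintype.sum_prod_type, Fintype.sum_prod_type]

end Joint

namespace ExtensiveGame

variable {S X Y A B : Type*} [Fintype S] [Fintype A] [Fintype B] (G : ExtensiveGame S X Y A B)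

/-- The set of pairs of sequence forms of the two players, as joint vectors. -/
def jointForms : Set ((X × A) ⊕ (Y × B) → ℝ) :=
  {z | (∀ i, 0 ≤ z i) ∧ G.minTree.Conserves 1 (minPart z) ∧ G.maxTree.Conserves 1 (maxPart z)}

/-- The tangent space of `jointForms`. -/
def jointTangent : Submodule ℝ ((X × A) ⊕ (Y × B) → ℝ) :=
  G.minTree.tangent.comap minPart ⊓ G.maxTree.tangent.comap maxPart

/-- The form which sends the joint strategies `z` and `z'` to the gain of the players from
deviating from `z` to `z'`, up to sign: the loss of the strategy of the min-player in `z'` against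
that of the max-player in `z`, minus the loss with the two exchanged. -/
noncomputable def jointForm : LinearMap.BilinForm ℝ ((X × A) ⊕ (Y × B) → ℝ) :=
  G.lossForm.flip.compl₁₂ maxPart minPart - G.lossForm.compl₁₂ minPart maxPart

lemma jointForm_apply (z w : (X × A) ⊕ (Y × B) → ℝ) :
    G.jointForm z w =
      G.lossForm (minPart w) (maxPart z) - G.lossForm (minPart z) (maxPart w) :=
  rfl

variable {G} {μ : X → A → ℝ} {ν : Y → B → ℝ} {z z' w : (X × A) ⊕ (Y × B) → ℝ}

lemma joint_seqForm_mem (hμ : IsPolicy μ) (hν : IsPolicy ν) :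
    joint (G.minTree.seqForm μ) (G.maxTree.seqForm ν) ∈ G.jointForms :=
  ⟨forall_joint (DecisionTree.seqForm_nonneg hμ) (DecisionTree.seqForm_nonneg hν),
    DecisionTree.conserves_seqForm hμ, DecisionTree.conserves_seqForm hν⟩

lemma le_one_of_mem_jointForms (hz : z ∈ G.jointForms) : ∀ i, z i ≤ 1
  | .inl (x, a) => hz.2.1.le_one (fun _ _ => hz.1 _) x a
  | .inr (y, b) => hz.2.2.le_one (fun _ _ => hz.1 _) y b

lemma sub_mem_jointTangent (hz : z ∈ G.jointForms) (hz' : z' ∈ G.jointForms) :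
    z - z' ∈ G.jointTangent := by
  have hmin := hz.2.1.sub hz'.2.1
  have hmax := hz.2.2.sub hz'.2.2
  rw [sub_self] at hmin hmax
  exact ⟨hmin, hmax⟩

lemma add_mem_jointForms (hz : z ∈ G.jointForms) (hw : w ∈ G.jointTangent)
    (hzw : ∀ i, 0 ≤ z i + w i) : z + w ∈ G.jointForms := by
  have hmin := hz.2.1.add hw.1
  have hmax := hz.2.2.add hw.2
  rw [add_zero] at hmin hmax
  exact ⟨hzw, hmin, hmax⟩

lemma abs_jointForm_le {u : (X × A) ⊕ (Y × B) → ℝ} (hz : z ∈ G.jointForms)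
    (hz' : z' ∈ G.jointForms) (hu : ∀ i, |u i| ≤ z i) (hw : ∀ i, |w i| ≤ z' i) :
    |G.jointForm u w| ≤ 2 * G.H :=
  calc |G.jointForm u w|
      ≤ |G.lossForm (minPart w) (maxPart u)| + |G.lossForm (minPart u) (maxPart w)| := abs_sub _ _
    _ ≤ G.H + G.H := by
      gcongr
      · exact G.abs_lossForm_le hz'.2.1 hz.2.2 (fun _ _ => hw _) fun _ _ => hu _
      · exact G.abs_lossForm_le hz.2.1 hz'.2.2 (fun _ _ => hu _) fun _ _ => hw _
    _ = 2 * G.H := (two_mul _).symm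

lemma jointForm_joint_seqForm {μ' : X → A → ℝ} {ν' : Y → B → ℝ} (hμ : IsPolicy μ)
    (hν : IsPolicy ν) (hμ' : IsPolicy μ') (hν' : IsPolicy ν') :
    G.jointForm (joint (G.minTree.seqForm μ) (G.maxTree.seqForm ν))
      (joint (G.minTree.seqForm μ') (G.maxTree.seqForm ν')) =
      G.value μ' ν - G.value μ ν' := by
  rw [G.value_eq_lossForm hμ' hν, G.value_eq_lossForm hμ hν']
  rfl

variable (G) in
lemma isAlt_jointForm : G.jointForm.IsAlt := fun _ => sub_self _

lemma exploitabilityGap_le (hμ : IsPolicy μ) (hν : IsPolicy ν) {g : ℝ}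
    (h : ∀ z' ∈ G.jointForms,
      G.jointForm (joint (G.minTree.seqForm μ) (G.maxTree.seqForm ν))
        (joint (G.minTree.seqForm μ) (G.maxTree.seqForm ν) - z') ≤ g) :
    G.exploitabilityGap μ ν ≤ g := by
  have hvalue {ν' : Y → B → ℝ} (hν' : IsPolicy ν') {μ' : X → A → ℝ} (hμ' : IsPolicy μ') :
      G.value μ ν' - G.value μ' ν ≤ g := by
    have := h _ (joint_seqForm_mem hμ' hν')
    rwa [map_sub, G.isAlt_jointForm, zero_sub, jointForm_joint_seqForm hμ hν hμ' hν',
      neg_sub] at this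
  rw [exploitabilityGap, sub_le_iff_le_add']
  refine csSup_le ⟨_, ν, hν, rfl⟩ (Set.forall_mem_image.2 fun ν' hν' => ?_)
  rw [← sub_le_iff_le_add]
  refine le_csInf ⟨_, μ, hμ, rfl⟩ (Set.forall_mem_image.2 fun μ' hμ' => ?_)
  exact sub_le_comm.1 (hvalue hν' hμ')

variable (G)

lemma isCompact_jointForms : IsCompact G.jointForms := by
  have hmin : Continuous (minPart : ((X × A) ⊕ (Y × B) → ℝ) → X → A → ℝ) :=
    continuous_pi fun x => continuous_pi fun a => continuous_apply (Sum.inl (x, a))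
  have hmax : Continuous (maxPart : ((X × A) ⊕ (Y × B) → ℝ) → Y → B → ℝ) :=
    continuous_pi fun y => continuous_pi fun b => continuous_apply (Sum.inr (y, b))
  exact (isCompact_Icc (a := 0) (b := 1)).of_isClosed_subset
    (isClosed_Ici.inter (((G.minTree.isClosed_setOf_conserves 1).preimage hmin).inter
      ((G.maxTree.isClosed_setOf_conserves 1).preimage hmax)))
    fun z hz => ⟨hz.1, le_one_of_mem_jointForms hz⟩

variable [Fintype X] [Fintype Y] [Nonempty A] [Nonempty B]

lemma height_le_card_joint : G.H ≤ Fintype.card ((X × A) ⊕ (Y × B)) := by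
  rw [Fintype.card_sum, Fintype.card_prod]
  exact (G.height_le_card.trans (Nat.le_mul_of_pos_right _ Fintype.card_pos)).trans
    (Nat.le_add_right _ _)

/-- The game as a saddle-point problem on sequence forms. -/
noncomputable def saddle : SaddleProblem ((X × A) ⊕ (Y × B)) where
  V := G.jointTangent
  Q := G.jointForms
  isCompact := G.isCompact_jointForms
  nonneg _ hz := hz.1
  le_one _ hz := le_one_of_mem_jointForms hz
  sub_mem _ hz _ hz' := sub_mem_jointTangent hz hz'
  add_mem _ hz _ hw hzw := add_mem_jointForms hz hw hzw
  form := G.jointForm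
  isAlt := G.isAlt_jointForm
  bound := 2 * (Fintype.card ((X × A) ⊕ (Y × B)) : ℝ)
  one_le_bound := by
    have : (1 : ℝ) ≤ (Fintype.card ((X × A) ⊕ (Y × B)) : ℝ) :=
      Nat.one_le_cast.2 (G.H_pos.trans_le G.height_le_card_joint)
    linarith
  abs_form_le z hz z' hz' u w hu hw := by
    refine (abs_jointForm_le hz hz' hu hw).trans ?_
    gcongr
    exact G.height_le_card_joint

end ExtensiveGame

namespace SaddleProblem

variable {I : Type*} [Fintype I] (G : SaddleProblem I) {z z' : I → ℝ}

lemma form_sub_le_bound (hz : z ∈ G.Q) (hz' : z' ∈ G.Q) : G.form z (z - z') ≤ G.bound := by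
  rw [map_sub, G.isAlt, zero_sub]
  exact (neg_le_abs _).trans <| G.abs_form_le z hz z' hz' z z'
    (fun i => (abs_of_nonneg (G.nonneg z hz i)).le) fun i => (abs_of_nonneg (G.nonneg z' hz' i)).le

end SaddleProblem

namespace ExtensiveGame

section Estimates

variable {S X Y A B : Type*} [Fintype S] {G : ExtensiveGame S X Y A B}

lemma playLoss_mem (z : G.Play) (h : Fin G.H) : G.playLoss z h ∈ Set.Icc 0 1 :=
  G.loss_mem _ _ _

variable [Fintype A] [Fintype B] {μ : X → A → ℝ} {ν : Y → B → ℝ}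

lemma joint_estimate_nonneg (hμ : IsInteriorPolicy μ) (hν : IsInteriorPolicy ν) (z : G.Play) :
    ∀ i, 0 ≤ joint (G.estimateMin μ z) (G.estimateMax ν z) i :=
  forall_joint
    (importanceSample_nonneg (DecisionTree.seqForm_pos hμ) (fun h => (playLoss_mem z h).1) _ _)
    (importanceSample_nonneg (DecisionTree.seqForm_pos hν)
      (fun h => sub_nonneg.2 (playLoss_mem z h).2) _ _)

variable [Fintype X] [Fintype Y]

lemma sum_joint_estimate_mul_le (hμ : IsInteriorPolicy μ) (hν : IsInteriorPolicy ν) (z : G.Play) :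
    ∑ i, joint (G.estimateMin μ z) (G.estimateMax ν z) i *
      joint (G.minTree.seqForm μ) (G.maxTree.seqForm ν) i ≤ 2 * G.H := by
  have hmin := sum_importanceSample_mul_self_le (DecisionTree.seqForm_pos (T := G.minTree) hμ)
    (fun h => (playLoss_mem z h).2) (fun h => G.infoMin (z h).1) fun h => (z h).2.1
  have hmax := sum_importanceSample_mul_self_le (DecisionTree.seqForm_pos (T := G.maxTree) hν)
    (fun h => sub_le_self 1 (playLoss_mem z h).1) (fun h => G.infoMax (z h).1)
    fun h => (z h).2.2
  rw [Fintype.card_fin] at hmin hmax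
  rw [sum_joint, two_mul]
  exact add_le_add hmin hmax

lemma sum_playProb_mul_sum_joint_estimate_mul (hμ : IsInteriorPolicy μ)
    (hν : IsInteriorPolicy ν) {w : (X × A) ⊕ (Y × B) → ℝ} (hw : w ∈ G.jointTangent) :
    ∑ z, G.playProb μ ν z * ∑ i, joint (G.estimateMin μ z) (G.estimateMax ν z) i * w i =
      G.jointForm (joint (G.minTree.seqForm μ) (G.maxTree.seqForm ν)) w := by
  simp only [sum_joint, mul_add, Finset.sum_add_distrib]
  rw [jointForm_apply, sub_eq_add_neg]
  exact congrArg₂ (· + ·) (G.sum_playProb_mul_sum_estimateMin_mul hμ hν.1 (minPart w))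
    (G.sum_playProb_mul_sum_estimateMax_mul hμ.1 hν hw.2)

end Estimates

variable {S X Y A B : Type*} [Fintype S] [Fintype X] [Fintype Y] [Fintype A] [Fintype B]
  {G : ExtensiveGame S X Y A B}

variable {δ η τ : ℝ} {T₀ : ℕ} {Ω : Type*} {mΩ : MeasurableSpace Ω} {P : Measure Ω}
  {ℱ : Filtration ℕ mΩ} {Z : ℕ → Ω → G.Play} {μ : ℕ → Ω → X → A → ℝ} {ν : ℕ → Ω → Y → B → ℝ}

namespace IsRun

lemma isInteriorPolicy_min (h : G.IsRun δ η τ T₀ P ℱ Z μ ν) :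
    ∀ t ω, IsInteriorPolicy (μ t ω)
  | 0, ω => by
    have := (h.step_min 0 ω).1.1.nonempty (G.infoMin G.root)
    exact h.start_min ω ▸ isInteriorPolicy_uniformPolicy
  | t + 1, ω => (h.step_min t ω).1

lemma isInteriorPolicy_max (h : G.IsRun δ η τ T₀ P ℱ Z μ ν) :
    ∀ t ω, IsInteriorPolicy (ν t ω)
  | 0, ω => by
    have := (h.step_max 0 ω).1.1.nonempty (G.infoMax G.root)
    exact h.start_max ω ▸ isInteriorPolicy_uniformPolicy
  | t + 1, ω => (h.step_max t ω).1

lemma hasCondLaw (h : G.IsRun δ η τ T₀ P ℱ Z μ ν) (t : ℕ) :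
    HasCondLaw P (ℱ t) (Z t) fun z ω => G.playProb (μ t ω) (ν t ω) z where
  measurableSet_eq z := ℱ.le _ _ (h.measurable_play t z)
  measurable _ := Finset.measurable_fun_prod _ fun _ _ =>
    (measurable_const.mul (h.measurable_min t _ _)).mul (h.measurable_max t _ _)
  nonneg z ω := G.playProb_nonneg (h.isInteriorPolicy_min t ω).1 (h.isInteriorPolicy_max t ω).1 z
  sum_eq_one ω := G.sum_playProb (h.isInteriorPolicy_min t ω).1 (h.isInteriorPolicy_max t ω).1
  condExp_ae_eq z := h.law_play t z

lemma isBarrierStep (h : G.IsRun δ η τ T₀ P ℱ Z μ ν) (t : ℕ) (ω : Ω) :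
    IsBarrierStep G.jointTangent (learningRate η T₀ t) (regStrength δ τ T₀ t)
      (joint (G.estimateMin (μ t ω) (Z t ω)) (G.estimateMax (ν t ω) (Z t ω)))
      (joint (G.minTree.seqForm (μ t ω)) (G.maxTree.seqForm (ν t ω)))
      (joint (G.minTree.seqForm (μ (t + 1) ω)) (G.maxTree.seqForm (ν (t + 1) ω))) := by
  intro w hw
  rw [sum_joint, ← add_zero 0]
  exact congrArg₂ (· + ·) ((h.step_min t ω).sum_eq_zero hw.1) ((h.step_max t ω).sum_eq_zero hw.2)

theorem isMirrorDescent [Nonempty A] [Nonempty B] (h : G.IsRun δ η τ T₀ P ℱ Z μ ν) :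
    G.saddle.IsMirrorDescent P ℱ (learningRate η T₀) (regStrength δ τ T₀) Z
      (fun t z ω => G.playProb (μ t ω) (ν t ω) z)
      (fun t z ω => joint (G.estimateMin (μ t ω) z) (G.estimateMax (ν t ω) z))
      (fun t ω => joint (G.minTree.seqForm (μ t ω)) (G.maxTree.seqForm (ν t ω))) where
  hasCondLaw := h.hasCondLaw
  measurable t := measurable_joint (G.minTree.measurable_seqForm (h.measurable_min t))
    (G.maxTree.measurable_seqForm (h.measurable_max t))
  mem t ω := joint_seqForm_mem (h.isInteriorPolicy_min t ω).1 (h.isInteriorPolicy_max t ω).1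
  pos t ω := forall_joint (DecisionTree.seqForm_pos (h.isInteriorPolicy_min t ω))
    (DecisionTree.seqForm_pos (h.isInteriorPolicy_max t ω))
  measurable_estimate t z := measurable_joint
    (fun x a => measurable_importanceSample
      (G.minTree.measurable_seqForm (h.measurable_min t) x a) _ _ _)
    (fun y b => measurable_importanceSample
      (G.maxTree.measurable_seqForm (h.measurable_max t) y b) _ _ _)
  estimate_nonneg t z ω :=
    joint_estimate_nonneg (h.isInteriorPolicy_min t ω) (h.isInteriorPolicy_max t ω) z
  sum_estimate_mul_le t z ω := by
    refine (sum_joint_estimate_mul_le (h.isInteriorPolicy_min t ω)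
      (h.isInteriorPolicy_max t ω) z).trans (mul_le_mul_of_nonneg_left ?_ zero_le_two)
    exact Nat.cast_le.2 G.height_le_card_joint
  unbiased t ω _ hw := sum_playProb_mul_sum_joint_estimate_mul (h.isInteriorPolicy_min t ω)
    (h.isInteriorPolicy_max t ω) hw
  isBarrierStep := h.isBarrierStep

end IsRun

end ExtensiveGame

lemma DecisionTree.one_div_pow_le_seqForm_uniformPolicy {X A : Type*} [Fintype A] [Nonempty A]
    (T : DecisionTree X A) {K : ℕ} (hA : Fintype.card A ≤ K) {x : X} (hx : T.depth x < K) (a : A) :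
    (1 / (K : ℝ)) ^ K ≤ T.seqForm (uniformPolicy X A) x a := by
  have hcard : 0 < Fintype.card A := Fintype.card_pos
  have hK : (1 : ℝ) ≤ K := Nat.one_le_cast.2 (hcard.trans_le hA)
  rw [seqForm_uniformPolicy]
  calc (1 / (K : ℝ)) ^ K ≤ (1 / (K : ℝ)) ^ (T.depth x + 1) :=
        pow_le_pow_of_le_one (by positivity) (div_le_one_of_le₀ hK (by positivity)) hx
    _ ≤ (1 / (Fintype.card A : ℝ)) ^ (T.depth x + 1) := by gcongr

namespace ExtensiveGame

variable {S X Y A B : Type*} [Fintype S] [Fintype X] [Fintype Y] [Fintype A] [Fintype B]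
  {G : ExtensiveGame S X Y A B}

lemma one_div_pow_le_joint_uniformPolicy [Nonempty A] [Nonempty B] :
    ∀ i, (1 / (Fintype.card ((X × A) ⊕ (Y × B)) : ℝ)) ^ Fintype.card ((X × A) ⊕ (Y × B)) ≤
      joint (G.minTree.seqForm (uniformPolicy X A)) (G.maxTree.seqForm (uniformPolicy Y B)) i := by
  refine forall_joint (fun x a => ?_) fun y b => ?_
  · obtain ⟨s, rfl⟩ := G.infoMin_surjective x
    refine G.minTree.one_div_pow_le_seqForm_uniformPolicy ?_ ?_ a
    · exact Fintype.card_le_of_injective (fun a => Sum.inl (G.infoMin s, a)) fun _ _ => by simp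
    · rw [G.depth_infoMin]
      exact (G.depth_lt s).trans_le G.height_le_card_joint
  · obtain ⟨s, rfl⟩ := G.infoMax_surjective y
    refine G.maxTree.one_div_pow_le_seqForm_uniformPolicy ?_ ?_ b
    · exact Fintype.card_le_of_injective (fun b => Sum.inr (G.infoMax s, b)) fun _ _ => by simp
    · rw [G.depth_infoMax]
      exact (G.depth_lt s).trans_le G.height_le_card_joint

variable {δ η τ : ℝ} {T₀ : ℕ} {Ω : Type*} {mΩ : MeasurableSpace Ω} {P : Measure Ω}
  [IsProbabilityMeasure P] {ℱ : Filtration ℕ mΩ} {Z : ℕ → Ω → G.Play} {μ : ℕ → Ω → X → A → ℝ}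
  {ν : ℕ → Ω → Y → B → ℝ}

lemma IsRun.card_pos (h : G.IsRun δ η τ T₀ P ℱ Z μ ν) :
    0 < Fintype.card ((X × A) ⊕ (Y × B)) := by
  obtain ⟨ω⟩ := nonempty_of_isProbabilityMeasure P
  obtain ⟨a⟩ := (h.isInteriorPolicy_min 0 ω).1.nonempty (G.infoMin G.root)
  exact Fintype.card_pos_iff.2 ⟨Sum.inl (G.infoMin G.root, a)⟩

theorem IsRun.one_sub_le_measureReal_exploitabilityGap_le {R u : ℝ} {r k w : ℕ → ℝ} {K : ℕ}
    (h : G.IsRun δ η τ T₀ P ℱ Z μ ν) (hδ : 0 < δ) (hK : Fintype.card ((X × A) ⊕ (Y × B)) = K)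
    (hs : IsTrackingSchedule K (2 * K) (K * ((1 / (K : ℝ)) ^ K)⁻¹) R δ (learningRate η T₀)
      (regStrength δ τ T₀) r k w u) :
    1 - δ ≤ P.real {ω | ∀ t, G.exploitabilityGap (μ t ω) (ν t ω) ≤
      2 * K * regStrength δ τ T₀ t} := by
  subst hK
  obtain ⟨ω₀⟩ := nonempty_of_isProbabilityMeasure P
  have := (h.isInteriorPolicy_min 0 ω₀).1.nonempty (G.infoMin G.root)
  have := (h.isInteriorPolicy_max 0 ω₀).1.nonempty (G.infoMax G.root)
  have hK : 0 < (Fintype.card ((X × A) ⊕ (Y × B)) : ℝ) := Nat.cast_pos.2 h.card_pos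
  refine (h.isMirrorDescent.one_sub_le_measureReal_form_sub_le hs hδ (pow_pos (one_div_pos.2 hK) _)
    fun ω => ?_).trans (measureReal_mono (fun ω hω t => ?_) (measure_ne_top _ _))
  · simp only [h.start_min, h.start_max]
    exact one_div_pow_le_joint_uniformPolicy
  · refine exploitabilityGap_le (h.isInteriorPolicy_min t ω).1 (h.isInteriorPolicy_max t ω).1
      fun z hz => ?_
    rcases lt_or_ge (regStrength δ τ T₀ t) 1 with hreg | hreg
    · refine (hω t hreg z hz).trans_eq ?_
      simp only [saddle]
      ring
    · exact (G.saddle.form_sub_le_bound (h.isMirrorDescent.mem t ω) hz).trans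
        (le_mul_of_one_le_right G.saddle.bound_pos.le hreg)

end ExtensiveGame

theorem mainTheorem2 (K : ℕ) (δ : ℝ) (hδ : 0 < δ) :
    ∃ c : ℝ, 0 < c ∧
      ∀ (S X Y A B : Type*) [Fintype S] [Fintype X] [Fintype Y] [Fintype A] [Fintype B]
        (G : ExtensiveGame S X Y A B)
        (_ : Fintype.card A * Fintype.card X + Fintype.card B * Fintype.card Y = K)
        (η τ : ℝ) (T₀ : ℕ) (_ : 0 < η) (_ : 0 < τ) (_ : 1 < T₀)
        (_ : 1 / (η * τ) ≤ c) (_ : η ≤ c)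
        (_ : η * τ ≤ T₀ / Real.log T₀ ^ 4) (_ : T₀ ≤ Real.log (1 / δ) ^ 2 * τ ^ 4)
        (Ω : Type*) (mΩ : MeasurableSpace Ω) (P : Measure Ω) [IsProbabilityMeasure P]
        (ℱ : Filtration ℕ mΩ) (Z : ℕ → Ω → G.Play)
        (μ : ℕ → Ω → X → A → ℝ) (ν : ℕ → Ω → Y → B → ℝ)
        (_ : G.IsRun δ η τ T₀ P ℱ Z μ ν),
        1 - δ ≤ P.real {ω | ∀ t : ℕ,
          G.exploitabilityGap (μ t ω) (ν t ω) ≤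
            2 * K * τ * Real.log (((t : ℝ) + T₀) / δ) * ((t : ℝ) + T₀) ^ (-(1 / 4) : ℝ)} := by
  rcases le_or_gt 1 δ with hδ₁ | hδ₁
  · refine ⟨1, one_pos, ?_⟩
    intros
    exact (sub_nonpos.2 hδ₁).trans measureReal_nonneg
  obtain ⟨c, hc, hschedule⟩ := exists_isTrackingSchedule (le_max_right (K : ℝ) 1)
    (by positivity : 0 ≤ K * ((1 / (K : ℝ)) ^ K)⁻¹) hδ hδ₁
  refine ⟨c, hc, ?_⟩
  intro S X Y A B _ _ _ _ _ G hK η τ T₀ hη hτ hT₀ hητ hηc hητ_le hT₀_le Ω mΩ P _ ℱ Z μ ν hrun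
  obtain ⟨r, k, w, u, hs⟩ := hschedule η τ T₀ hη hτ hT₀ hητ hηc hητ_le hT₀_le
  have hcard : Fintype.card ((X × A) ⊕ (Y × B)) = K := by
    rw [Fintype.card_sum, Fintype.card_prod, Fintype.card_prod, ← hK, mul_comm (Fintype.card X),
      mul_comm (Fintype.card Y)]
  rw [max_eq_left (Nat.one_le_cast.2 (hcard ▸ hrun.card_pos))] at hs
  simpa only [regStrength, mul_assoc] using
    hrun.one_sub_le_measureReal_exploitabilityGap_le hδ hcard hs
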